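/- \textbf{Theorem.} Let $\gamma>2$. Let $\mu_2$ be the isometry-invariant measure on the space $\mathcal L^2$ of un-sensed lines of the plane $\mathbb R^2$, given by $\mu_2(d\ell)=\tfrac12\,dr\,d\theta$, where $\theta\in[0,\pi)$ is the angle of $\ell$ with the first coordinate axis and $r\in\mathbb R$ is its signed distance from the origin. Let $\Pi$ be a Poisson point process on $\mathcal L^2\times(0,\infty)$ with intensity measure $(\gamma-1)\,v^{-\gamma}\,dv\,\mu_2(d\ell)$; a point $(\ell,v)$ of $\Pi$ is a line $\ell$ with speed-limit $v$. For $v>0$ let $\mathcal S_v=\bigcup\{\ell : (\ell,w)\in\Pi,\ w\ge v\}$. A $\Pi$-path of duration $T$ is a locally Lipschitz map $\xi:[0,T)\to\mathbb R^2$ such that, for every $v>0$, the set $\{t\in[0,T): |\xi'(t)|>v \text{ and } \xi(t)\notin\mathcal S_v\}$ is Lebesgue-null. It connects $x$ to $y$ if $T<\infty$ and $\xi$ extends continuously to $[0,T]$ with $\xi(0)=x$ and $\xi(T)=y$; by convention, the path of duration $T=0$ connects each point to itself. A $\Pi$-geodesic from $x$ to $y$ is a $\Pi$-path $\xi:[0,T]\to\mathbb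 R^2$ connecting $x$ to $y$ such that no $\Pi$-path of duration $S<T$ connects $x$ to $y$. Then, for any fixed points $x,y\in\mathbb R^2$, almost surely there is exactly one $\Pi$-geodesic from $x$ to $y$: one exists, and any two have the same duration $T$ and agree as maps on $[0,T]$. -/

import Mathlib

open MeasureTheory ProbabilityTheory

noncomputable section

/-- The Euclidean plane. -/
abbrev Plane : Type := EuclideanSpace ℝ (Fin 2)

/-- Line-space: the un-sensed (affine) lines of the plane. -/
def PlaneLine : Type :=
  {ℓ : AffineSubspace ℝ Plane // Module.finrank ℝ ℓ.direction = 1}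

namespace PlaneLine

/-- The points of a line. -/
def points (ℓ : PlaneLine) : Set Plane := {z | z ∈ ℓ.1}

/-- Unit vector making the angle `θ` with the first coordinate axis. -/
def unitDir (θ : ℝ) : Plane := !₂[Real.cos θ, Real.sin θ]

/-- Unit normal of the lines that make the angle `θ` with the first coordinate axis. -/
def unitNormal (θ : ℝ) : Plane := !₂[-Real.sin θ, Real.cos θ]

theorem unitDir_ne_zero (θ : ℝ) : unitDir θ ≠ 0 := by
  intro h
  have h0 : Real.cos θ = 0 := by simpa [unitDir] using congrArg (fun z : Plane => z 0) h
  have h1 : Real.sin θ = 0 := by simpa [unitDir] using congrArg (fun z : Plane => z 1) h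
  have := Real.sin_sq_add_cos_sq θ
  simp [h0, h1] at this

/-- The line with angle `p.1` to the first coordinate axis and signed distance `p.2` from the
origin. On `[0, π) × ℝ` this is a bijective parametrization of line-space. -/
def ofParam (p : ℝ × ℝ) : PlaneLine :=
  ⟨AffineSubspace.mk' (p.2 • unitNormal p.1) (Submodule.span ℝ {unitDir p.1}), by
    rw [AffineSubspace.direction_mk']
    exact finrank_span_singleton (unitDir_ne_zero p.1)⟩

/-- The Borel structure of line-space: a set of lines is measurable if and only if it is
measurable in the coordinates (angle, signed distance). -/
instance : MeasurableSpace PlaneLine := MeasurableSpace.map ofParam inferInstance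

theorem measurable_ofParam : Measurable ofParam := Measurable.of_le_map le_rfl

end PlaneLine

/-- The invariant line measure of the plane, `(1/2) dr dθ` for `θ ∈ [0, π)` and `r ∈ ℝ`. -/
def lineMeasure : Measure PlaneLine :=
  (2⁻¹ : ENNReal) •
    ((volume : Measure (ℝ × ℝ)).restrict (Set.Ico 0 Real.pi ×ˢ Set.univ)).map PlaneLine.ofParam

/-- The measure `(γ - 1) v ^ (-γ) dv` on the speeds `v > 0`. -/
def speedMeasure (γ : ℝ) : Measure ℝ :=
  ((volume : Measure ℝ).restrict (Set.Ioi 0)).withDensity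
    (fun v => ENNReal.ofReal ((γ - 1) * v ^ (-γ)))

/-- The intensity measure `(γ - 1) v ^ (-γ) dv μ₂(dℓ)` on lines marked with speed-limits. -/
def markedLineIntensity (γ : ℝ) : Measure (PlaneLine × ℝ) :=
  lineMeasure.prod (speedMeasure γ)

/-- `N` is a Poisson point process on `S` with (diffuse) intensity measure `Λ`, given as a random
set of points: the number of points in a measurable set `B` is a Poisson random variable of mean
`Λ B` (almost surely infinite if `Λ B = ∞`), and the numbers of points in finitely many pairwise
disjoint measurable sets are independent. -/
structure IsPoissonProcess {Ω S : Type*} [MeasurableSpace Ω] [MeasurableSpace S]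
    (P : Measure Ω) (Λ : Measure S) (N : Ω → Set S) : Prop where
  measurable_count : ∀ B : Set S, MeasurableSet B → Measurable fun ω => (N ω ∩ B).encard
  law_count : ∀ B : Set S, MeasurableSet B → Λ B ≠ ⊤ →
    P.map (fun ω => (N ω ∩ B).encard) =
      (poissonMeasure (Λ B).toNNReal).map (fun k : ℕ => (k : ℕ∞))
  count_eq_top : ∀ B : Set S, MeasurableSet B → Λ B = ⊤ → ∀ᵐ ω ∂P, (N ω ∩ B).encard = ⊤
  indep_count : ∀ (n : ℕ) (B : Fin n → Set S), (∀ i, MeasurableSet (B i)) →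
    (Pairwise fun i j => Disjoint (B i) (B j)) →
    iIndepFun (fun (i : Fin n) ω => (N ω ∩ B i).encard) P

/-- The silhouette at level `v`: the union of all lines with speed-limit at least `v`. -/
def silhouette (L : Set (PlaneLine × ℝ)) (v : ℝ) : Set Plane :=
  {z | ∃ ℓ w, (ℓ, w) ∈ L ∧ v ≤ w ∧ z ∈ ℓ.points}

/-- `ξ` restricted to `[0, T)` is a path that obeys the speed-limits of the marked lines `L`:
it is locally Lipschitz, and for every `v > 0` it spends almost no time outside the silhouette
at level `v` while moving faster than `v`. (`deriv ξ t` is the usual velocity for almost all `t` in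
`[0, T)`, and for `t` in `(0, T)` it does not depend on the values of `ξ` outside `[0, T)`.) -/
def IsSpeedLimitPath (L : Set (PlaneLine × ℝ)) (T : ℝ) (ξ : ℝ → Plane) : Prop :=
  LocallyLipschitzOn (Set.Ico 0 T) ξ ∧
    ∀ v : ℝ, 0 < v →
      volume {t : ℝ | t ∈ Set.Ico 0 T ∧ v < ‖deriv ξ t‖ ∧ ξ t ∉ silhouette L v} = 0

/-- `ξ` restricted to `[0, T]` is such a path from `x` to `y`, of finite duration `T`.
The case `T = 0` only adds the trivial path from a point to itself. -/
def Connects (L : Set (PlaneLine × ℝ)) (x y : Plane) (T : ℝ) (ξ : ℝ → Plane) : Prop :=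
  0 ≤ T ∧ IsSpeedLimitPath L T ξ ∧ ContinuousOn ξ (Set.Icc 0 T) ∧ ξ 0 = x ∧ ξ T = y

/-- `ξ` restricted to `[0, T]` is a minimum-time geodesic from `x` to `y`. -/
def IsLineGeodesic (L : Set (PlaneLine × ℝ)) (x y : Plane) (T : ℝ) (ξ : ℝ → Plane) : Prop :=
  Connects L x y T ξ ∧ ∀ S : ℝ, S < T → ∀ η : ℝ → Plane, ¬ Connects L x y S η

end

/-!
Existence is a compactness argument, and uniqueness follows from perturbing one random line at a
time.

*Runs.* A speed-limit path is replaced by a continuous path that moves by at most `v * (t - s)`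
during any time interval `[s, t]` in which it stays off the silhouette at level `v` (`IsRun`). This
derivative-free notion is closed under limits, so that the least travel time between two points is
attained as soon as it is finite (`SpeedRegular.reach_of_reachTime_le`). The lines are almost surely
locally finite at each level, and slow enough for runs not to escape in bounded time
(`ae_speedRegular`); the travel time between two given points is finite because one can zigzag
towards either of them along fast lines at the scales `2 ^ (-n)` (`ae_travelTime_ne_top`).

*Structure of minimal runs.* Near each time, a minimal run either avoids a given line or follows it
at its full speed (`IsMinimal.germ_right`), and every time interval contains one in which the run
follows some line (`IsMinimal.exists_follows`). Hence the set of points of a line that a minimal run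
visits is, up to isolated points, a finite union of intervals. An end point of such an interval is a
crossing with another line: otherwise rotating the line about one of its points would shorten a
travel time at an infinite rate (`IsMinimal.exists_crossing_of_departure`), while a lower
semicontinuous function of the angle does so at almost no angle (`volume_steepAt`).

*Uniqueness.* Changing the speed of one line changes the travel time with a rate given by the length
which a minimal run covers on that line. Two minimal runs with different lengths would produce a
corner of a monotone function, and such corners do not occur at a random speed (`ae_noCorner`). So
any two minimal runs cover the same length on each line. This length is a combination, with
coefficients `1` and `-1`, of the positions of the end points of the visited intervals, all of them
crossings; the crossings on a line are almost surely linearly independent over `ℚ`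
(`ae_indep_crossings`), so that the visited intervals on each line agree
(`IsIntervalUnion.fullRight_iff`). Two minimal runs that pass through a common point do so at the
same time, and the runs follow lines during a dense set of times, so they are equal
(`IsMinimal.eqOn`).

*Randomness.* The three genericity statements are instances of one principle, which replaces the
Mecke formula: given the other points of the process, the only point in a region `B` has a law that
is absolutely continuous with respect to the intensity (`IsPoissonProcess.ae_notMem_of_null`).
Countably many regions isolate all the lines. The measurability which this requires comes from
writing travel times as suprema of infima over chains of points in a countable dense set
(`iSup_chainTime`).
-/

open Set Filter Topology
open scoped ENNReal

/-! ### Runs: a derivative-free form of speed-limited paths -/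

/-- An additive relation on the subintervals of `[a, b]` holds for `[a, b]` as soon as it holds for
all short intervals that start, and all short intervals that end, at any given point. -/
theorem interval_induction {P : ℝ → ℝ → Prop} {a b : ℝ} (hab : a ≤ b) (hrefl : ∀ t, P t t)
    (htrans : ∀ r s t, a ≤ r → r ≤ s → s ≤ t → t ≤ b → P r s → P s t → P r t)
    (hright : ∀ t ∈ Ico a b, ∀ᶠ u in 𝓝[>] t, P t u)
    (hleft : ∀ t ∈ Ioc a b, ∀ᶠ u in 𝓝[<] t, P u t) : P a b := by
  set S : Set ℝ := {t | t ∈ Icc a b ∧ P a t} with hS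
  have haS : a ∈ S := ⟨left_mem_Icc.2 hab, hrefl a⟩
  have hbdd : BddAbove S := ⟨b, fun t ht => ht.1.2⟩
  set c := sSup S with hc
  have hac : a ≤ c := le_csSup hbdd haS
  have hcb : c ≤ b := csSup_le ⟨a, haS⟩ fun t ht => ht.1.2
  have hPc : P a c := by
    rcases hac.eq_or_lt with h | h
    · rw [← h]; exact hrefl a
    · obtain ⟨d, hd, hd'⟩ := (mem_nhdsLT_iff_exists_Ioo_subset).1 (hleft c ⟨h, hcb⟩)
      obtain ⟨s, hs, hds⟩ := exists_lt_of_lt_csSup ⟨a, haS⟩ (show d < sSup S from hd)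
      have hsc : s ≤ c := le_csSup hbdd hs
      rcases hsc.eq_or_lt with h' | h'
      · rw [← h']; exact hs.2
      · exact htrans a s c le_rfl hs.1.1 hsc hcb hs.2 (hd' ⟨hds, h'⟩)
  rcases hcb.eq_or_lt with h | h
  · rw [← h]; exact hPc
  · exfalso
    obtain ⟨d, hd, hd'⟩ := (mem_nhdsGT_iff_exists_Ioo_subset).1 (hright c ⟨hac, h⟩)
    have hcd : c < d := hd
    obtain ⟨e, he1, he2⟩ := exists_between (lt_min hcd h)
    have he2' := lt_min_iff.1 he2
    have : e ∈ S := ⟨⟨hac.trans he1.le, he2'.2.le⟩,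
      htrans a c e le_rfl hac he1.le he2'.2.le hPc (hd' ⟨he1, he2'.1⟩)⟩
    exact absurd (le_csSup hbdd this) (not_le.2 he1)

/-- A map `ξ : ℝ → ℝ²` is a run for the family of silhouettes `σ` if, for each `v > 0`, it is
`v`-Lipschitz across every time interval during which it avoids `σ v`. For locally finite families
of lines, these are exactly the speed-limited paths. -/
structure IsRun (σ : ℝ → Set Plane) (ξ : ℝ → Plane) : Prop where
  cont : Continuous ξ
  speed : ∀ v, 0 < v → ∀ s t, s ≤ t → (∀ u ∈ Icc s t, ξ u ∉ σ v) →
    dist (ξ s) (ξ t) ≤ v * (t - s)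

namespace IsRun

variable {σ σ' : ℝ → Set Plane} {ξ η : ℝ → Plane}

/-- Only the interior of the time interval needs to avoid the silhouette. -/
theorem speed_Ioo (h : IsRun σ ξ) {v s t : ℝ} (hv : 0 < v) (hst : s ≤ t)
    (ha : ∀ u ∈ Ioo s t, ξ u ∉ σ v) : dist (ξ s) (ξ t) ≤ v * (t - s) := by
  rcases hst.eq_or_lt with rfl | hst
  · simp
  have h1 : Tendsto (fun e : ℝ => dist (ξ (s + e)) (ξ (t - e))) (𝓝[>] 0)
      (𝓝 (dist (ξ (s + 0)) (ξ (t - 0)))) := by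
    refine (Continuous.tendsto ?_ 0).mono_left nhdsWithin_le_nhds
    have := h.cont
    fun_prop
  have h2 : Tendsto (fun e : ℝ => v * ((t - e) - (s + e))) (𝓝[>] 0)
      (𝓝 (v * ((t - 0) - (s + 0)))) := by
    refine (Continuous.tendsto ?_ 0).mono_left nhdsWithin_le_nhds
    fun_prop
  simp only [add_zero, sub_zero] at h1 h2
  refine le_of_tendsto_of_tendsto h1 h2 ?_
  have : ∀ᶠ e : ℝ in 𝓝[>] 0, e ∈ Ioo 0 ((t - s) / 2) := Ioo_mem_nhdsGT (by linarith)
  filter_upwards [this] with e he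
  refine h.speed v hv _ _ (by linarith [he.2]) fun u hu => ha u ⟨?_, ?_⟩
  · linarith [hu.1, he.1]
  · linarith [hu.2, he.1]

theorem dist_le_of_forall_gt (h : IsRun σ ξ) {w s t : ℝ} (hw : 0 ≤ w) (hst : s ≤ t)
    (ha : ∀ v, w < v → ∀ u ∈ Ioo s t, ξ u ∉ σ v) : dist (ξ s) (ξ t) ≤ w * (t - s) := by
  have h2 : Tendsto (fun v : ℝ => v * (t - s)) (𝓝[>] w) (𝓝 (w * (t - s))) := by
    refine (Continuous.tendsto ?_ w).mono_left nhdsWithin_le_nhds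
    fun_prop
  refine ge_of_tendsto h2 ?_
  filter_upwards [self_mem_nhdsWithin] with v hv
  exact h.speed_Ioo (hw.trans_lt hv) hst (ha v hv)

theorem mono (h : IsRun σ ξ) (hσ : ∀ v, 0 < v → σ v ⊆ σ' v) : IsRun σ' ξ :=
  ⟨h.cont, fun v hv s t hst ha => h.speed v hv s t hst fun u hu hu' => ha u hu (hσ v hv hu')⟩

theorem reverse (h : IsRun σ ξ) (c : ℝ) : IsRun σ (fun t => ξ (c - t)) := by
  refine ⟨h.cont.comp (by fun_prop), fun v hv s t hst ha => ?_⟩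
  have := h.speed v hv (c - t) (c - s) (by linarith) fun u hu => by
    have := ha (c - u) ⟨by linarith [hu.2], by linarith [hu.1]⟩
    simpa using this
  rw [dist_comm]
  calc _ ≤ _ := this
    _ = _ := by ring

theorem translate (h : IsRun σ ξ) (c : ℝ) : IsRun σ (fun t => ξ (t + c)) := by
  refine ⟨h.cont.comp (by fun_prop), fun v hv s t hst ha => ?_⟩
  have := h.speed v hv (s + c) (t + c) (by linarith) fun u hu => by
    have := ha (u - c) ⟨by linarith [hu.1], by linarith [hu.2]⟩
    simpa using this
  calc _ ≤ _ := this
    _ = _ := by ring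

theorem const (z : Plane) : IsRun σ (fun _ => z) :=
  ⟨continuous_const, fun v hv s t hst _ => by
    rw [dist_self]; exact mul_nonneg hv.le (by linarith)⟩

/-- A path on `[a, b]` that obeys the silhouettes, stopped outside `[a, b]`, is a run. -/
theorem clamp {a b : ℝ} (hab : a ≤ b) (hc : ContinuousOn ξ (Icc a b))
    (h : ∀ v, 0 < v → ∀ s t, a ≤ s → s ≤ t → t ≤ b → (∀ u ∈ Icc s t, ξ u ∉ σ v) →
      dist (ξ s) (ξ t) ≤ v * (t - s)) : IsRun σ (fun t => ξ (max a (min b t))) := by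
  have hmem : ∀ t, max a (min b t) ∈ Icc a b := fun t =>
    ⟨le_max_left _ _, max_le hab (min_le_left _ _)⟩
  refine ⟨hc.comp_continuous (by fun_prop) hmem, fun v hv s t hst ha => ?_⟩
  have hmono : max a (min b s) ≤ max a (min b t) := max_le_max le_rfl (min_le_min le_rfl hst)
  refine (h v hv _ _ (hmem s).1 hmono (hmem t).2 ?_).trans ?_
  · intro u hu
    -- the truncation maps `[s, t]` onto the interval between the truncated end points
    have hcont : ContinuousOn (fun t : ℝ => max a (min b t)) (Icc s t) := by fun_prop
    obtain ⟨r, hr, hru⟩ := intermediate_value_Icc hst hcont hu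
    have := ha r hr
    simp only at hru
    rwa [hru] at this
  · refine mul_le_mul_of_nonneg_left ?_ hv.le
    rcases max_cases a (min b t) with h1 | h1 <;> rcases max_cases a (min b s) with h2 | h2 <;>
    rcases min_cases b t with h3 | h3 <;> rcases min_cases b s with h4 | h4 <;> linarith

theorem concat (h : IsRun σ ξ) (h' : IsRun σ η) {c : ℝ} (hc : ξ c = η c) :
    IsRun σ (fun t => if t ≤ c then ξ t else η t) := by
  refine ⟨?_, fun v hv s t hst ha => ?_⟩
  · refine Continuous.if_le h.cont h'.cont continuous_id continuous_const ?_
    rintro x rfl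
    exact hc
  · by_cases htc : t ≤ c
    · have hsc : s ≤ c := hst.trans htc
      simp only [htc, hsc, if_true]
      refine h.speed v hv s t hst fun u hu => ?_
      have := ha u hu
      simpa only [hu.2.trans htc, if_true] using this
    push Not at htc
    have key : ∀ r, c ≤ r → r ≤ t → s ≤ r → dist (η r) (η t) ≤ v * (t - r) := by
      intro r hr hrt hsr
      refine h'.speed v hv r t hrt fun u hu => ?_
      have := ha u ⟨hsr.trans hu.1, hu.2⟩
      rcases (hr.trans hu.1).eq_or_lt with h1 | h1
      · subst h1
        simp only [le_refl, if_true, hc] at this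
        exact this
      · simpa only [not_le.2 h1, if_false] using this
    by_cases hsc : s ≤ c
    · simp only [hsc, if_true, not_le.2 htc, if_false]
      have h1 : dist (ξ s) (ξ c) ≤ v * (c - s) := by
        refine h.speed v hv s c hsc fun u hu => ?_
        have := ha u ⟨hu.1, hu.2.trans htc.le⟩
        simpa only [hu.2, if_true] using this
      have h2 := key c le_rfl htc.le hsc
      calc dist (ξ s) (η t) ≤ dist (ξ s) (ξ c) + dist (ξ c) (η t) := dist_triangle _ _ _
        _ ≤ v * (c - s) + v * (t - c) := by rw [hc] at h1 ⊢; gcongr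
        _ = _ := by ring
    · push Not at hsc
      simp only [not_le.2 htc, not_le.2 hsc, if_false]
      exact key s hsc.le hst le_rfl

/-- The straight segment from `p` to `q` can be run at the speed `w` if it lies in the silhouettes
at all levels up to `w`. -/
theorem exists_segment {w : ℝ} (hw : 0 < w) {p q : Plane}
    (hpq : ∀ v, 0 < v → v ≤ w → ∀ c : ℝ, AffineMap.lineMap p q c ∈ σ v) :
    ∃ ξ, IsRun σ ξ ∧ ξ 0 = p ∧ ξ (dist p q / w) = q := by
  by_cases hd : p = q
  · subst hd
    exact ⟨_, const p, rfl, rfl⟩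
  have hd' : 0 < dist p q := dist_pos.2 hd
  refine ⟨fun t => AffineMap.lineMap p q (t * w / dist p q), ⟨?_, ?_⟩, by simp, ?_⟩
  · exact AffineMap.lineMap_continuous.comp (by fun_prop)
  · intro v hv s t hst ha
    have hvw : w < v := by
      by_contra! hvw
      exact ha s ⟨le_rfl, hst⟩ (hpq v hv hvw _)
    rw [dist_lineMap_lineMap, Real.dist_eq, abs_sub_comm, abs_of_nonneg]
    · have : (t * w / dist p q - s * w / dist p q) * dist p q = w * (t - s) := by
        field_simp
      rw [this]
      exact mul_le_mul_of_nonneg_right hvw.le (by linarith)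
    · rw [← sub_div]
      have : 0 ≤ t * w - s * w := by nlinarith
      positivity
  · have : dist p q / w * w / dist p q = 1 := by field_simp
    simp [this]

end IsRun

/-- `u'` can be reached from `u` within time `t` by a run. -/
def Reach (σ : ℝ → Set Plane) (u u' : Plane) (t : ℝ) : Prop :=
  0 ≤ t ∧ ∃ ξ, IsRun σ ξ ∧ ξ 0 = u ∧ ξ t = u'

theorem IsRun.reach {σ : ℝ → Set Plane} {ξ : ℝ → Plane} (h : IsRun σ ξ) {s t : ℝ} (hst : s ≤ t) :
    Reach σ (ξ s) (ξ t) (t - s) :=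
  ⟨by linarith, _, h.translate s, by simp, by simp⟩

namespace Reach

variable {σ σ' : ℝ → Set Plane} {u u' u'' : Plane} {t t' : ℝ}

/-- The run can be taken to rest outside the time interval `[0, t]`. -/
theorem exists_clamped (h : Reach σ u u' t) :
    ∃ ξ, IsRun σ ξ ∧ (∀ s, s ≤ 0 → ξ s = u) ∧ ∀ s, t ≤ s → ξ s = u' := by
  obtain ⟨ht, ξ, hξ, h0, h1⟩ := h
  refine ⟨_, IsRun.clamp (ξ := ξ) ht hξ.cont.continuousOn
    (fun v hv s r _ hsr _ => hξ.speed v hv s r hsr), fun s hs => ?_, fun s hs => ?_⟩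
  · rw [min_eq_right (hs.trans ht), max_eq_left hs, h0]
  · rw [min_eq_left hs, max_eq_right ht, h1]

theorem mono_time (h : Reach σ u u' t) (htt' : t ≤ t') : Reach σ u u' t' := by
  obtain ⟨ξ, hξ, h0, h1⟩ := h.exists_clamped
  exact ⟨h.1.trans htt', ξ, hξ, h0 0 le_rfl, h1 _ htt'⟩

theorem mono (h : Reach σ u u' t) (hσ : ∀ v, 0 < v → σ v ⊆ σ' v) : Reach σ' u u' t := by
  obtain ⟨ht, ξ, hξ, h0, h1⟩ := h
  exact ⟨ht, ξ, hξ.mono hσ, h0, h1⟩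

theorem refl (σ : ℝ → Set Plane) (u : Plane) : Reach σ u u 0 := ⟨le_rfl, _, IsRun.const u, rfl, rfl⟩

theorem symm (h : Reach σ u u' t) : Reach σ u' u t := by
  obtain ⟨ht, ξ, hξ, h0, h1⟩ := h
  exact ⟨ht, _, hξ.reverse t, by simpa using h1, by simpa using h0⟩

theorem trans (h : Reach σ u u' t) (h' : Reach σ u' u'' t') : Reach σ u u'' (t + t') := by
  obtain ⟨ht, ξ, hξ, h0, h1⟩ := h
  obtain ⟨ht', η, hη, h0', h1'⟩ := h'
  refine ⟨add_nonneg ht ht', _, hξ.concat (hη.translate (-t)) (c := t) ?_, ?_, ?_⟩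
  · rw [h1, add_neg_cancel, h0']
  · rw [if_pos ht, h0]
  · split_ifs with h
    · have : t' = 0 := by linarith
      subst this
      rw [add_zero, h1, ← h0', h1']
    · rw [add_comm t t', add_neg_cancel_right, h1']

theorem segment {w : ℝ} (hw : 0 < w)
    (h : ∀ v, 0 < v → v ≤ w → ∀ c : ℝ, AffineMap.lineMap u u' c ∈ σ v) :
    Reach σ u u' (dist u u' / w) := by
  obtain ⟨ξ, hξ, h0, h1⟩ := IsRun.exists_segment hw h
  exact ⟨by positivity, ξ, hξ, h0, h1⟩

end Reach

/-- From scale `2 ^ k₀` on, the disc of radius `2 ^ k` meets no silhouette at a level above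
`2 ^ k`. -/
def Tame (σ : ℝ → Set Plane) (k₀ : ℕ) : Prop :=
  ∀ k, k₀ ≤ k → ∀ v : ℝ, 2 ^ k < v → ∀ z : Plane, ‖z‖ ≤ 2 ^ k → z ∉ σ v

/-- In a tame family every doubling of the distance from the origin takes at least half a unit of
time, so that runs of bounded duration stay bounded. -/
theorem Tame.norm_le {σ : ℝ → Set Plane} {k₀ k : ℕ} (h : Tame σ k₀) (hk : k₀ ≤ k)
    {ξ : ℝ → Plane} (hξ : IsRun σ ξ) (h0 : ‖ξ 0‖ ≤ 2 ^ k) (j : ℕ) :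
    ∀ t : ℝ, 0 ≤ t → t ≤ j / 2 → ‖ξ t‖ ≤ 2 ^ (k + j) := by
  induction j with
  | zero =>
    intro t ht ht'
    have : t = 0 := by simp at ht'; linarith
    simpa [this] using h0
  | succ j ih =>
    intro t ht ht'
    set a := min t (j / 2 : ℝ) with ha
    have ha0 : 0 ≤ a := le_min ht (by positivity)
    have hat : a ≤ t := min_le_left _ _
    have hna := ih a ha0 (min_le_right _ _)
    by_contra! hlt
    push_cast at ht'
    have hta : t - a ≤ 1 / 2 := by
      rcases min_cases t (j / 2 : ℝ) with h | h <;> linarith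
    set R : ℝ := 2 ^ (k + (j + 1)) with hR
    have hRR : R = 2 * 2 ^ (k + j) := by rw [hR, ← add_assoc, pow_succ]; ring
    have hpos : (0 : ℝ) < 2 ^ (k + j) := by positivity
    -- the first time after `a` at which the circle of radius `R` is reached
    set S : Set ℝ := {s | s ∈ Icc a t ∧ R ≤ ‖ξ s‖} with hS
    have hScl : IsClosed S := by
      have : S = Icc a t ∩ (fun s => ‖ξ s‖) ⁻¹' Ici R := rfl
      rw [this]
      exact isClosed_Icc.inter (isClosed_Ici.preimage hξ.cont.norm)
    have htS : t ∈ S := ⟨⟨hat, le_rfl⟩, hlt.le⟩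
    have hSb : BddBelow S := ⟨a, fun s hs => hs.1.1⟩
    have hs := hScl.csInf_mem ⟨t, htS⟩ hSb
    set s := sInf S with hsdef
    have hbefore : ∀ r ∈ Ioo a s, ‖ξ r‖ ≤ R := by
      intro r hr
      by_contra! hr'
      exact absurd (csInf_le hSb (show r ∈ S from ⟨⟨hr.1.le, hr.2.le.trans hs.1.2⟩, hr'.le⟩))
        (not_le.2 hr.2)
    have hspeed : dist (ξ a) (ξ s) ≤ R * (s - a) := by
      refine hξ.dist_le_of_forall_gt (by positivity) hs.1.1 fun v hv u hu => ?_
      exact h (k + (j + 1)) (by omega) v hv _ (hbefore u hu)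
    have hsa : 0 ≤ s - a := by linarith [hs.1.1]
    have hdist : ‖ξ s‖ - ‖ξ a‖ ≤ dist (ξ a) (ξ s) := by
      rw [dist_comm, dist_eq_norm]; exact norm_sub_norm_le _ _
    have h2 : R ≤ ‖ξ s‖ := hs.2
    have hst : s = t := by
      have : (1 : ℝ) / 2 ≤ s - a := by nlinarith
      linarith [hs.1.2]
    have h3 : R * (s - a) ≤ R * (1 / 2) := by
      rw [hst]; exact mul_le_mul_of_nonneg_left hta (by positivity)
    rw [hst] at h3 hspeed hdist
    linarith

/-- Runs of bounded duration from a bounded set, at rest outside their time interval, have a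
common Lipschitz constant. -/
theorem Tame.dist_le {σ : ℝ → Set Plane} {k₀ k j : ℕ} (h : Tame σ k₀) (hk : k₀ ≤ k)
    {ξ : ℝ → Plane} (hξ : IsRun σ ξ) {T : ℝ} (hT0 : 0 ≤ T) (hT : T ≤ j / 2)
    (h0 : ∀ s, s ≤ 0 → ξ s = ξ 0) (h1 : ∀ s, T ≤ s → ξ s = ξ T) (hn : ‖ξ 0‖ ≤ 2 ^ k) :
    (∀ t, ‖ξ t‖ ≤ 2 ^ (k + j)) ∧ ∀ s t, s ≤ t → dist (ξ s) (ξ t) ≤ 2 ^ (k + j) * (t - s) := by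
  have hb : ∀ t, ‖ξ t‖ ≤ 2 ^ (k + j) := by
    intro t
    rcases le_total t 0 with ht | ht
    · rw [h0 t ht]
      exact hn.trans (pow_le_pow_right₀ (by norm_num) (by omega))
    · rcases le_total T t with ht' | ht'
      · rw [h1 t ht']
        exact h.norm_le hk hξ hn j T hT0 hT
      · exact h.norm_le hk hξ hn j t ht (ht'.trans hT)
  refine ⟨hb, fun s t hst => hξ.dist_le_of_forall_gt (by positivity) hst fun v hv u _ => ?_⟩
  exact h (k + j) (by omega) v hv _ (hb u)

/-- Closedness of reachability: limits of runs are runs. The families of silhouettes are uniformly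
tame, and each point outside the limit silhouette keeps away from the approximating ones. The
limit run is the pointwise limit along an ultrafilter. -/
theorem Reach.of_tendsto {ι : Type*} {l : Filter ι} [l.NeBot] {σ' : ι → ℝ → Set Plane}
    {σ : ℝ → Set Plane} {k₀ : ℕ} (htame : ∀ i, Tame (σ' i) k₀)
    (happrox : ∀ v, 0 < v → ∀ z, z ∉ σ v → ∃ ε > 0, ∀ᶠ i in l, ∀ z', dist z' z < ε → z' ∉ σ' i v)
    {u u' : ι → Plane} {t : ι → ℝ} {u₀ u₀' : Plane} {t₀ : ℝ} (hu : Tendsto u l (𝓝 u₀))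
    (hu' : Tendsto u' l (𝓝 u₀')) (ht : Tendsto t l (𝓝 t₀))
    (h : ∀ᶠ i in l, Reach (σ' i) (u i) (u' i) (t i)) : Reach σ u₀ u₀' t₀ := by
  classical
  set F : Ultrafilter ι := Ultrafilter.of l with hF
  have hFl : (F : Filter ι) ≤ l := Ultrafilter.of_le l
  replace hu := hu.mono_left hFl
  replace hu' := hu'.mono_left hFl
  replace ht := ht.mono_left hFl
  replace h := h.filter_mono hFl
  have ht₀ : 0 ≤ t₀ := ge_of_tendsto ht (h.mono fun i hi => hi.1)
  obtain ⟨k, hk₀, hk⟩ : ∃ k, k₀ ≤ k ∧ ‖u₀‖ + 1 ≤ 2 ^ k := by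
    obtain ⟨n, hn⟩ := pow_unbounded_of_one_lt (‖u₀‖ + 1) (by norm_num : (1 : ℝ) < 2)
    exact ⟨max k₀ n, le_max_left _ _, hn.le.trans
      (pow_le_pow_right₀ (by norm_num) (le_max_right _ _))⟩
  obtain ⟨j, hj⟩ : ∃ j : ℕ, t₀ + 1 ≤ j / 2 := by
    obtain ⟨n, hn⟩ := exists_nat_ge (2 * (t₀ + 1))
    exact ⟨n, by linarith⟩
  set M : ℝ := 2 ^ (k + j) with hM
  have hMpos : 0 < M := by positivity
  have hex : ∀ᶠ i in (F : Filter ι), ∃ ξ : ℝ → Plane, IsRun (σ' i) ξ ∧ ξ 0 = u i ∧ ξ (t i) = u' i ∧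
      (∀ s, ‖ξ s‖ ≤ M) ∧ ∀ s r, s ≤ r → dist (ξ s) (ξ r) ≤ M * (r - s) := by
    have hu1 : ∀ᶠ i in (F : Filter ι), ‖u i‖ < ‖u₀‖ + 1 :=
      hu.norm.eventually (gt_mem_nhds (by linarith))
    have ht1 : ∀ᶠ i in (F : Filter ι), t i < t₀ + 1 := ht.eventually (gt_mem_nhds (by linarith))
    filter_upwards [h, hu1, ht1] with i hi hui hti
    obtain ⟨ξ, hξ, h0, h1⟩ := hi.exists_clamped
    have := (htame i).dist_le hk₀ hξ hi.1 (hti.le.trans hj)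
      (fun s hs => by rw [h0 s hs, h0 0 le_rfl]) (fun s hs => by rw [h1 s hs, h1 _ le_rfl])
      (by rw [h0 0 le_rfl]; exact hui.le.trans hk)
    exact ⟨ξ, hξ, h0 0 le_rfl, h1 _ le_rfl, this.1, this.2⟩
  obtain ⟨ξ, hξ⟩ := hex.choice
  simp only [eventually_and] at hξ
  obtain ⟨hrun, h0, h1, hbd, hlip⟩ := hξ
  have hlim : ∀ s, ∃ z, Tendsto (fun i => ξ i s) F (𝓝 z) := by
    intro s
    have hc : IsCompact (Metric.closedBall (0 : Plane) M) := isCompact_closedBall _ _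
    obtain ⟨z, -, hz⟩ := hc.ultrafilter_le_nhds (F.map fun i => ξ i s) (by
      rw [Ultrafilter.coe_map, le_principal_iff, mem_map]
      filter_upwards [hbd] with i hi
      simpa using hi s)
    exact ⟨z, hz⟩
  choose ζ hζ using hlim
  have hζlip : ∀ s r, s ≤ r → dist (ζ s) (ζ r) ≤ M * (r - s) := by
    intro s r hsr
    refine le_of_tendsto ((hζ s).dist (hζ r)) ?_
    filter_upwards [hlip] with i hi using hi s r hsr
  have hζc : Continuous ζ := by
    refine (LipschitzWith.of_dist_le_mul (K := M.toNNReal) fun s r => ?_).continuous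
    rw [Real.coe_toNNReal _ hMpos.le, Real.dist_eq]
    rcases le_total s r with hsr | hsr
    · rw [abs_sub_comm, abs_of_nonneg (by linarith)]; exact hζlip s r hsr
    · rw [dist_comm, abs_of_nonneg (by linarith)]; exact hζlip r s hsr
  refine ⟨ht₀, ζ, ⟨hζc, fun v hv s r hsr ha => ?_⟩, ?_, ?_⟩
  · -- the bound is local in time, and locally it is inherited from the approximating runs
    have hloc : ∀ a ∈ Icc s r, ∃ δ > 0, ∀ p q, p ≤ q → |p - a| < δ → |q - a| < δ →
        dist (ζ p) (ζ q) ≤ v * (q - p) := by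
      intro a has
      obtain ⟨ε, hε, hev⟩ := happrox v hv (ζ a) (ha a has)
      refine ⟨ε / (2 * M), by positivity, fun p q hpq hp hq => ?_⟩
      refine le_of_tendsto ((hζ p).dist (hζ q)) ?_
      have hclose : ∀ᶠ i in (F : Filter ι), dist (ξ i a) (ζ a) < ε / 2 :=
        (hζ a).eventually (Metric.ball_mem_nhds _ (by positivity))
      filter_upwards [hlip, hrun, hclose, hev.filter_mono hFl] with i hi hri hci hevi
      refine hri.speed v hv p q hpq fun b hb => hevi _ ?_
      have hb' : |b - a| < ε / (2 * M) := by
        rw [abs_lt] at hp hq ⊢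
        constructor <;> linarith [hb.1, hb.2, hp.1, hp.2, hq.1, hq.2]
      have h3 : dist (ξ i b) (ξ i a) ≤ M * |b - a| := by
        rcases le_total b a with hba | hba
        · rw [abs_sub_comm, abs_of_nonneg (by linarith)]; exact hi b a hba
        · rw [dist_comm, abs_of_nonneg (by linarith)]; exact hi a b hba
      have h4 : M * |b - a| < ε / 2 := by
        calc M * |b - a| < M * (ε / (2 * M)) := mul_lt_mul_of_pos_left hb' hMpos
          _ = ε / 2 := by field_simp
      calc dist (ξ i b) (ζ a) ≤ dist (ξ i b) (ξ i a) + dist (ξ i a) (ζ a) := dist_triangle _ _ _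
        _ < ε := by linarith
    refine interval_induction (P := fun p q => dist (ζ p) (ζ q) ≤ v * (q - p)) hsr
      (fun p => by simp) (fun p q m _ _ _ _ h1 h2 => ?_) (fun a ha' => ?_) (fun a ha' => ?_)
    · calc dist (ζ p) (ζ m) ≤ dist (ζ p) (ζ q) + dist (ζ q) (ζ m) := dist_triangle _ _ _
        _ ≤ v * (q - p) + v * (m - q) := add_le_add h1 h2
        _ = _ := by ring
    · obtain ⟨δ, hδ, hδ'⟩ := hloc a ⟨ha'.1, ha'.2.le⟩
      filter_upwards [Ioo_mem_nhdsGT (show a < a + δ by linarith)] with b hb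
      exact hδ' a b hb.1.le (by simpa using hδ) (by rw [abs_of_pos] <;> linarith [hb.1, hb.2])
    · obtain ⟨δ, hδ, hδ'⟩ := hloc a ⟨ha'.1.le, ha'.2⟩
      filter_upwards [Ioo_mem_nhdsLT (show a - δ < a by linarith)] with b hb
      exact hδ' b a hb.2.le (by rw [abs_of_neg] <;> linarith [hb.1, hb.2]) (by simpa using hδ)
  · refine tendsto_nhds_unique (hζ 0) (hu.congr' ?_)
    filter_upwards [h0] with i hi using hi.symm
  · refine tendsto_nhds_unique (hζ t₀) ?_
    have h5 : Tendsto (fun i => dist (ξ i t₀) (u' i)) F (𝓝 0) := by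
      have h6 : Tendsto (fun i => M * |t i - t₀|) F (𝓝 0) := by
        have : Tendsto (fun i => M * |t i - t₀|) F (𝓝 (M * |t₀ - t₀|)) :=
          ((ht.sub tendsto_const_nhds).abs).const_mul M
        simpa using this
      refine squeeze_zero' (Eventually.of_forall fun _ => dist_nonneg) ?_ h6
      filter_upwards [hlip, h1] with i hi h1i
      rw [← h1i]
      rcases le_total t₀ (t i) with hba | hba
      · rw [abs_of_nonneg (by linarith)]; exact hi _ _ hba
      · rw [dist_comm, abs_sub_comm, abs_of_nonneg (by linarith)]; exact hi _ _ hba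
    exact (tendsto_iff_of_dist h5).2 hu'

/-! ### Coordinates on the plane and on line-space -/

theorem dist_sq_coord (z z' : Plane) : dist z z' ^ 2 = (z 0 - z' 0) ^ 2 + (z 1 - z' 1) ^ 2 := by
  rw [EuclideanSpace.dist_eq, Real.sq_sqrt (by positivity), Fin.sum_univ_two, Real.dist_eq,
    Real.dist_eq, sq_abs, sq_abs]

/-- Signed distance of `z` from the line with angle `p.1` and signed distance `p.2` from the
origin. -/
noncomputable def height (p : ℝ × ℝ) (z : Plane) : ℝ :=
  -Real.sin p.1 * z 0 + Real.cos p.1 * z 1 - p.2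

/-- Coordinate of the orthogonal projection of `z` to the direction of angle `θ`. -/
noncomputable def along (θ : ℝ) (z : Plane) : ℝ := Real.cos θ * z 0 + Real.sin θ * z 1

theorem continuous_height : Continuous fun q : (ℝ × ℝ) × Plane => height q.1 q.2 := by
  unfold height; fun_prop

theorem continuous_height_right (p : ℝ × ℝ) : Continuous (height p) := by
  unfold height; fun_prop

theorem continuous_along_right (θ : ℝ) : Continuous (along θ) := by
  unfold along; fun_prop

theorem dist_sq_along_height (p : ℝ × ℝ) (z z' : Plane) :
    dist z z' ^ 2 = (along p.1 z - along p.1 z') ^ 2 + (height p z - height p z') ^ 2 := by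
  rw [dist_sq_coord, along, along, height, height]
  have := Real.sin_sq_add_cos_sq p.1
  linear_combination (-(z 0 - z' 0) ^ 2 - (z 1 - z' 1) ^ 2) * this

theorem abs_height_sub_le (p : ℝ × ℝ) (z z' : Plane) :
    |height p z - height p z'| ≤ dist z z' := by
  refine abs_le_of_sq_le_sq ?_ dist_nonneg
  rw [dist_sq_along_height p]; nlinarith [sq_nonneg (along p.1 z - along p.1 z')]

theorem abs_along_sub_le (θ : ℝ) (z z' : Plane) :
    |along θ z - along θ z'| ≤ dist z z' := by
  refine abs_le_of_sq_le_sq ?_ dist_nonneg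
  rw [dist_sq_along_height (θ, 0)]; nlinarith [sq_nonneg (height (θ, 0) z - height (θ, 0) z')]

namespace PlaneLine

theorem mem_points_ofParam {p : ℝ × ℝ} {z : Plane} :
    z ∈ (ofParam p).points ↔ height p z = 0 := by
  have hcs := Real.sin_sq_add_cos_sq p.1
  change z ∈ (AffineSubspace.mk' (p.2 • unitNormal p.1) (Submodule.span ℝ {unitDir p.1}) :
    AffineSubspace ℝ Plane) ↔ _
  rw [AffineSubspace.mem_mk', Submodule.mem_span_singleton]
  constructor
  · rintro ⟨a, ha⟩
    have h0 : a * Real.cos p.1 = z 0 - p.2 * -Real.sin p.1 := by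
      simpa [unitDir, unitNormal] using congrArg (fun z : Plane => z 0) ha
    have h1 : a * Real.sin p.1 = z 1 - p.2 * Real.cos p.1 := by
      simpa [unitDir, unitNormal] using congrArg (fun z : Plane => z 1) ha
    rw [height]
    linear_combination Real.sin p.1 * h0 - Real.cos p.1 * h1 + p.2 * hcs
  · intro h
    rw [height] at h
    refine ⟨along p.1 z, ?_⟩
    ext i
    fin_cases i
    · simp [unitDir, unitNormal, along]
      linear_combination Real.sin p.1 * h + z 0 * hcs
    · simp [unitDir, unitNormal, along]
      linear_combination (-Real.cos p.1) * h + z 1 * hcs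

theorem ext_points {ℓ ℓ' : PlaneLine} (h : ∀ z, z ∈ ℓ.points ↔ z ∈ ℓ'.points) : ℓ = ℓ' := by
  apply Subtype.ext
  ext z
  exact h z

theorem exists_unitDir {v : Plane} (hv : v ≠ 0) :
    ∃ θ ∈ Ico 0 Real.pi, ∃ a : ℝ, a ≠ 0 ∧ v = a • unitDir θ := by
  obtain ⟨θ, a, ha, hva⟩ : ∃ θ a : ℝ, a ≠ 0 ∧ v = a • unitDir θ := by
    set c : ℂ := ⟨v 0, v 1⟩ with hc
    have hc0 : c ≠ 0 := by
      intro h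
      apply hv
      have h0 := congrArg Complex.re h
      have h1 := congrArg Complex.im h
      ext i; fin_cases i
      · simpa using h0
      · simpa using h1
    refine ⟨c.arg, ‖c‖, by simpa using hc0, ?_⟩
    ext i; fin_cases i
    · simp [unitDir, Complex.norm_mul_cos_arg, c]
    · simp [unitDir, Complex.norm_mul_sin_arg, c]
  -- shifting the angle by a multiple of `π` changes the direction at most by its sign
  have key : ∀ k : ℤ, ∃ a : ℝ, a ≠ 0 ∧ v = a • unitDir (θ - k * Real.pi) := by
    intro k
    refine ⟨(-1) ^ k * a, mul_ne_zero (zpow_ne_zero _ (by norm_num)) ha, ?_⟩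
    have h1 : ((-1 : ℝ) ^ k) * ((-1 : ℝ) ^ k) = 1 := by
      rw [← zpow_add₀ (by norm_num : (-1 : ℝ) ≠ 0), ← two_mul, zpow_mul]; norm_num
    rw [hva]
    ext i; fin_cases i
    · simp [unitDir, Real.cos_sub_int_mul_pi]
      linear_combination (-(a * Real.cos θ)) * h1
    · simp [unitDir, Real.sin_sub_int_mul_pi]
      linear_combination (-(a * Real.sin θ)) * h1
  obtain ⟨b, hb, hvb⟩ := key ⌊θ / Real.pi⌋
  refine ⟨_, ⟨?_, ?_⟩, b, hb, hvb⟩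
  · have := Int.floor_le (θ / Real.pi)
    rw [le_div_iff₀ Real.pi_pos] at this
    linarith
  · have := Int.lt_floor_add_one (θ / Real.pi)
    rw [div_lt_iff₀ Real.pi_pos] at this
    linarith

theorem exists_ofParam (ℓ : PlaneLine) : ∃ p : ℝ × ℝ, p.1 ∈ Ico 0 Real.pi ∧ ofParam p = ℓ := by
  obtain ⟨s, hs⟩ := ℓ
  obtain ⟨v, hv, hspan⟩ := finrank_eq_one_iff'.1 hs
  have hv' : (v : Plane) ≠ 0 := by simpa using hv
  have hne : (s : Set Plane).Nonempty := by
    rw [AffineSubspace.nonempty_iff_ne_bot]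
    rintro rfl
    rw [AffineSubspace.direction_bot, finrank_bot] at hs
    exact absurd hs (by norm_num)
  obtain ⟨z₀, hz₀⟩ := hne
  obtain ⟨θ, hθ, a, ha, hva⟩ := exists_unitDir hv'
  have hθs : Real.sin θ ^ 2 + Real.cos θ ^ 2 = 1 := Real.sin_sq_add_cos_sq θ
  refine ⟨(θ, height (θ, 0) z₀), hθ, ext_points fun z => ?_⟩
  rw [mem_points_ofParam]
  change _ ↔ z ∈ s
  have h1 : z ∈ s ↔ z - z₀ ∈ s.direction := by
    rw [← vsub_eq_sub, AffineSubspace.vsub_right_mem_direction_iff_mem hz₀]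
  rw [h1]
  have h2 : z - z₀ ∈ s.direction ↔ ∃ c : ℝ, c • (v : Plane) = z - z₀ := by
    constructor
    · intro h
      obtain ⟨c, hc⟩ := hspan ⟨_, h⟩
      exact ⟨c, by simpa using congrArg Subtype.val hc⟩
    · rintro ⟨c, hc⟩
      rw [← hc]
      exact s.direction.smul_mem c v.2
  rw [h2]
  constructor
  · intro h
    simp only [height] at h
    refine ⟨a⁻¹ * (along θ z - along θ z₀), ?_⟩
    rw [hva, smul_smul, mul_right_comm, inv_mul_cancel₀ ha, one_mul]
    ext i; fin_cases i
    · simp [unitDir, along]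
      linear_combination Real.sin θ * h + (z 0 - z₀ 0) * hθs
    · simp [unitDir, along]
      linear_combination (-Real.cos θ) * h + (z 1 - z₀ 1) * hθs
  · rintro ⟨c, hc⟩
    rw [hva] at hc
    have h0 : c * (a * Real.cos θ) = z 0 - z₀ 0 := by
      simpa [unitDir] using congrArg (fun z : Plane => z 0) hc
    have h1 : c * (a * Real.sin θ) = z 1 - z₀ 1 := by
      simpa [unitDir] using congrArg (fun z : Plane => z 1) hc
    simp only [height]
    linear_combination Real.sin θ * h0 - Real.cos θ * h1

theorem ofParam_injOn : InjOn ofParam {p : ℝ × ℝ | p.1 ∈ Ico 0 Real.pi} := by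
  rintro ⟨θ, r⟩ hθ ⟨θ', r'⟩ hθ' h
  have hiff : ∀ z, height (θ, r) z = 0 → height (θ', r') z = 0 := fun z hz => by
    rw [← mem_points_ofParam, h, mem_points_ofParam] at hz; exact hz
  have hcs := Real.sin_sq_add_cos_sq θ
  have h1 := hiff !₂[-r * Real.sin θ, r * Real.cos θ] (by
    simp [height]; linear_combination r * hcs)
  have h2 := hiff !₂[-r * Real.sin θ + Real.cos θ, r * Real.cos θ + Real.sin θ] (by
    simp [height]; linear_combination r * hcs)
  simp [height] at h1 h2 hθ hθ'
  have h3 : Real.sin (θ - θ') = 0 := by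
    rw [Real.sin_sub]; linear_combination h2 - h1
  have h4 : θ = θ' := by
    by_contra hne
    rcases lt_or_gt_of_ne hne with hlt | hlt
    · have := Real.sin_neg_of_neg_of_neg_pi_lt (show θ - θ' < 0 by linarith) (by linarith)
      linarith
    · have := Real.sin_pos_of_pos_of_lt_pi (show 0 < θ - θ' by linarith) (by linarith)
      linarith
  subst h4
  refine Prod.ext rfl ?_
  change r = r'
  linear_combination h1 - r * hcs

/-- The coordinates (angle in `[0, π)`, signed distance from the origin) of a line. -/
noncomputable def rep (ℓ : PlaneLine) : ℝ × ℝ := ℓ.exists_ofParam.choose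

theorem rep_mem (ℓ : PlaneLine) : ℓ.rep.1 ∈ Ico 0 Real.pi := ℓ.exists_ofParam.choose_spec.1

@[simp] theorem ofParam_rep (ℓ : PlaneLine) : ofParam ℓ.rep = ℓ := ℓ.exists_ofParam.choose_spec.2

theorem rep_injective : Function.Injective rep := fun ℓ ℓ' h => by
  rw [← ofParam_rep ℓ, h, ofParam_rep]

theorem rep_ofParam {p : ℝ × ℝ} (hp : p.1 ∈ Ico 0 Real.pi) : (ofParam p).rep = p :=
  ofParam_injOn (rep_mem _) hp (ofParam_rep _)

theorem mem_points {ℓ : PlaneLine} {z : Plane} : z ∈ ℓ.points ↔ height ℓ.rep z = 0 := by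
  rw [← mem_points_ofParam, ofParam_rep]

theorem ofParam_sub_int_mul_pi (p : ℝ × ℝ) (k : ℤ) :
    ofParam (p.1 - k * Real.pi, (-1) ^ k * p.2) = ofParam p := by
  refine ext_points fun z => ?_
  rw [mem_points_ofParam, mem_points_ofParam]
  simp only [height, Real.sin_sub_int_mul_pi, Real.cos_sub_int_mul_pi]
  have h0 : (-1 : ℝ) ^ k ≠ 0 := zpow_ne_zero _ (by norm_num)
  rw [show -((-1) ^ k * Real.sin p.1) * z 0 + (-1) ^ k * Real.cos p.1 * z 1 - (-1) ^ k * p.2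
    = (-1) ^ k * (-Real.sin p.1 * z 0 + Real.cos p.1 * z 1 - p.2) by ring, mul_eq_zero]
  simp [h0]

theorem measurable_rep : Measurable rep := by
  have h : Measurable fun p : ℝ × ℝ =>
      ((p.1 - ⌊p.1 / Real.pi⌋ * Real.pi, (-1 : ℝ) ^ ⌊p.1 / Real.pi⌋ * p.2) : ℝ × ℝ) := by
    have hfl : Measurable fun p : ℝ × ℝ => ⌊p.1 / Real.pi⌋ :=
      Int.measurable_floor.comp (measurable_fst.div_const _)
    have h1 : Measurable fun k : ℤ => (k : ℝ) := measurable_from_top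
    have h2 : Measurable fun k : ℤ => (-1 : ℝ) ^ k := measurable_from_top
    exact (measurable_fst.sub ((h1.comp hfl).mul_const _)).prodMk
      ((h2.comp hfl).mul measurable_snd)
  intro s hs
  change MeasurableSet (ofParam ⁻¹' (rep ⁻¹' s))
  have : ofParam ⁻¹' (rep ⁻¹' s) = (fun p : ℝ × ℝ =>
      ((p.1 - ⌊p.1 / Real.pi⌋ * Real.pi, (-1 : ℝ) ^ ⌊p.1 / Real.pi⌋ * p.2) : ℝ × ℝ)) ⁻¹' s := by
    ext p
    simp only [mem_preimage]
    rw [← ofParam_sub_int_mul_pi p ⌊p.1 / Real.pi⌋, rep_ofParam]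
    constructor
    · have := Int.floor_le (p.1 / Real.pi)
      rw [le_div_iff₀ Real.pi_pos] at this
      simp only
      linarith
    · have := Int.lt_floor_add_one (p.1 / Real.pi)
      rw [div_lt_iff₀ Real.pi_pos] at this
      simp only
      linarith
  rw [this]
  exact h hs

theorem isClosed_points (ℓ : PlaneLine) : IsClosed ℓ.points := by
  have : ℓ.points = height ℓ.rep ⁻¹' {0} := by ext z; exact mem_points
  rw [this]
  exact isClosed_singleton.preimage (continuous_height_right _)

theorem lineMap_mem {ℓ : PlaneLine} {p q : Plane} (hp : p ∈ ℓ.points) (hq : q ∈ ℓ.points) (c : ℝ) :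
    AffineMap.lineMap p q c ∈ ℓ.points := AffineMap.lineMap_mem c hp hq

theorem dist_eq_of_mem {ℓ : PlaneLine} {p q : Plane} (hp : p ∈ ℓ.points) (hq : q ∈ ℓ.points) :
    dist p q = |along ℓ.rep.1 p - along ℓ.rep.1 q| := by
  rw [mem_points] at hp hq
  have := dist_sq_along_height ℓ.rep p q
  rw [hp, hq, sub_zero, zero_pow two_ne_zero, add_zero, ← sq_abs (along _ _ - _)] at this
  exact (pow_left_inj₀ dist_nonneg (abs_nonneg _) two_ne_zero).1 this

/-- Foot of the perpendicular from `z` to the line with parameters `p`. -/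
noncomputable def foot (p : ℝ × ℝ) (z : Plane) : Plane := z - height p z • unitNormal p.1

theorem height_foot (p : ℝ × ℝ) (z : Plane) : height p (foot p z) = 0 := by
  have hcs := Real.sin_sq_add_cos_sq p.1
  simp [foot, unitNormal, height]
  linear_combination (-(-(Real.sin p.1 * z 0) + Real.cos p.1 * z 1 - p.2)) * hcs

theorem dist_foot (p : ℝ × ℝ) (z : Plane) : dist z (foot p z) = |height p z| := by
  have hcs := Real.sin_sq_add_cos_sq p.1
  have h := dist_sq_along_height p z (foot p z)
  rw [height_foot, sub_zero] at h
  have h2 : along p.1 (foot p z) = along p.1 z := by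
    simp [foot, unitNormal, along]; ring
  rw [h2, sub_self, zero_pow two_ne_zero, zero_add, ← sq_abs (height p z)] at h
  exact (pow_left_inj₀ dist_nonneg (abs_nonneg _) two_ne_zero).1 h

end PlaneLine

/-! ### Travel times -/

/-- The infimum of the durations of the runs from `u` to `u'`. -/
noncomputable def reachTime (σ : ℝ → Set Plane) (u u' : Plane) : ℝ≥0∞ :=
  ⨅ (t : ℝ) (_ : Reach σ u u' t), ENNReal.ofReal t

section reachTime

variable {σ σ' : ℝ → Set Plane} {u u' u'' : Plane} {t : ℝ}

theorem Reach.reachTime_le (h : Reach σ u u' t) : reachTime σ u u' ≤ ENNReal.ofReal t :=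
  iInf₂_le t h

theorem reach_of_reachTime_lt (h : reachTime σ u u' < ENNReal.ofReal t) : Reach σ u u' t := by
  simp only [reachTime, iInf_lt_iff] at h
  obtain ⟨s, hs, hst⟩ := h
  exact hs.mono_time (ENNReal.ofReal_lt_ofReal_iff'.1 hst).1.le

theorem reachTime_self (σ : ℝ → Set Plane) (u : Plane) : reachTime σ u u = 0 := by
  simpa using (Reach.refl σ u).reachTime_le

theorem reachTime_comm (σ : ℝ → Set Plane) (u u' : Plane) :
    reachTime σ u u' = reachTime σ u' u :=
  le_antisymm (le_iInf₂ fun _ h => h.symm.reachTime_le) (le_iInf₂ fun _ h => h.symm.reachTime_le)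

theorem reachTime_triangle (σ : ℝ → Set Plane) (u u' u'' : Plane) :
    reachTime σ u u'' ≤ reachTime σ u u' + reachTime σ u' u'' := by
  conv_rhs => rw [reachTime, reachTime]
  simp only [ENNReal.iInf_add, ENNReal.add_iInf]
  refine le_iInf fun t' => le_iInf fun h' => le_iInf fun t => le_iInf fun h => ?_
  rw [← ENNReal.ofReal_add h.1 h'.1]
  exact (h.trans h').reachTime_le

theorem reachTime_anti (hσ : ∀ v, 0 < v → σ v ⊆ σ' v) : reachTime σ' u u' ≤ reachTime σ u u' :=
  le_iInf₂ fun _ h => (h.mono hσ).reachTime_le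

theorem reachTime_le_segment {w : ℝ} (hw : 0 < w)
    (h : ∀ v, 0 < v → v ≤ w → ∀ c : ℝ, AffineMap.lineMap u u' c ∈ σ v) :
    reachTime σ u u' ≤ edist u u' / ENNReal.ofReal w := by
  refine (Reach.segment hw h).reachTime_le.trans_eq ?_
  rw [ENNReal.ofReal_div_of_pos hw, edist_dist]

end reachTime

/-- A family of lines with speeds is regular if only finitely many lines with speed at least `v`
meet any given disc, and if its silhouettes are tame. -/
structure SpeedRegular (C : Set (PlaneLine × ℝ)) (k₀ : ℕ) : Prop where
  locFin : ∀ R v : ℝ, 0 < v → {m ∈ C | v ≤ m.2 ∧ ∃ z ∈ m.1.points, ‖z‖ ≤ R}.Finite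
  tame : Tame (silhouette C) k₀

theorem silhouette_mono {C C' : Set (PlaneLine × ℝ)} (h : C ⊆ C') (v : ℝ) :
    silhouette C v ⊆ silhouette C' v := by
  rintro z ⟨ℓ, w, hm, hvw, hz⟩
  exact ⟨ℓ, w, h hm, hvw, hz⟩

theorem mem_silhouette_insert {C : Set (PlaneLine × ℝ)} {m : PlaneLine × ℝ} {v : ℝ} {z : Plane} :
    z ∈ silhouette (insert m C) v ↔ (v ≤ m.2 ∧ z ∈ m.1.points) ∨ z ∈ silhouette C v := by
  constructor
  · rintro ⟨ℓ, w, hm, hvw, hz⟩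
    rcases hm with rfl | hm
    · exact Or.inl ⟨hvw, hz⟩
    · exact Or.inr ⟨ℓ, w, hm, hvw, hz⟩
  · rintro (⟨h1, h2⟩ | ⟨ℓ, w, hm, hvw, hz⟩)
    · exact ⟨m.1, m.2, mem_insert _ _, h1, h2⟩
    · exact ⟨ℓ, w, mem_insert_of_mem _ hm, hvw, hz⟩

namespace SpeedRegular

variable {C C' : Set (PlaneLine × ℝ)} {k₀ : ℕ}

theorem subset (h : SpeedRegular C k₀) (hC : C' ⊆ C) : SpeedRegular C' k₀ :=
  ⟨fun R v hv => (h.locFin R v hv).subset fun _ hm => ⟨hC hm.1, hm.2⟩,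
    fun k hk v hv z hz hz' => h.tame k hk v hv z hz (silhouette_mono hC v hz')⟩

theorem mono (h : SpeedRegular C k₀) {k₁ : ℕ} (hk : k₀ ≤ k₁) : SpeedRegular C k₁ :=
  ⟨h.locFin, fun k hk' => h.tame k (hk.trans hk')⟩

theorem insert (h : SpeedRegular C k₀) {m : PlaneLine × ℝ} (hm : m.2 ≤ 2 ^ k₀) :
    SpeedRegular (insert m C) k₀ := by
  refine ⟨fun R v hv => ((h.locFin R v hv).insert m).subset ?_, fun k hk v hv z hz hz' => ?_⟩
  · rintro m' ⟨hm' | hm', h2⟩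
    · exact Or.inl hm'
    · exact Or.inr ⟨hm', h2⟩
  · rcases mem_silhouette_insert.1 hz' with ⟨h1, -⟩ | h1
    · have : (2 : ℝ) ^ k₀ ≤ 2 ^ k := pow_le_pow_right₀ (by norm_num) hk
      linarith
    · exact h.tame k hk v hv z hz h1

theorem isClosed_silhouette (h : SpeedRegular C k₀) {v : ℝ} (hv : 0 < v) :
    ∀ z, z ∉ silhouette C v → ∃ ε > 0, ∀ z', dist z' z < ε → z' ∉ silhouette C v := by
  intro z hz
  set F := {m ∈ C | v ≤ m.2 ∧ ∃ z' ∈ m.1.points, ‖z'‖ ≤ ‖z‖ + 1} with hF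
  have hfin : F.Finite := h.locFin _ v hv
  have hcl : IsClosed (⋃ m ∈ F, m.1.points) :=
    hfin.isClosed_biUnion fun m _ => m.1.isClosed_points
  have hz' : z ∈ (⋃ m ∈ F, m.1.points)ᶜ := by
    simp only [mem_compl_iff, mem_iUnion, not_exists]
    intro m hm hzm
    exact hz ⟨m.1, m.2, hm.1, hm.2.1, hzm⟩
  obtain ⟨ε, hε, hball⟩ := Metric.isOpen_iff.1 hcl.isOpen_compl z hz'
  refine ⟨min ε 1, lt_min hε one_pos, fun z' hzz' hz's => ?_⟩
  obtain ⟨ℓ, w, hm, hvw, hzℓ⟩ := hz's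
  refine hball (Metric.mem_ball.2 (hzz'.trans_le (min_le_left _ _))) ?_
  refine mem_iUnion₂.2 ⟨(ℓ, w), ⟨hm, hvw, z', hzℓ, ?_⟩, hzℓ⟩
  have h1 : dist z' z < 1 := hzz'.trans_le (min_le_right _ _)
  have h2 : ‖z'‖ - ‖z‖ ≤ dist z' z := by rw [dist_eq_norm]; exact norm_sub_norm_le _ _
  linarith

theorem reach_of_tendsto {ι : Type*} {l : Filter ι} [l.NeBot] (h : SpeedRegular C k₀)
    {u u' : ι → Plane} {t : ι → ℝ} {u₀ u₀' : Plane} {t₀ : ℝ} (hu : Tendsto u l (𝓝 u₀))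
    (hu' : Tendsto u' l (𝓝 u₀')) (ht : Tendsto t l (𝓝 t₀))
    (hr : ∀ᶠ i in l, Reach (silhouette C) (u i) (u' i) (t i)) :
    Reach (silhouette C) u₀ u₀' t₀ :=
  Reach.of_tendsto (σ' := fun _ => silhouette C) (fun _ => h.tame)
    (fun v hv z hz => by
      obtain ⟨ε, hε, hz'⟩ := h.isClosed_silhouette hv z hz
      exact ⟨ε, hε, Eventually.of_forall fun _ => hz'⟩) hu hu' ht hr

/-- Travel times are attained. -/
theorem reach_of_reachTime_le (h : SpeedRegular C k₀) {u u' : Plane} {t : ℝ}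
    (ht : 0 ≤ t) (hr : reachTime (silhouette C) u u' ≤ ENNReal.ofReal t) :
    Reach (silhouette C) u u' t := by
  have h1 : Tendsto (fun n : ℕ => t + 1 / ((n : ℝ) + 1)) atTop (𝓝 (t + 0)) :=
    tendsto_const_nhds.add tendsto_one_div_add_atTop_nhds_zero_nat
  rw [add_zero] at h1
  refine h.reach_of_tendsto tendsto_const_nhds tendsto_const_nhds h1
    (Eventually.of_forall fun n => reach_of_reachTime_lt (hr.trans_lt ?_))
  have : 0 < 1 / ((n : ℝ) + 1) := by positivity
  exact (ENNReal.ofReal_lt_ofReal_iff (by positivity)).2 (by linarith)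

end SpeedRegular

/-- The travel time between two points, for the marked lines `C`. -/
noncomputable abbrev travelTime (C : Set (PlaneLine × ℝ)) (u u' : Plane) : ℝ≥0∞ :=
  reachTime (silhouette C) u u'

theorem travelTime_anti {C C' : Set (PlaneLine × ℝ)} (h : C ⊆ C') (u u' : Plane) :
    travelTime C' u u' ≤ travelTime C u u' := reachTime_anti fun v _ => silhouette_mono h v

theorem travelTime_le_of_mem {C : Set (PlaneLine × ℝ)} {m : PlaneLine × ℝ} (hm : m ∈ C)
    (hw : 0 < m.2) {p q : Plane} (hp : p ∈ m.1.points) (hq : q ∈ m.1.points) :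
    travelTime C p q ≤ edist p q / ENNReal.ofReal m.2 :=
  reachTime_le_segment hw fun _ _ hv c => ⟨m.1, m.2, hm, hv, PlaneLine.lineMap_mem hp hq c⟩

/-- The travel time depends in a lower semicontinuous way on the position of one of the lines. -/
theorem lowerSemicontinuous_travelTime {X : Type*} [TopologicalSpace X]
    {C : Set (PlaneLine × ℝ)} {k₀ : ℕ} (h : SpeedRegular C k₀) {w : ℝ} (hw : w ≤ 2 ^ k₀)
    {p : X → ℝ × ℝ} (hp : Continuous p) (u u' : Plane) :
    LowerSemicontinuous fun x => travelTime (insert (PlaneLine.ofParam (p x), w) C) u u' := by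
  intro x₀ y hy
  by_contra hcon
  have hfr : ∃ᶠ x in 𝓝 x₀,
      travelTime (insert (PlaneLine.ofParam (p x), w) C) u u' ≤ y := by
    simpa [not_eventually] using hcon
  set A := {x | travelTime (insert (PlaneLine.ofParam (p x), w) C) u u' ≤ y} with hA
  have hne : (𝓝 x₀ ⊓ 𝓟 A).NeBot := frequently_mem_iff_neBot.1 hfr
  have hytop : y ≠ ⊤ := ne_top_of_lt hy
  have hyy : ENNReal.ofReal y.toReal = y := ENNReal.ofReal_toReal hytop
  have hreach : Reach (silhouette (insert (PlaneLine.ofParam (p x₀), w) C)) u u' y.toReal := by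
    refine Reach.of_tendsto (l := 𝓝 x₀ ⊓ 𝓟 A) (u := fun _ => u) (u' := fun _ => u')
      (t := fun _ => y.toReal)
      (σ' := fun x => silhouette (insert (PlaneLine.ofParam (p x), w) C))
      (fun x => (h.insert (m := (PlaneLine.ofParam (p x), w)) hw).tame) (fun v hv z hz => ?_)
      tendsto_const_nhds tendsto_const_nhds tendsto_const_nhds ?_
    · rw [mem_silhouette_insert, not_or] at hz
      obtain ⟨ε, hε, hz'⟩ := h.isClosed_silhouette hv z hz.2
      by_cases hvw : v ≤ w
      · have h0 : height (p x₀) z ≠ 0 := fun h0 =>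
          hz.1 ⟨hvw, PlaneLine.mem_points_ofParam.2 h0⟩
        have hc : Continuous fun x => |height (p x) z| :=
          (continuous_height.comp (hp.prodMk continuous_const)).abs
        have hev : ∀ᶠ x in 𝓝 x₀, |height (p x₀) z| / 2 < |height (p x) z| :=
          hc.continuousAt.eventually (lt_mem_nhds (by
            have := abs_pos.2 h0
            linarith))
        refine ⟨min ε (|height (p x₀) z| / 2), lt_min hε (by have := abs_pos.2 h0; linarith), ?_⟩
        filter_upwards [hev.filter_mono inf_le_left] with x hx z' hzz' hmem
        rcases mem_silhouette_insert.1 hmem with ⟨-, h1⟩ | h1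
        · have h1' := PlaneLine.mem_points_ofParam.1 h1
          have h2 := abs_height_sub_le (p x) z' z
          rw [h1', zero_sub, abs_neg] at h2
          have := hzz'.trans_le (min_le_right _ _)
          linarith
        · exact hz' z' (hzz'.trans_le (min_le_left _ _)) h1
      · refine ⟨ε, hε, Eventually.of_forall fun x z' hzz' hmem => ?_⟩
        rcases mem_silhouette_insert.1 hmem with ⟨h1, -⟩ | h1
        · exact hvw h1
        · exact hz' z' hzz' h1
    · have hAmem : ∀ᶠ x in 𝓝 x₀ ⊓ 𝓟 A, x ∈ A := mem_inf_of_right (mem_principal_self A)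
      filter_upwards [hAmem] with x hx
      refine (h.insert hw).reach_of_reachTime_le ENNReal.toReal_nonneg ?_
      rw [hyy]
      exact hx
  have := hreach.reachTime_le
  rw [hyy] at this
  exact absurd this (not_le.2 hy)

/-! ### Approximation of travel times by chains -/

/-- Families of silhouettes that allow, in addition, free movement at the speed `1 / (n + 1)`. -/
def slowed (C : Set (PlaneLine × ℝ)) (n : ℕ) (v : ℝ) : Set Plane :=
  {z | v ≤ 1 / ((n : ℝ) + 1) ∨ z ∈ silhouette C v}

/-- Time needed to go from `z` to `z'` by way of the line `m`, where the line is reached and left at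
the speed `1 / (n + 1)`. -/
noncomputable def stepCost (n : ℕ) (m : PlaneLine × ℝ) (z z' : Plane) : ℝ≥0∞ :=
  (n + 1) * ENNReal.ofReal |height m.1.rep z| + edist z z' / ENNReal.ofReal m.2 +
    (n + 1) * ENNReal.ofReal |height m.1.rep z'|

/-- Cost of a step that uses at most one of the lines. -/
noncomputable def netCost (C : Set (PlaneLine × ℝ)) (n : ℕ) (z z' : Plane) : ℝ≥0∞ :=
  min ((n + 1) * edist z z') (⨅ m ∈ C, stepCost n m z z')

/-- A dense sequence of the plane. -/
noncomputable def net (i : ℕ) : Plane := TopologicalSpace.denseSeq Plane i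

theorem denseRange_net : DenseRange net := TopologicalSpace.denseRange_denseSeq Plane

/-- Least cost of a chain of `k + 1` steps through points of the dense sequence. -/
noncomputable def chainCost (C : Set (PlaneLine × ℝ)) (n : ℕ) : ℕ → ℕ → ℕ → ℝ≥0∞
  | 0, i, j => netCost C n (net i) (net j)
  | k + 1, i, j => ⨅ m, chainCost C n k i m + netCost C n (net m) (net j)

/-- Least cost of a chain from `u` to `u'` through points of the dense sequence. -/
noncomputable def chainTime (C : Set (PlaneLine × ℝ)) (n : ℕ) (u u' : Plane) : ℝ≥0∞ :=
  ⨅ (k : ℕ) (i : ℕ) (j : ℕ),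
    ((n + 1) * edist u (net i) + chainCost C n k i j + (n + 1) * edist (net j) u')

section chain

variable {C : Set (PlaneLine × ℝ)} {n : ℕ} {k₀ : ℕ}

theorem reachTime_slowed_le_edist (u u' : Plane) :
    reachTime (slowed C n) u u' ≤ (n + 1) * edist u u' := by
  have hpos : (0 : ℝ) < 1 / ((n : ℝ) + 1) := by positivity
  refine (reachTime_le_segment (w := 1 / ((n : ℝ) + 1)) hpos fun v _ hv c => Or.inl hv).trans_eq ?_
  rw [one_div, ENNReal.ofReal_inv_of_pos (by positivity), div_eq_mul_inv, inv_inv, mul_comm,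
    ENNReal.ofReal_add (by positivity) zero_le_one, ENNReal.ofReal_natCast, ENNReal.ofReal_one]

theorem reachTime_slowed_le_stepCost {m : PlaneLine × ℝ} (hm : m ∈ C) (z z' : Plane) :
    reachTime (slowed C n) z z' ≤ stepCost n m z z' := by
  rcases le_or_gt m.2 0 with hw | hw
  · rw [stepCost, ENNReal.ofReal_of_nonpos hw]
    by_cases hz : z = z'
    · subst hz; rw [reachTime_self]; exact zero_le
    · rw [ENNReal.div_zero (edist_pos.2 hz).ne']
      simp
  set f := PlaneLine.foot m.1.rep z with hf
  set f' := PlaneLine.foot m.1.rep z' with hf'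
  have h1 : reachTime (slowed C n) z f ≤ (n + 1) * ENNReal.ofReal |height m.1.rep z| := by
    refine (reachTime_slowed_le_edist z f).trans_eq ?_
    rw [edist_dist, PlaneLine.dist_foot]
  have h3 : reachTime (slowed C n) f' z' ≤ (n + 1) * ENNReal.ofReal |height m.1.rep z'| := by
    rw [reachTime_comm]
    refine (reachTime_slowed_le_edist z' f').trans_eq ?_
    rw [edist_dist, PlaneLine.dist_foot]
  have hmf : f ∈ m.1.points := PlaneLine.mem_points.2 (PlaneLine.height_foot _ _)
  have hmf' : f' ∈ m.1.points := PlaneLine.mem_points.2 (PlaneLine.height_foot _ _)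
  have h2 : reachTime (slowed C n) f f' ≤ edist z z' / ENNReal.ofReal m.2 := by
    refine (reachTime_le_segment hw fun v _ hv c =>
      Or.inr ⟨m.1, m.2, hm, hv, PlaneLine.lineMap_mem hmf hmf' c⟩).trans ?_
    refine ENNReal.div_le_div_right ?_ _
    rw [edist_dist, edist_dist]
    refine ENNReal.ofReal_le_ofReal ?_
    have e : ∀ z, along m.1.rep.1 (PlaneLine.foot m.1.rep z) = along m.1.rep.1 z := by
      intro z
      simp [PlaneLine.foot, PlaneLine.unitNormal, along]; ring
    rw [PlaneLine.dist_eq_of_mem hmf hmf', e, e]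
    exact abs_along_sub_le _ _ _
  calc reachTime (slowed C n) z z' ≤ reachTime (slowed C n) z f + reachTime (slowed C n) f z' :=
        reachTime_triangle _ _ _ _
    _ ≤ reachTime (slowed C n) z f + (reachTime (slowed C n) f f' +
          reachTime (slowed C n) f' z') := by gcongr; exact reachTime_triangle _ _ _ _
    _ ≤ _ := by rw [stepCost, add_assoc]; gcongr

theorem reachTime_slowed_le_netCost (z z' : Plane) :
    reachTime (slowed C n) z z' ≤ netCost C n z z' :=
  le_min (reachTime_slowed_le_edist z z')
    (le_iInf₂ fun _ hm => reachTime_slowed_le_stepCost hm z z')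

theorem reachTime_slowed_le_chainCost (k i j : ℕ) :
    reachTime (slowed C n) (net i) (net j) ≤ chainCost C n k i j := by
  induction k generalizing j with
  | zero => exact reachTime_slowed_le_netCost _ _
  | succ k ih =>
    refine le_iInf fun m => (reachTime_triangle _ _ (net m) _).trans ?_
    exact add_le_add (ih m) (reachTime_slowed_le_netCost _ _)

theorem reachTime_slowed_le_chainTime (u u' : Plane) :
    reachTime (slowed C n) u u' ≤ chainTime C n u u' := by
  refine le_iInf fun k => le_iInf fun i => le_iInf fun j => ?_
  refine (reachTime_triangle _ _ (net j) _).trans (add_le_add ?_ (reachTime_slowed_le_edist _ _))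
  exact (reachTime_triangle _ _ (net i) _).trans
    (add_le_add (reachTime_slowed_le_edist _ _) (reachTime_slowed_le_chainCost _ _ _))

theorem chainCost_append (k k' i j i' j' : ℕ) :
    chainCost C n (k + k' + 2) i j' ≤
      chainCost C n k i j + netCost C n (net j) (net i') + chainCost C n k' i' j' := by
  induction k' generalizing j' with
  | zero =>
    refine (iInf_le _ i').trans (add_le_add ?_ le_rfl)
    exact iInf_le _ j
  | succ k' ih =>
    conv_rhs => rw [chainCost]
    rw [ENNReal.add_iInf]
    exact le_iInf fun m => (iInf_le _ m).trans
      ((add_le_add_left (ih m) _).trans_eq (add_assoc _ _ _))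

theorem chainTime_triangle (u u' u'' : Plane) :
    chainTime C n u u'' ≤ chainTime C n u u' + chainTime C n u' u'' := by
  conv_rhs => rw [chainTime, chainTime]
  simp only [ENNReal.iInf_add, ENNReal.add_iInf]
  refine le_iInf fun k' => le_iInf fun i' => le_iInf fun j' => le_iInf fun k => le_iInf fun i =>
    le_iInf fun j => ?_
  refine (iInf_le _ (k + k' + 2)).trans ((iInf_le _ i).trans ((iInf_le _ j').trans ?_))
  have h1 : netCost C n (net j) (net i') ≤
      (n + 1) * edist (net j) u' + (n + 1) * edist u' (net i') := by
    refine (min_le_left _ _).trans ?_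
    rw [← mul_add]
    gcongr
    exact edist_triangle _ _ _
  calc _ ≤ (n + 1) * edist u (net i) + (chainCost C n k i j + ((n + 1) * edist (net j) u' +
            (n + 1) * edist u' (net i')) + chainCost C n k' i' j') +
            (n + 1) * edist (net j') u'' := by
        gcongr
        exact (chainCost_append k k' i j i' j').trans (by gcongr)
    _ = _ := by ring

theorem natCast_add_one_ne_top : ((n : ℝ≥0∞) + 1) ≠ ⊤ := by simp

theorem chainTime_le_edist (u u' : Plane) : chainTime C n u u' ≤ (n + 1) * edist u u' := by
  have hc : Continuous fun z : Plane => ((n : ℝ≥0∞) + 1) * edist u z + (n + 1) * edist z u' := by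
    have := ENNReal.continuous_const_mul (natCast_add_one_ne_top (n := n))
    exact (this.comp (by fun_prop)).add (this.comp (by fun_prop))
  have key : ∀ z : Plane, chainTime C n u u' ≤ (n + 1) * edist u z + (n + 1) * edist z u' := by
    intro z
    refine denseRange_net.induction_on z (isClosed_le continuous_const hc) fun i => ?_
    refine (iInf_le _ 0).trans ((iInf_le _ i).trans ((iInf_le _ i).trans ?_))
    have h0 : chainCost C n 0 i i = 0 := by
      have : netCost C n (net i) (net i) ≤ (n + 1) * edist (net i) (net i) := min_le_left _ _
      rw [edist_self, mul_zero] at this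
      exact le_antisymm this zero_le
    rw [h0, add_zero]
  simpa using key u

theorem chainTime_le_of_mem {m : PlaneLine × ℝ} (hm : m ∈ C) (hw : 0 < m.2) {p q : Plane}
    (hp : p ∈ m.1.points) (hq : q ∈ m.1.points) :
    chainTime C n p q ≤ edist p q / ENNReal.ofReal m.2 := by
  have hc : Continuous fun z : Plane × Plane => ((n : ℝ≥0∞) + 1) * edist p z.1 +
      stepCost n m z.1 z.2 + (n + 1) * edist z.2 q := by
    have h1 := ENNReal.continuous_const_mul (natCast_add_one_ne_top (n := n))
    have h2 : Continuous fun a : ℝ≥0∞ => a / ENNReal.ofReal m.2 :=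
      ENNReal.continuous_div_const _ (by simpa using hw)
    have h3 := continuous_height_right m.1.rep
    unfold stepCost
    refine ((h1.comp (by fun_prop)).add (((h1.comp ?_).add (h2.comp (by fun_prop))).add
      (h1.comp ?_))).add (h1.comp (by fun_prop))
    · exact ENNReal.continuous_ofReal.comp (h3.comp continuous_fst).abs
    · exact ENNReal.continuous_ofReal.comp (h3.comp continuous_snd).abs
  have key : ∀ z : Plane × Plane, chainTime C n p q ≤ (n + 1) * edist p z.1 +
      stepCost n m z.1 z.2 + (n + 1) * edist z.2 q := by
    intro z
    refine (denseRange_net.prodMap denseRange_net).induction_on z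
      (isClosed_le continuous_const hc) fun ij => ?_
    refine (iInf_le _ 0).trans ((iInf_le _ ij.1).trans ((iInf_le _ ij.2).trans ?_))
    change _ ≤ (n + 1) * edist p (net ij.1) + stepCost n m (net ij.1) (net ij.2) +
      (n + 1) * edist (net ij.2) q
    gcongr
    exact (min_le_right _ _).trans (iInf₂_le (f := fun m _ => stepCost n m _ _) m hm)
  have := key (p, q)
  rw [PlaneLine.mem_points] at hp hq
  simpa [stepCost, hp, hq] using this

/-- A quantity that behaves like a travel time with free movement at the speed `1 / (n + 1)` is a
lower bound for the duration of runs. By induction on the number of lines that are relevant: up to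
the first, and after the last visit to the fastest line, one line less is relevant. -/
theorem le_of_isRun {D : Plane → Plane → ℝ≥0∞} (htri : ∀ u u' u'', D u u'' ≤ D u u' + D u' u'')
    (hfree : ∀ u u', D u u' ≤ (n + 1) * edist u u')
    (hline : ∀ m ∈ C, 0 < m.2 → ∀ p ∈ m.1.points, ∀ q ∈ m.1.points,
      D p q ≤ edist p q / ENNReal.ofReal m.2)
    {ξ : ℝ → Plane} (hξ : IsRun (silhouette C) ξ) (N : ℕ) :
    ∀ (G : Finset (PlaneLine × ℝ)), G.card = N → ↑G ⊆ C → ∀ a b, a ≤ b →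
      (∀ m ∈ C, 1 / ((n : ℝ) + 1) ≤ m.2 → ∀ t ∈ Icc a b, ξ t ∈ m.1.points → m ∈ G) →
      D (ξ a) (ξ b) ≤ ENNReal.ofReal (b - a) := by
  classical
  have hε : (0 : ℝ) < 1 / ((n : ℝ) + 1) := by positivity
  have hNR : ((n : ℝ≥0∞) + 1) = ENNReal.ofReal ((n : ℝ) + 1) := by
    rw [ENNReal.ofReal_add (by positivity) zero_le_one, ENNReal.ofReal_natCast, ENNReal.ofReal_one]
  induction N with
  | zero =>
    intro G hG _ a b hab hrel
    rw [Finset.card_eq_zero] at hG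
    have h1 : dist (ξ a) (ξ b) ≤ 1 / ((n : ℝ) + 1) * (b - a) := by
      refine hξ.speed _ hε a b hab fun t ht hmem => ?_
      obtain ⟨ℓ, w, hm, hvw, hz⟩ := hmem
      have := hrel (ℓ, w) hm hvw t ht hz
      simp [hG] at this
    refine (hfree _ _).trans ?_
    rw [hNR, edist_dist, ← ENNReal.ofReal_mul (by positivity)]
    refine ENNReal.ofReal_le_ofReal ?_
    rw [one_div, inv_mul_eq_div, le_div_iff₀ (by positivity)] at h1
    linarith
  | succ N ih =>
    intro G hG hGC a b hab hrel
    have hGne : G.Nonempty := by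
      rw [← Finset.card_pos, hG]; omega
    obtain ⟨m, hmG, hmax⟩ := G.exists_max_image (fun m => m.2) hGne
    have hcard : (G.erase m).card = N := by rw [Finset.card_erase_of_mem hmG, hG]; omega
    have hsub : ↑(G.erase m) ⊆ C := fun x hx => hGC (Finset.mem_of_mem_erase hx)
    -- intervals on which `m` is not met
    have hclean : ∀ c d, a ≤ c → c ≤ d → d ≤ b → (∀ t ∈ Icc c d, ξ t ∉ m.1.points) →
        D (ξ c) (ξ d) ≤ ENNReal.ofReal (d - c) := by
      intro c d hac hcd hdb hno
      refine ih _ hcard hsub c d hcd fun m' hm' hw t ht hz => ?_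
      refine Finset.mem_erase.2 ⟨?_, hrel m' hm' hw t ⟨hac.trans ht.1, ht.2.trans hdb⟩ hz⟩
      rintro rfl
      exact hno t ht hz
    set A : Set ℝ := Icc a b ∩ ξ ⁻¹' m.1.points with hA
    have hAc : IsCompact A := isCompact_Icc.inter_right (m.1.isClosed_points.preimage hξ.cont)
    rcases A.eq_empty_or_nonempty with hAe | hAne
    · refine hclean a b le_rfl hab le_rfl fun t ht hz => ?_
      have : t ∈ A := ⟨ht, hz⟩
      simp [hAe] at this
    by_cases hw : 1 / ((n : ℝ) + 1) ≤ m.2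
    swap
    · -- a slow line is irrelevant
      refine ih _ hcard hsub a b hab fun m' hm' hw' t ht hz => ?_
      refine Finset.mem_erase.2 ⟨?_, hrel m' hm' hw' t ht hz⟩
      rintro rfl
      exact hw hw'
    have hw0 : 0 < m.2 := hε.trans_le hw
    have hs := hAc.sInf_mem hAne
    have ht := hAc.sSup_mem hAne
    set s := sInf A
    set t := sSup A
    have hst : s ≤ t := csInf_le hAc.bddBelow ht
    have hmid : D (ξ s) (ξ t) ≤ ENNReal.ofReal (t - s) := by
      refine (hline m (hGC hmG) hw0 _ hs.2 _ ht.2).trans ?_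
      have h1 : dist (ξ s) (ξ t) ≤ m.2 * (t - s) := by
        refine hξ.dist_le_of_forall_gt hw0.le hst fun v hv r hr hmem => ?_
        obtain ⟨ℓ, w, hm, hvw, hz⟩ := hmem
        have := hrel (ℓ, w) hm (by simp only; linarith) r
          ⟨hs.1.1.trans hr.1.le, hr.2.le.trans ht.1.2⟩ hz
        have := hmax _ this
        simp only at this
        linarith
      rw [edist_dist, ← ENNReal.ofReal_div_of_pos hw0]
      refine ENNReal.ofReal_le_ofReal ?_
      rw [div_le_iff₀ hw0]
      linarith
    have hcD : ∀ (z : Plane) (c : ℝ),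
        Tendsto (fun r => ((n : ℝ≥0∞) + 1) * edist (ξ r) (ξ c)) (𝓝 c) (𝓝 0) := by
      intro z c
      have h1 := (ENNReal.continuous_const_mul (natCast_add_one_ne_top (n := n))).comp
        (hξ.cont.edist (continuous_const (y := ξ c)))
      have := h1.tendsto c
      simpa [Function.comp_def] using this
    have hleft : D (ξ a) (ξ s) ≤ ENNReal.ofReal (s - a) := by
      rcases hs.1.1.eq_or_lt with h | h
      · rw [← h]
        refine (hfree _ _).trans ?_
        simp
      have hlim : Tendsto (fun r => ENNReal.ofReal (r - a) + ((n : ℝ≥0∞) + 1) * edist (ξ r) (ξ s))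
          (𝓝[<] s) (𝓝 (ENNReal.ofReal (s - a) + 0)) := by
        refine Tendsto.add ?_ ((hcD 0 s).mono_left nhdsWithin_le_nhds)
        have : Continuous fun r : ℝ => ENNReal.ofReal (r - a) :=
          ENNReal.continuous_ofReal.comp (by fun_prop)
        exact (this.tendsto s).mono_left nhdsWithin_le_nhds
      rw [add_zero] at hlim
      refine ge_of_tendsto hlim ?_
      filter_upwards [Ioo_mem_nhdsLT h] with r hr
      refine (htri _ (ξ r) _).trans (add_le_add ?_ (hfree _ _))
      refine hclean a r le_rfl hr.1.le (hr.2.le.trans hs.1.2) fun q hq hz => ?_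
      have : q ∈ A := ⟨⟨hq.1, hq.2.trans (hr.2.le.trans hs.1.2)⟩, hz⟩
      have := csInf_le hAc.bddBelow this
      linarith [hq.2, hr.2]
    have hright : D (ξ t) (ξ b) ≤ ENNReal.ofReal (b - t) := by
      rcases ht.1.2.eq_or_lt with h | h
      · rw [← h]
        refine (hfree _ _).trans ?_
        simp
      have hlim : Tendsto (fun r => ((n : ℝ≥0∞) + 1) * edist (ξ r) (ξ t) + ENNReal.ofReal (b - r))
          (𝓝[>] t) (𝓝 (0 + ENNReal.ofReal (b - t))) := by
        refine Tendsto.add ((hcD 0 t).mono_left nhdsWithin_le_nhds) ?_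
        have : Continuous fun r : ℝ => ENNReal.ofReal (b - r) :=
          ENNReal.continuous_ofReal.comp (by fun_prop)
        exact (this.tendsto t).mono_left nhdsWithin_le_nhds
      rw [zero_add] at hlim
      refine ge_of_tendsto hlim ?_
      filter_upwards [Ioo_mem_nhdsGT h] with r hr
      refine (htri _ (ξ r) _).trans (add_le_add ?_ ?_)
      · rw [edist_comm]
        exact hfree _ _
      refine hclean r b (ht.1.1.trans hr.1.le) hr.2.le le_rfl fun q hq hz => ?_
      have : q ∈ A := ⟨⟨(ht.1.1.trans hr.1.le).trans hq.1, hq.2⟩, hz⟩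
      have := le_csSup hAc.bddAbove this
      linarith [hq.1, hr.1]
    calc D (ξ a) (ξ b) ≤ D (ξ a) (ξ s) + (D (ξ s) (ξ t) + D (ξ t) (ξ b)) :=
          (htri _ (ξ s) _).trans (add_le_add le_rfl (htri _ _ _))
      _ ≤ ENNReal.ofReal (s - a) + (ENNReal.ofReal (t - s) + ENNReal.ofReal (b - t)) := by gcongr
      _ = ENNReal.ofReal (b - a) := by
        rw [← ENNReal.ofReal_add (by linarith) (by linarith [ht.1.2]),
          ← ENNReal.ofReal_add (by linarith [hs.1.1]) (by linarith [ht.1.2])]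
        congr 1; ring

theorem chainTime_le_travelTime (h : SpeedRegular C k₀) (u u' : Plane) :
    chainTime C n u u' ≤ travelTime C u u' := by
  refine le_iInf₂ fun t ⟨ht, ξ, hξ, h0, h1⟩ => ?_
  obtain ⟨R, hR⟩ : ∃ R, ∀ s ∈ Icc 0 t, ‖ξ s‖ ≤ R :=
    isCompact_Icc.exists_bound_of_continuousOn hξ.cont.continuousOn
  have hfin := h.locFin R (1 / ((n : ℝ) + 1)) (by positivity)
  have := le_of_isRun (C := C) (n := n) (D := chainTime C n) chainTime_triangle chainTime_le_edist
    (fun m hm hw p hp q hq => chainTime_le_of_mem hm hw hp hq) hξ _ hfin.toFinset rfl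
    (fun m hm => ((hfin.mem_toFinset).1 hm).1) 0 t ht
    (fun m hm hw s hs hz => hfin.mem_toFinset.2 ⟨hm, hw, _, hz, hR s hs⟩)
  simpa [h0, h1] using this

/-- Chain times increase to the travel time. -/
theorem iSup_chainTime (h : SpeedRegular C k₀) (u u' : Plane) :
    ⨆ n, chainTime C n u u' = travelTime C u u' := by
  refine le_antisymm (iSup_le fun n => chainTime_le_travelTime h u u') ?_
  refine le_of_forall_gt_imp_ge_of_dense fun c hc => ?_
  by_cases hctop : c = ⊤
  · rw [hctop]; exact le_top
  have hcc : ENNReal.ofReal c.toReal = c := ENNReal.ofReal_toReal hctop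
  have hr : ∀ n, Reach (slowed C n) u u' c.toReal := fun n =>
    reach_of_reachTime_lt (((reachTime_slowed_le_chainTime u u').trans
      (le_iSup (fun n => chainTime C n u u') n)).trans_lt (hcc.symm ▸ hc))
  have : Reach (silhouette C) u u' c.toReal := by
    refine Reach.of_tendsto (l := atTop) (σ' := slowed C) (k₀ := k₀)
      (u := fun _ => u) (u' := fun _ => u') (t := fun _ => c.toReal) (fun n k hk v hv z hz => ?_)
      (fun v hv z hz => ?_) tendsto_const_nhds tendsto_const_nhds tendsto_const_nhds
      (Eventually.of_forall hr)
    · rintro (h1 | h1)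
      · have h2 : (1 : ℝ) ≤ 2 ^ k := one_le_pow₀ (by norm_num)
        have h3 : 1 / ((n : ℝ) + 1) ≤ 1 := by
          rw [div_le_one (by positivity)]; linarith [(Nat.cast_nonneg n : (0 : ℝ) ≤ n)]
        linarith
      · exact h.tame k hk v hv z hz h1
    · obtain ⟨ε, hε, hz'⟩ := h.isClosed_silhouette hv z hz
      refine ⟨ε, hε, ?_⟩
      have := tendsto_one_div_add_atTop_nhds_zero_nat (𝕜 := ℝ)
      filter_upwards [this.eventually (gt_mem_nhds hv)] with n hn z' hzz' hmem
      rcases hmem with h1 | h1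
      · exact absurd h1 (not_le.2 hn)
      · exact hz' z' hzz' h1
  have := this.reachTime_le
  rwa [hcc] at this

end chain

/-! ### Local structure of minimal runs -/

theorem PlaneLine.eq_of_mem_of_mem {ℓ ℓ' : PlaneLine} (h : ℓ.rep.1 ≠ ℓ'.rep.1) {p q : Plane}
    (hp : p ∈ ℓ.points) (hq : q ∈ ℓ.points) (hp' : p ∈ ℓ'.points) (hq' : q ∈ ℓ'.points) :
    p = q := by
  rw [mem_points, height] at hp hq hp' hq'
  have hs : Real.sin (ℓ'.rep.1 - ℓ.rep.1) ≠ 0 := by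
    have h1 := ℓ.rep_mem
    have h2 := ℓ'.rep_mem
    rcases lt_or_gt_of_ne h with hlt | hlt
    · exact (Real.sin_pos_of_pos_of_lt_pi (by linarith) (by linarith [h1.1, h2.2])).ne'
    · exact (Real.sin_neg_of_neg_of_neg_pi_lt (by linarith) (by linarith [h1.2, h2.1])).ne
  rw [Real.sin_sub] at hs
  ext i
  fin_cases i
  · refine mul_left_cancel₀ hs ?_
    simp only [Fin.zero_eta]
    linear_combination Real.cos ℓ'.rep.1 * (hp - hq) - Real.cos ℓ.rep.1 * (hp' - hq')
  · refine mul_left_cancel₀ hs ?_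
    simp only [Fin.mk_one]
    linear_combination Real.sin ℓ'.rep.1 * (hp - hq) - Real.sin ℓ.rep.1 * (hp' - hq')

/-- Families of lines with positive speeds and pairwise different directions. -/
structure InGeneralDirections (L : Set (PlaneLine × ℝ)) : Prop where
  pos : ∀ m ∈ L, 0 < m.2
  angle_ne : ∀ m ∈ L, ∀ m' ∈ L, m ≠ m' → m.1.rep.1 ≠ m'.1.rep.1

/-- A run that, on `[0, T]`, connects any two of its points in the least possible time. -/
structure IsMinimal (L : Set (PlaneLine × ℝ)) (T : ℝ) (ξ : ℝ → Plane) : Prop where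
  run : IsRun (silhouette L) ξ
  opt : ∀ s t, 0 ≤ s → s ≤ t → t ≤ T → ENNReal.ofReal (t - s) ≤ travelTime L (ξ s) (ξ t)

theorem SpeedRegular.eventually_notMem {L : Set (PlaneLine × ℝ)} {k₀ : ℕ} (h : SpeedRegular L k₀)
    {ξ : ℝ → Plane} (hξ : Continuous ξ) {t₀ : ℝ} {l : Filter ℝ} (hl : l ≤ 𝓝 t₀) {v : ℝ} (hv : 0 < v)
    {Q : PlaneLine × ℝ → Prop} (hQv : ∀ m ∈ L, Q m → v ≤ m.2)
    (hQ : ∀ m ∈ L, Q m → ∀ᶠ u in l, ξ u ∉ m.1.points) :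
    ∀ᶠ u in l, ∀ m ∈ L, Q m → ξ u ∉ m.1.points := by
  have hfin := h.locFin (‖ξ t₀‖ + 1) v hv
  have h1 : ∀ᶠ u in l, ‖ξ u‖ < ‖ξ t₀‖ + 1 :=
    (hξ.norm.continuousAt.eventually (gt_mem_nhds (by linarith))).filter_mono hl
  have h2 : ∀ᶠ u in l, ∀ m ∈ {m ∈ L | v ≤ m.2 ∧ ∃ z ∈ m.1.points, ‖z‖ ≤ ‖ξ t₀‖ + 1},
      Q m → ξ u ∉ m.1.points := by
    rw [eventually_all_finite hfin]
    intro m hm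
    by_cases hq : Q m
    · filter_upwards [hQ m hm.1 hq] with u hu _ using hu
    · exact Eventually.of_forall fun u hq' => absurd hq' hq
  filter_upwards [h1, h2] with u hu1 hu2 m hm hq hz
  exact hu2 m ⟨hm, hQv m hm hq, _, hz, hu1.le⟩ hq hz

/-- A run that avoids one of the lines is a run for the other lines. -/
theorem IsRun.reach_diff {L : Set (PlaneLine × ℝ)} {ξ : ℝ → Plane} (hξ : IsRun (silhouette L) ξ)
    {m : PlaneLine × ℝ} {a b : ℝ} (hab : a ≤ b) (ha : ∀ s ∈ Ioo a b, ξ s ∉ m.1.points) :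
    Reach (silhouette (L \ {m})) (ξ a) (ξ b) (b - a) := by
  have h := IsRun.clamp (σ := silhouette (L \ {m})) hab hξ.cont.continuousOn
    (fun v hv s t has hst htb hno => hξ.speed_Ioo hv hst fun u hu hmem => by
      obtain ⟨ℓ, w, hm, hvw, hz⟩ := hmem
      refine hno u ⟨hu.1.le, hu.2.le⟩ ⟨ℓ, w, ⟨hm, ?_⟩, hvw, hz⟩
      rintro rfl
      exact ha u ⟨has.trans_lt hu.1, hu.2.trans_le htb⟩ hz)
  have := h.reach hab
  simpa [hab] using this

namespace IsMinimal

variable {L : Set (PlaneLine × ℝ)} {T : ℝ} {ξ : ℝ → Plane} {k₀ : ℕ}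

theorem reverse (h : IsMinimal L T ξ) : IsMinimal L T (fun t => ξ (T - t)) := by
  refine ⟨h.run.reverse T, fun s t hs hst ht => ?_⟩
  have := h.opt (T - t) (T - s) (by linarith) (by linarith) (by linarith)
  rw [travelTime, reachTime_comm]
  convert this using 2
  ring

theorem injOn (h : IsMinimal L T ξ) {s t : ℝ} (hs : s ∈ Icc 0 T) (ht : t ∈ Icc 0 T)
    (hst : ξ s = ξ t) : s = t := by
  have key : ∀ s t, 0 ≤ s → s < t → t ≤ T → ξ s = ξ t → False := by
    intro s t hs hst ht heq
    have := h.opt s t hs hst.le ht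
    rw [heq, travelTime, reachTime_self, nonpos_iff_eq_zero, ENNReal.ofReal_eq_zero] at this
    linarith
  rcases lt_trichotomy s t with h' | h' | h'
  · exact (key s t hs.1 h' ht.2 hst).elim
  · exact h'
  · exact (key t s ht.1 h' hs.2 hst.symm).elim

/-- Immediately after any time a minimal run either is off a given line, or moves along this line
at full speed. The fastest line among those that are visited at arbitrarily short notice would
provide a shortcut otherwise. -/
theorem germ_right (hreg : SpeedRegular L k₀) (hL : InGeneralDirections L) (h : IsMinimal L T ξ)
    {t₀ : ℝ} (ht₀ : t₀ ∈ Ico 0 T) {m : PlaneLine × ℝ} (hm : m ∈ L) :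
    (∀ᶠ u in 𝓝[>] t₀, ∀ s ∈ Ioc t₀ u, ξ s ∉ m.1.points) ∨
    (∃ ε : ℝ, (ε = 1 ∨ ε = -1) ∧ ∀ᶠ u in 𝓝[>] t₀, ∀ s ∈ Icc t₀ u, ξ s ∈ m.1.points ∧
      along m.1.rep.1 (ξ s) = along m.1.rep.1 (ξ t₀) + ε * (m.2 * (s - t₀))) := by
  by_cases hcase : ∀ᶠ u in 𝓝[>] t₀, ξ u ∉ m.1.points
  · left
    obtain ⟨d, hd, hd'⟩ := mem_nhdsGT_iff_exists_Ioo_subset.1 hcase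
    filter_upwards [Ioo_mem_nhdsGT hd] with u hu s hs
    exact hd' ⟨hs.1, hs.2.trans_lt hu.2⟩
  right
  have hfr : ∃ᶠ u in 𝓝[>] t₀, ξ u ∈ m.1.points := by
    simpa [not_eventually] using hcase
  have hT : ∀ᶠ u in 𝓝[>] t₀, u ∈ Ioo t₀ T := Ioo_mem_nhdsGT ht₀.2
  -- the lines that are at least as fast and are visited immediately after `t₀`
  set M := {m' ∈ L | m.2 ≤ m'.2 ∧ ∃ᶠ u in 𝓝[>] t₀, ξ u ∈ m'.1.points} with hM
  have hMfin : M.Finite := by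
    refine (hreg.locFin (‖ξ t₀‖ + 1) m.2 (hL.pos m hm)).subset ?_
    rintro m' ⟨hm', hw, hf⟩
    have h1 : ∀ᶠ u in 𝓝[>] t₀, ‖ξ u‖ < ‖ξ t₀‖ + 1 :=
      (h.run.cont.norm.continuousAt.eventually (gt_mem_nhds (by linarith))).filter_mono
        nhdsWithin_le_nhds
    obtain ⟨u, hu, hu'⟩ := (hf.and_eventually h1).exists
    exact ⟨hm', hw, _, hu, hu'.le⟩
  obtain ⟨m', hm', hmax⟩ := hMfin.exists_maximalFor (fun m => m.2) M ⟨m, hm, le_rfl, hfr⟩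
  obtain ⟨hm'L, hww, hfr'⟩ := hm'
  have hw' : 0 < m'.2 := hL.pos m' hm'L
  have hev : ∀ᶠ u in 𝓝[>] t₀, ∀ m'' ∈ L, m'.2 < m''.2 → ξ u ∉ m''.1.points := by
    refine hreg.eventually_notMem h.run.cont nhdsWithin_le_nhds hw' (fun _ _ h => h.le) ?_
    intro m'' hm'' hlt
    by_contra hcon
    have hmem : m'' ∈ M := ⟨hm'', hww.trans hlt.le, by simpa [not_eventually] using hcon⟩
    exact absurd (hmax hmem hlt.le) (not_le.2 hlt)
  obtain ⟨d, hd, hd'⟩ := mem_nhdsGT_iff_exists_Ioo_subset.1 (hev.and hT)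
  have hspeed : ∀ s t, t₀ ≤ s → s ≤ t → t < d → dist (ξ s) (ξ t) ≤ m'.2 * (t - s) := by
    intro s t hs hst htd
    refine h.run.dist_le_of_forall_gt hw'.le hst fun v hv u hu hmem => ?_
    obtain ⟨ℓ, w, hmw, hvw, hz⟩ := hmem
    exact (hd' ⟨hs.trans_lt hu.1, hu.2.trans htd⟩).1 (ℓ, w) hmw (hv.trans_le hvw) hz
  have hcl : ∀ m'' : PlaneLine × ℝ, (∃ᶠ u in 𝓝[>] t₀, ξ u ∈ m''.1.points) →
      ξ t₀ ∈ m''.1.points := fun m'' hf =>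
    m''.1.isClosed_points.mem_of_frequently_of_tendsto hf
      ((h.run.cont.tendsto t₀).mono_left nhdsWithin_le_nhds)
  have hp' := hcl m' hfr'
  obtain ⟨t₁, ht₁, ht₁d⟩ := (hfr'.and_eventually (Ioo_mem_nhdsGT hd)).exists
  have ht₁T : t₁ < T := (hd' ht₁d).2.2
  set θ := m'.1.rep.1 with hθ
  set A := along θ (ξ t₀) with hA
  have hbig : m'.2 * (t₁ - t₀) ≤ |along θ (ξ t₁) - A| := by
    have h1 := h.opt t₀ t₁ ht₀.1 ht₁d.1.le ht₁T.le
    have h2 := h1.trans (travelTime_le_of_mem hm'L hw' hp' ht₁)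
    rw [edist_dist, ← ENNReal.ofReal_div_of_pos hw',
      ENNReal.ofReal_le_ofReal_iff (by positivity), le_div_iff₀ hw', dist_comm,
      PlaneLine.dist_eq_of_mem ht₁ hp'] at h2
    linarith
  obtain ⟨ε, hε, hεeq⟩ : ∃ ε : ℝ, (ε = 1 ∨ ε = -1) ∧
      m'.2 * (t₁ - t₀) ≤ ε * (along θ (ξ t₁) - A) := by
    rcases abs_cases (along θ (ξ t₁) - A) with h' | h'
    · exact ⟨1, Or.inl rfl, by linarith⟩
    · exact ⟨-1, Or.inr rfl, by linarith⟩
  have hε2 : ε * ε = 1 := by rcases hε with rfl | rfl <;> norm_num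
  have hε1 : ∀ x : ℝ, ε * x ≤ |x| := by
    intro x
    rcases hε with rfl | rfl
    · simpa using le_abs_self x
    · simpa using neg_le_abs x
  have hstraight : ∀ s ∈ Icc t₀ t₁, ξ s ∈ m'.1.points ∧
      along θ (ξ s) = A + ε * (m'.2 * (s - t₀)) := by
    intro s hs
    have h1 := hspeed t₀ s le_rfl hs.1 (hs.2.trans_lt ht₁d.2)
    have h2 := hspeed s t₁ hs.1 hs.2 ht₁d.2
    have h3 : ε * (along θ (ξ t₁) - along θ (ξ s)) ≤ m'.2 * (t₁ - s) :=
      (hε1 _).trans ((abs_along_sub_le _ _ _).trans (by rw [dist_comm]; exact h2))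
    have h4 : ε * (along θ (ξ s) - A) ≤ m'.2 * (s - t₀) :=
      (hε1 _).trans ((abs_along_sub_le _ _ _).trans (by rw [dist_comm]; exact h1))
    have h5 : ε * (along θ (ξ s) - A) = m'.2 * (s - t₀) := by
      refine le_antisymm h4 ?_
      linarith
    have h6 : along θ (ξ s) = A + ε * (m'.2 * (s - t₀)) := by
      rw [← h5, ← mul_assoc, hε2]; ring
    refine ⟨PlaneLine.mem_points.2 ?_, h6⟩
    have h7 := dist_sq_along_height m'.1.rep (ξ t₀) (ξ s)
    rw [PlaneLine.mem_points.1 hp', ← hθ, ← hA, h6] at h7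
    have h8 : dist (ξ t₀) (ξ s) ^ 2 ≤ (m'.2 * (s - t₀)) ^ 2 :=
      pow_le_pow_left₀ dist_nonneg h1 2
    have h9 : (A - (A + ε * (m'.2 * (s - t₀)))) ^ 2 = (m'.2 * (s - t₀)) ^ 2 := by
      linear_combination (m'.2 * (s - t₀)) ^ 2 * hε2
    have : height m'.1.rep (ξ s) ^ 2 ≤ 0 := by nlinarith
    exact pow_eq_zero_iff two_ne_zero |>.1 (le_antisymm this (sq_nonneg _))
  have hmm : m = m' := by
    by_contra hne
    obtain ⟨u, hu, hu'⟩ := (hfr.and_eventually (Ioo_mem_nhdsGT ht₁d.1)).exists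
    have := PlaneLine.eq_of_mem_of_mem (hL.angle_ne m hm m' hm'L hne) (hcl m hfr) hu hp'
      (hstraight u ⟨hu'.1.le, hu'.2.le⟩).1
    have := h.injOn ⟨ht₀.1, ht₀.2.le⟩ ⟨ht₀.1.trans hu'.1.le, hu'.2.le.trans ht₁T.le⟩ this
    linarith [hu'.1]
  subst hmm
  refine ⟨ε, hε, ?_⟩
  filter_upwards [Ioo_mem_nhdsGT ht₁d.1] with u hu s hs
  exact hstraight s ⟨hs.1, hs.2.trans hu.2.le⟩

theorem _root_.tendsto_sub_nhdsLT (T t₀ : ℝ) :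
    Tendsto (fun u => T - u) (𝓝[<] t₀) (𝓝[>] (T - t₀)) := by
  refine tendsto_nhdsWithin_iff.2 ⟨?_, ?_⟩
  · exact (Continuous.tendsto (by fun_prop) t₀).mono_left nhdsWithin_le_nhds
  · filter_upwards [self_mem_nhdsWithin] with u hu
    have : u < t₀ := hu
    simp only [mem_Ioi]
    linarith

theorem germ_left (hreg : SpeedRegular L k₀) (hL : InGeneralDirections L) (h : IsMinimal L T ξ)
    {t₀ : ℝ} (ht₀ : t₀ ∈ Ioc 0 T) {m : PlaneLine × ℝ} (hm : m ∈ L) :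
    (∀ᶠ u in 𝓝[<] t₀, ∀ s ∈ Ico u t₀, ξ s ∉ m.1.points) ∨
    (∃ ε : ℝ, (ε = 1 ∨ ε = -1) ∧ ∀ᶠ u in 𝓝[<] t₀, ∀ s ∈ Icc u t₀, ξ s ∈ m.1.points ∧
      along m.1.rep.1 (ξ s) = along m.1.rep.1 (ξ t₀) + ε * (m.2 * (t₀ - s))) := by
  rcases germ_right hreg hL h.reverse (t₀ := T - t₀) ⟨by linarith [ht₀.2], by linarith [ht₀.1]⟩ hm
    with h1 | ⟨ε, hε, h1⟩
  · left
    filter_upwards [(tendsto_sub_nhdsLT T t₀).eventually h1] with u hu s hs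
    have := hu (T - s) ⟨by linarith [hs.2], by linarith [hs.1]⟩
    simpa using this
  · right
    refine ⟨ε, hε, ?_⟩
    filter_upwards [(tendsto_sub_nhdsLT T t₀).eventually h1] with u hu s hs
    have := hu (T - s) ⟨by linarith [hs.2], by linarith [hs.1]⟩
    simp only [sub_sub_cancel] at this
    refine ⟨this.1, this.2.trans ?_⟩
    ring

/-- During any time interval a minimal run follows some line for a while. -/
theorem exists_follows (hreg : SpeedRegular L k₀) (hL : InGeneralDirections L)
    (h : IsMinimal L T ξ) {a b : ℝ} (ha : 0 ≤ a) (hab : a < b) (hb : b ≤ T) :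
    ∃ m ∈ L, ∃ c d, a < c ∧ c < d ∧ d < b ∧ ∀ s ∈ Icc c d, ξ s ∈ m.1.points := by
  by_contra hcon
  push Not at hcon
  obtain ⟨a', ha', ha'b⟩ := exists_between hab
  obtain ⟨b', ha'b', hb'⟩ := exists_between ha'b
  have hR : ∀ t ∈ Ico a' b', ∀ m ∈ L, ∀ᶠ u in 𝓝[>] t, ξ u ∉ m.1.points := by
    intro t ht m hm
    rcases germ_right hreg hL h (t₀ := t) ⟨by linarith [ht.1], by linarith [ht.2]⟩ hm
      with h1 | ⟨ε, -, h1⟩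
    · filter_upwards [h1, self_mem_nhdsWithin] with u hu hu'
      exact hu u ⟨hu', le_rfl⟩
    · exfalso
      obtain ⟨u, hu, hu'⟩ := (h1.and (Ioo_mem_nhdsGT (ht.2.trans hb'))).exists
      obtain ⟨s, hs, hs'⟩ := hcon m hm t u (by linarith [ht.1]) hu'.1 hu'.2
      exact hs' (hu s hs).1
  have hLe : ∀ t ∈ Ioc a' b', ∀ m ∈ L, ∀ᶠ u in 𝓝[<] t, ξ u ∉ m.1.points := by
    intro t ht m hm
    rcases germ_left hreg hL h (t₀ := t) ⟨by linarith [ht.1], by linarith [ht.2]⟩ hm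
      with h1 | ⟨ε, -, h1⟩
    · filter_upwards [h1, self_mem_nhdsWithin] with u hu hu'
      exact hu u ⟨le_rfl, hu'⟩
    · exfalso
      obtain ⟨u, hu, hu'⟩ := (h1.and (Ioo_mem_nhdsLT (show a < t by linarith [ht.1]))).exists
      obtain ⟨s, hs, hs'⟩ := hcon m hm u t hu'.1 hu'.2 (by linarith [ht.2])
      exact hs' (hu s hs).1
  have hdist : ∀ v : ℝ, 0 < v → dist (ξ a') (ξ b') ≤ v * (b' - a') := by
    intro v hv
    refine interval_induction (P := fun p q => dist (ξ p) (ξ q) ≤ v * (q - p)) ha'b'.le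
      (fun p => by simp) (fun p q r _ _ _ _ h1 h2 => ?_) (fun t ht => ?_) (fun t ht => ?_)
    · calc dist (ξ p) (ξ r) ≤ dist (ξ p) (ξ q) + dist (ξ q) (ξ r) := dist_triangle _ _ _
        _ ≤ v * (q - p) + v * (r - q) := add_le_add h1 h2
        _ = _ := by ring
    · have := hreg.eventually_notMem h.run.cont (t₀ := t) nhdsWithin_le_nhds hv
        (Q := fun m => v ≤ m.2) (fun _ _ h => h) (fun m hm _ => hR t ht m hm)
      obtain ⟨d, hd, hd'⟩ := mem_nhdsGT_iff_exists_Ioo_subset.1 this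
      filter_upwards [Ioo_mem_nhdsGT hd] with u hu
      refine h.run.speed_Ioo hv hu.1.le fun s hs hmem => ?_
      obtain ⟨ℓ, w, hm, hvw, hz⟩ := hmem
      exact hd' ⟨hs.1, hs.2.trans hu.2⟩ (ℓ, w) hm hvw hz
    · have := hreg.eventually_notMem h.run.cont (t₀ := t) nhdsWithin_le_nhds hv
        (Q := fun m => v ≤ m.2) (fun _ _ h => h) (fun m hm _ => hLe t ht m hm)
      obtain ⟨d, hd, hd'⟩ := mem_nhdsLT_iff_exists_Ioo_subset.1 this
      filter_upwards [Ioo_mem_nhdsLT hd] with u hu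
      refine h.run.speed_Ioo hv hu.2.le fun s hs hmem => ?_
      obtain ⟨ℓ, w, hm, hvw, hz⟩ := hmem
      exact hd' ⟨hu.1.trans hs.1, hs.2⟩ (ℓ, w) hm hvw hz
  have h0 : dist (ξ a') (ξ b') ≤ 0 := by
    refine le_of_forall_pos_le_add fun e he => ?_
    have := hdist (e / (b' - a')) (div_pos he (by linarith))
    rw [div_mul_cancel₀ _ (by linarith : b' - a' ≠ 0)] at this
    linarith
  have := h.injOn (s := a') (t := b') ⟨by linarith, by linarith⟩ ⟨by linarith, by linarith⟩
    (dist_le_zero.1 h0)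
  linarith

end IsMinimal

/-! ### Perturbing the speed of a line -/

/-- Positions, along the line `m`, of the points of this line that are visited during `[a, b]`. -/
def trace (m : PlaneLine × ℝ) (ξ : ℝ → Plane) (a b : ℝ) : Set ℝ :=
  (fun t => along m.1.rep.1 (ξ t)) '' {t | t ∈ Icc a b ∧ ξ t ∈ m.1.points}

theorem isCompact_trace (m : PlaneLine × ℝ) {ξ : ℝ → Plane} (hξ : Continuous ξ) (a b : ℝ) :
    IsCompact (trace m ξ a b) := by
  have : IsCompact {t | t ∈ Icc a b ∧ ξ t ∈ m.1.points} :=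
    isCompact_Icc.inter_right (m.1.isClosed_points.preimage hξ)
  exact this.image ((continuous_along_right _).comp hξ)

open scoped Pointwise in
theorem volume_image_affine {A w ε a b : ℝ} (hε : ε = 1 ∨ ε = -1) (hw : 0 < w) :
    volume ((fun s => A + ε * (w * (s - a))) '' Icc a b) = ENNReal.ofReal (w * (b - a)) := by
  have h1 : (fun s => A + ε * (w * (s - a))) '' Icc a b =
      (fun s => (ε * w) * s + (A - ε * w * a)) '' Icc a b := by
    congr 1; ext s; ring
  have h2 : (fun s => (ε * w) * s + (A - ε * w * a)) '' Icc a b =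
      (fun y => y + (A - ε * w * a)) '' ((fun s => (ε * w) * s) '' Icc a b) := by
    rw [image_image]
  rw [h1, h2, image_add_right, measure_preimage_add_right]
  have h3 : (fun s => (ε * w) * s) '' Icc a b = (ε * w) • Icc a b := by
    rw [← image_smul]; rfl
  rw [h3, Measure.addHaar_smul, Real.volume_Icc, Module.finrank_self, pow_one,
    ← ENNReal.ofReal_mul (abs_nonneg _)]
  congr 2
  rcases hε with rfl | rfl
  · rw [one_mul, abs_of_pos hw]
  · rw [neg_one_mul, abs_neg, abs_of_pos hw]

theorem IsMinimal.volume_trace_add {L : Set (PlaneLine × ℝ)} {T : ℝ} {ξ : ℝ → Plane}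
    (h : IsMinimal L T ξ) (m : PlaneLine × ℝ) {a b c : ℝ} (ha : 0 ≤ a) (hab : a ≤ b) (hbc : b ≤ c)
    (hc : c ≤ T) : (volume (trace m ξ a c)).toReal =
      (volume (trace m ξ a b)).toReal + (volume (trace m ξ b c)).toReal := by
  have hu : trace m ξ a c = trace m ξ a b ∪ trace m ξ b c := by
    rw [trace, trace, trace, ← image_union]
    congr 1
    ext t
    simp only [mem_ofPred_eq, mem_union, mem_Icc]
    constructor
    · rintro ⟨⟨h1, h2⟩, h3⟩
      rcases le_total t b with h4 | h4
      · exact Or.inl ⟨⟨h1, h4⟩, h3⟩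
      · exact Or.inr ⟨⟨h4, h2⟩, h3⟩
    · rintro (⟨⟨h1, h2⟩, h3⟩ | ⟨⟨h1, h2⟩, h3⟩)
      · exact ⟨⟨h1, h2.trans hbc⟩, h3⟩
      · exact ⟨⟨hab.trans h1, h2⟩, h3⟩
  have hd : AEDisjoint volume (trace m ξ a b) (trace m ξ b c) := by
    refine measure_mono_null (t := {along m.1.rep.1 (ξ b)}) ?_ (by simp)
    rintro _ ⟨⟨s, ⟨hs, hsm⟩, rfl⟩, ⟨t, ⟨ht, htm⟩, hst⟩⟩
    simp only at hst
    have h1 : dist (ξ t) (ξ s) = 0 := by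
      rw [PlaneLine.dist_eq_of_mem htm hsm, hst, sub_self, abs_zero]
    have h2 := h.injOn (s := t) (t := s) ⟨by linarith [ht.1], by linarith [ht.2]⟩
      ⟨by linarith [hs.1], by linarith [hs.2]⟩ (dist_eq_zero.1 h1)
    have h3 : s = b := le_antisymm hs.2 (h2 ▸ ht.1)
    simp [h3]
  rw [hu, measure_union₀ (isCompact_trace m h.run.cont b c).measurableSet.nullMeasurableSet hd,
    ENNReal.toReal_add (isCompact_trace m h.run.cont a b).measure_lt_top.ne
      (isCompact_trace m h.run.cont b c).measure_lt_top.ne]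

/-- If the speed of one of the lines is changed, then the minimal run can be adapted: the time spent
on this line changes in proportion. -/
theorem IsMinimal.travelTime_change_speed {L : Set (PlaneLine × ℝ)} {T : ℝ} {ξ : ℝ → Plane}
    {k₀ : ℕ} (hreg : SpeedRegular L k₀) (hL : InGeneralDirections L) (h : IsMinimal L T ξ)
    (hT : 0 ≤ T) {m : PlaneLine × ℝ} (hm : m ∈ L) {w : ℝ} (hw : 0 < w) :
    travelTime (insert (m.1, w) (L \ {m})) (ξ 0) (ξ T) ≤
      ENNReal.ofReal (T + (volume (trace m ξ 0 T)).toReal * (1 / w - 1 / m.2)) ∧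
    (volume (trace m ξ 0 T)).toReal / m.2 ≤ T := by
  set C := insert (m.1, w) (L \ {m}) with hC
  have hmw : 0 < m.2 := hL.pos m hm
  -- the time spent on `m` is separated from the time spent elsewhere
  have key : ∃ r : ℝ, 0 ≤ r ∧ T - 0 = r + (volume (trace m ξ 0 T)).toReal / m.2 ∧
      travelTime C (ξ 0) (ξ T) ≤
        ENNReal.ofReal (r + (volume (trace m ξ 0 T)).toReal / w) := by
    have hclean : ∀ a b, a ≤ b → (∀ s ∈ Ioo a b, ξ s ∉ m.1.points) →
        volume (trace m ξ a b) = 0 → ∃ r : ℝ, 0 ≤ r ∧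
          b - a = r + (volume (trace m ξ a b)).toReal / m.2 ∧
          travelTime C (ξ a) (ξ b) ≤
            ENNReal.ofReal (r + (volume (trace m ξ a b)).toReal / w) := by
      intro a b hab hno hv
      refine ⟨b - a, by linarith, by simp [hv], ?_⟩
      rw [hv, ENNReal.toReal_zero, zero_div, add_zero]
      exact (travelTime_anti (subset_insert _ _) _ _).trans
        (h.run.reach_diff hab hno).reachTime_le
    have hfull : ∀ a b, a ≤ b → ξ a ∈ m.1.points → ξ b ∈ m.1.points →
        dist (ξ a) (ξ b) = m.2 * (b - a) →
        volume (trace m ξ a b) = ENNReal.ofReal (m.2 * (b - a)) → ∃ r : ℝ, 0 ≤ r ∧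
          b - a = r + (volume (trace m ξ a b)).toReal / m.2 ∧
          travelTime C (ξ a) (ξ b) ≤
            ENNReal.ofReal (r + (volume (trace m ξ a b)).toReal / w) := by
      intro a b hab ha hb hd hv
      have hnn : 0 ≤ m.2 * (b - a) := mul_nonneg hmw.le (by linarith)
      refine ⟨0, le_rfl, ?_, ?_⟩
      · rw [hv, ENNReal.toReal_ofReal hnn]; field_simp; ring
      · rw [hv, ENNReal.toReal_ofReal hnn, zero_add]
        refine (travelTime_le_of_mem (m := (m.1, w)) (mem_insert _ _) hw ha hb).trans_eq ?_
        rw [edist_dist, hd, ENNReal.ofReal_div_of_pos hw]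
    refine interval_induction (P := fun a b => ∃ r : ℝ, 0 ≤ r ∧
      b - a = r + (volume (trace m ξ a b)).toReal / m.2 ∧
      travelTime C (ξ a) (ξ b) ≤ ENNReal.ofReal (r + (volume (trace m ξ a b)).toReal / w))
      hT (fun a => ?_) (fun a b c ha hab hbc hc => ?_) (fun t ht => ?_) (fun t ht => ?_)
    · refine hclean a a le_rfl (by simp) ?_
      refine measure_mono_null (t := {along m.1.rep.1 (ξ a)}) ?_ (by simp)
      rintro _ ⟨s, ⟨hs, -⟩, rfl⟩
      rw [Icc_self, mem_singleton_iff] at hs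
      simp [hs]
    · rintro ⟨r, hr, h1, h2⟩ ⟨r', hr', h1', h2'⟩
      refine ⟨r + r', by positivity, ?_, ?_⟩
      · rw [h.volume_trace_add m ha hab hbc hc, add_div]; linarith
      · refine (reachTime_triangle _ _ (ξ b) _).trans ((add_le_add h2 h2').trans_eq ?_)
        rw [← ENNReal.ofReal_add (by positivity) (by positivity),
          h.volume_trace_add m ha hab hbc hc]
        congr 1; ring
    · rcases h.germ_right hreg hL ht hm with h1 | ⟨ε, hε, h1⟩
      · filter_upwards [h1, self_mem_nhdsWithin] with u hu htu
        have htu : t < u := htu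
        refine hclean t u htu.le (fun s hs => hu s ⟨hs.1, hs.2.le⟩) ?_
        refine measure_mono_null (t := {along m.1.rep.1 (ξ t)}) ?_ (by simp)
        rintro _ ⟨s, ⟨hs, hsm⟩, rfl⟩
        rcases hs.1.eq_or_lt with h2 | h2
        · simp [h2]
        · exact absurd hsm (hu s ⟨h2, hs.2⟩)
      · filter_upwards [h1, self_mem_nhdsWithin] with u hu htu
        have htu : t < u := htu
        have ht' := hu t ⟨le_rfl, htu.le⟩
        have hu' := hu u ⟨htu.le, le_rfl⟩
        refine hfull t u htu.le ht'.1 hu'.1 ?_ ?_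
        · rw [dist_comm, PlaneLine.dist_eq_of_mem hu'.1 ht'.1, hu'.2, add_sub_cancel_left, abs_mul]
          have : |ε| = 1 := by rcases hε with rfl | rfl <;> simp
          rw [this, one_mul, abs_of_nonneg (mul_nonneg hmw.le (by linarith))]
        · rw [← volume_image_affine (A := along m.1.rep.1 (ξ t)) hε hmw]
          congr 1
          have hset : {s | s ∈ Icc t u ∧ ξ s ∈ m.1.points} = Icc t u := by
            ext s; exact ⟨fun hs => hs.1, fun hs => ⟨hs, (hu s hs).1⟩⟩
          rw [trace, hset]
          exact image_congr fun s hs => (hu s hs).2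
    · rcases h.germ_left hreg hL ht hm with h1 | ⟨ε, hε, h1⟩
      · filter_upwards [h1, self_mem_nhdsWithin] with u hu htu
        have htu : u < t := htu
        refine hclean u t htu.le (fun s hs => hu s ⟨hs.1.le, hs.2⟩) ?_
        refine measure_mono_null (t := {along m.1.rep.1 (ξ t)}) ?_ (by simp)
        rintro _ ⟨s, ⟨hs, hsm⟩, rfl⟩
        rcases hs.2.eq_or_lt with h2 | h2
        · simp [h2]
        · exact absurd hsm (hu s ⟨hs.1, h2⟩)
      · filter_upwards [h1, self_mem_nhdsWithin] with u hu htu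
        have htu : u < t := htu
        have ht' := hu t ⟨htu.le, le_rfl⟩
        have hu' := hu u ⟨le_rfl, htu.le⟩
        refine hfull u t htu.le hu'.1 ht'.1 ?_ ?_
        · rw [PlaneLine.dist_eq_of_mem hu'.1 ht'.1, hu'.2, add_sub_cancel_left, abs_mul]
          have : |ε| = 1 := by rcases hε with rfl | rfl <;> simp
          rw [this, one_mul, abs_of_nonneg (mul_nonneg hmw.le (by linarith))]
        · rw [← volume_image_affine (A := along m.1.rep.1 (ξ t) + ε * (m.2 * (t - u)))
            (ε := -ε) (by rcases hε with rfl | rfl <;> simp) hmw]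
          congr 1
          have hset : {s | s ∈ Icc u t ∧ ξ s ∈ m.1.points} = Icc u t := by
            ext s; exact ⟨fun hs => hs.1, fun hs => ⟨hs, (hu s hs).1⟩⟩
          rw [trace, hset]
          refine image_congr fun s hs => ?_
          rw [(hu s hs).2]; ring
  obtain ⟨r, hr0, hr, hle⟩ := key
  refine ⟨hle.trans_eq ?_, by linarith⟩
  congr 1
  linear_combination -hr

/-! ### Rotating a line about one of its points -/

/-- Ordinate of the point with abscissa `q` on the line with parameters `p`. -/
noncomputable def ordinate (p : ℝ × ℝ) (q : ℝ) : ℝ := (p.2 + q * Real.sin p.1) / Real.cos p.1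

/-- The point with abscissa `q` on the line with parameters `p`. -/
noncomputable def pointAt (p : ℝ × ℝ) (q : ℝ) : Plane := !₂[q, ordinate p q]

/-- Parameters of the line through the point `(q, a)` with angle `θ`. -/
noncomputable def pencil (q a θ : ℝ) : ℝ × ℝ := (θ, -q * Real.sin θ + a * Real.cos θ)

theorem height_pencil_self (q a θ : ℝ) : height (pencil q a θ) !₂[q, a] = 0 := by
  simp [height, pencil]; ring

theorem pencil_ordinate {p : ℝ × ℝ} (hp : Real.cos p.1 ≠ 0) (q : ℝ) :
    pencil q (ordinate p q) p.1 = p := by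
  refine Prod.ext rfl ?_
  simp only [pencil, ordinate]
  field_simp
  ring

theorem eq_pointAt {ℓ : PlaneLine} (hℓ : Real.cos ℓ.rep.1 ≠ 0) {z : Plane} (hz : z ∈ ℓ.points) :
    z = pointAt ℓ.rep (z 0) := by
  rw [PlaneLine.mem_points, height] at hz
  ext i
  fin_cases i
  · simp [pointAt]
  · simp only [pointAt, ordinate, Fin.mk_one, PiLp.toLp_apply, Matrix.cons_val_one,
      Matrix.cons_val_fin_one]
    rw [eq_div_iff hℓ]
    linarith

theorem height_pencil_add (q a θ h : ℝ) (z : Plane) :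
    height (pencil q a (θ + h)) z = Real.cos h * height (pencil q a θ) z -
      Real.sin h * (along θ z - along θ !₂[q, a]) := by
  simp [height, pencil, along, Real.sin_add, Real.cos_add]; ring

theorem continuous_pencil (q a : ℝ) : Continuous (pencil q a) := by
  unfold pencil; fun_prop

/-- `f` decreases at an infinite rate if `θ` is left in the direction `ε = ±1`. Only rational
increments are tested, so that the condition is measurable. -/
def SteepAt (f : ℝ → ℝ≥0∞) (ε θ : ℝ) : Prop :=
  f θ < ⊤ ∧ ∀ K : ℕ, ∃ j : ℕ, ∀ h : ℚ, (0 : ℝ) < h → (h : ℝ) < 1 / ((j : ℝ) + 1) →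
    f (θ + ε * h) + ENNReal.ofReal (K * h) ≤ f θ

/-- The travel time between the points with abscissas `q` on the line `m` and `q'` on the line
`m'`, as a function of the angle, when the line `m` is rotated about the first of these points. -/
noncomputable def rotatedTime (L : Set (PlaneLine × ℝ)) (m m' : PlaneLine × ℝ) (q q' θ : ℝ) :
    ℝ≥0∞ :=
  travelTime (insert (PlaneLine.ofParam (pencil q (ordinate m.1.rep q) θ), m.2) (L \ {m}))
    (pointAt m.1.rep q) (pointAt m'.1.rep q')

/-- No rotation of a line of `L` about a point with rational abscissa shortens a travel time at an
infinite rate. -/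
def NoSteepRotation (L : Set (PlaneLine × ℝ)) : Prop :=
  ∀ m ∈ L, ∀ m' ∈ L, m ≠ m' → ∀ q q' : ℚ, ∀ ε : ℝ, ε = 1 ∨ ε = -1 →
    ¬ SteepAt (rotatedTime L m m' q q') ε m.1.rep.1

/-- A path that follows a non-vertical line visits a point with rational abscissa. -/
theorem exists_rat_abscissa {ξ : ℝ → Plane} (hξ : Continuous ξ) {ℓ : PlaneLine}
    (hℓ : Real.cos ℓ.rep.1 ≠ 0) {c d : ℝ} (hcd : c ≤ d) (hne : ξ c ≠ ξ d)
    (hmem : ∀ s ∈ Icc c d, ξ s ∈ ℓ.points) : ∃ s ∈ Ioo c d, ∃ q : ℚ, ξ s = pointAt ℓ.rep q := by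
  have h0 : ξ c 0 ≠ ξ d 0 := by
    intro h
    apply hne
    rw [eq_pointAt hℓ (hmem c ⟨le_rfl, hcd⟩), eq_pointAt hℓ (hmem d ⟨hcd, le_rfl⟩), h]
  have hc : Continuous fun s => ξ s 0 := by fun_prop
  have key : ∃ q : ℚ, (q : ℝ) ≠ ξ c 0 ∧ (q : ℝ) ≠ ξ d 0 ∧ (q : ℝ) ∈ uIcc (ξ c 0) (ξ d 0) := by
    rcases lt_or_gt_of_ne h0 with h | h
    · obtain ⟨q, h1, h2⟩ := exists_rat_btwn h
      exact ⟨q, h1.ne', h2.ne, by rw [uIcc_of_le h.le]; exact ⟨h1.le, h2.le⟩⟩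
    · obtain ⟨q, h1, h2⟩ := exists_rat_btwn h
      exact ⟨q, h2.ne, h1.ne', by rw [uIcc_of_ge h.le]; exact ⟨h1.le, h2.le⟩⟩
  obtain ⟨q, hqc, hqd, hq⟩ := key
  obtain ⟨s, hs, hsq⟩ := intermediate_value_uIcc (f := fun s => ξ s 0) hc.continuousOn hq
  rw [uIcc_of_le hcd] at hs
  simp only at hsq
  refine ⟨s, ⟨lt_of_le_of_ne hs.1 ?_, lt_of_le_of_ne hs.2 ?_⟩, q, ?_⟩
  · rintro rfl; exact hqc hsq.symm
  · rintro rfl; exact hqd hsq.symm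
  · rw [← hsq]; exact eq_pointAt hℓ (hmem s hs)

theorem half_mul_le_sin {x : ℝ} (h0 : 0 < x) (h1 : x ≤ 1) : x / 2 ≤ Real.sin x := by
  have := Real.sin_gt_sub_cube h0
  nlinarith [mul_pos h0 h0, mul_le_mul h1 h1 h0.le zero_le_one]

set_option maxHeartbeats 800000 in
/-- A minimal run leaves a line that it has followed only at a crossing with another line.
Otherwise the lines near the point of departure are arbitrarily slow, and a rotation of the line
towards the departing run would shorten the travel time at an infinite rate. -/
theorem IsMinimal.exists_crossing_of_departure {L : Set (PlaneLine × ℝ)} {T : ℝ} {ξ : ℝ → Plane}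
    {k₀ : ℕ} (hreg : SpeedRegular L k₀) (hL : InGeneralDirections L)
    (hvert : ∀ m ∈ L, Real.cos m.1.rep.1 ≠ 0) (hsteep : NoSteepRotation L) (h : IsMinimal L T ξ)
    {m : PlaneLine × ℝ} (hm : m ∈ L) {t₂ : ℝ} (ht₂ : t₂ ∈ Ioo 0 T)
    {ε₁ : ℝ} (hε₁ : ε₁ = 1 ∨ ε₁ = -1)
    (hleft : ∀ᶠ u in 𝓝[<] t₂, ∀ s ∈ Icc u t₂, ξ s ∈ m.1.points ∧
      along m.1.rep.1 (ξ s) = along m.1.rep.1 (ξ t₂) + ε₁ * (m.2 * (t₂ - s)))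
    (hright : ∀ᶠ u in 𝓝[>] t₂, ∀ s ∈ Ioc t₂ u, ξ s ∉ m.1.points) :
    ∃ m' ∈ L, m' ≠ m ∧ ξ t₂ ∈ m'.1.points := by
  by_contra hcon
  push Not at hcon
  have hw : 0 < m.2 := hL.pos m hm
  -- a point on `m` before the departure
  obtain ⟨t₁, ht₁, ht₁'⟩ := (hleft.and (Ioo_mem_nhdsLT ht₂.1)).exists
  obtain ⟨s₁, hs₁, q, hq⟩ := exists_rat_abscissa h.run.cont (hvert m hm) ht₁'.2.le
    (fun heq => by
      have := h.injOn ⟨ht₁'.1.le, (ht₁'.2.trans ht₂.2).le⟩ ⟨ht₂.1.le, ht₂.2.le⟩ heq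
      linarith [ht₁'.2]) (fun s hs => (ht₁ s hs).1)
  -- a point on another line after the departure
  obtain ⟨t₃, ht₃, ht₃'⟩ := (hright.and (Ioo_mem_nhdsGT ht₂.2)).exists
  obtain ⟨m', hm', c, d, hc, hcd, hd, hfol⟩ := h.exists_follows hreg hL ht₂.1.le ht₃'.1 ht₃'.2.le
  have hmm' : m ≠ m' := by
    rintro rfl
    exact ht₃ c ⟨hc, hcd.le.trans hd.le⟩ (hfol c ⟨le_rfl, hcd.le⟩)
  obtain ⟨s₂, hs₂, q', hq'⟩ := exists_rat_abscissa h.run.cont (hvert m' hm') hcd.le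
    (fun heq => by
      have := h.injOn ⟨by linarith [ht₂.1], by linarith [ht₃'.2]⟩
        ⟨by linarith [ht₂.1], by linarith [ht₃'.2]⟩ heq
      linarith) hfol
  have hts₂ : t₂ < s₂ := hc.trans hs₂.1
  have hs₂₃ : s₂ < t₃ := hs₂.2.trans hd
  have hs₁0 : 0 < s₁ := ht₁'.1.trans hs₁.1
  have hs₂T : s₂ < T := hs₂₃.trans ht₃'.2
  set θ := m.1.rep.1 with hθ
  set a := ordinate m.1.rep q with ha
  have hpen : pencil q a θ = m.1.rep := pencil_ordinate (hvert m hm) q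
  have hu₁ : ξ s₁ = !₂[(q : ℝ), a] := hq
  have hfl : m.1.points (ξ t₂) := (ht₁ t₂ ⟨ht₁'.2.le, le_rfl⟩).1
  have hht₂ : height m.1.rep (ξ t₂) = 0 := PlaneLine.mem_points.1 hfl
  have hal := (ht₁ s₁ ⟨hs₁.1.le, hs₁.2.le⟩).2
  set D := m.2 * (t₂ - s₁) with hD
  have hDpos : 0 < D := mul_pos hw (by linarith [hs₁.2])
  have hdist₁ : dist (ξ s₁) (ξ t₂) = D := by
    rw [PlaneLine.dist_eq_of_mem (ht₁ s₁ ⟨hs₁.1.le, hs₁.2.le⟩).1 hfl, hal, add_sub_cancel_left,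
      abs_mul, abs_of_pos hDpos]
    rcases hε₁ with rfl | rfl <;> simp
  -- the side of `m` on which the run departs
  have hne : ∀ t ∈ Ioc t₂ s₂, height m.1.rep (ξ t) ≠ 0 := fun t ht h0 =>
    ht₃ t ⟨ht.1, ht.2.trans hs₂₃.le⟩ (PlaneLine.mem_points.2 h0)
  have hcont : Continuous fun t => height m.1.rep (ξ t) :=
    (continuous_height_right _).comp h.run.cont
  obtain ⟨ε₂, hε₂, hside⟩ : ∃ ε₂ : ℝ, (ε₂ = 1 ∨ ε₂ = -1) ∧
      ∀ t ∈ Ioc t₂ s₂, 0 < ε₂ * height m.1.rep (ξ t) := by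
    rcases lt_or_gt_of_ne (hne s₂ ⟨hts₂, le_rfl⟩) with h1 | h1
    · refine ⟨-1, Or.inr rfl, fun t ht => ?_⟩
      by_contra! h2
      have h3 : 0 ≤ height m.1.rep (ξ t) := by linarith
      obtain ⟨r, hr, hr0⟩ := intermediate_value_Icc' ht.2 hcont.continuousOn
        (show (0 : ℝ) ∈ Icc _ _ from ⟨h1.le, h3⟩)
      exact hne r ⟨ht.1.trans_le hr.1, hr.2⟩ hr0
    · refine ⟨1, Or.inl rfl, fun t ht => ?_⟩
      by_contra! h2
      have h3 : height m.1.rep (ξ t) ≤ 0 := by linarith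
      obtain ⟨r, hr, hr0⟩ := intermediate_value_Icc ht.2 hcont.continuousOn
        (show (0 : ℝ) ∈ Icc _ _ from ⟨h3, h1.le⟩)
      exact hne r ⟨ht.1.trans_le hr.1, hr.2⟩ hr0
  have hε₁2 : ε₁ * ε₁ = 1 := by rcases hε₁ with rfl | rfl <;> norm_num
  have hε₂2 : ε₂ * ε₂ = 1 := by rcases hε₂ with rfl | rfl <;> norm_num
  set ε := -(ε₁ * ε₂) with hε
  have hεpm : ε = 1 ∨ ε = -1 := by
    rcases hε₁ with rfl | rfl <;> rcases hε₂ with rfl | rfl <;> simp [hε]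
  have hins : insert (m.1, m.2) (L \ {m}) = L := by
    rw [Prod.mk.eta, insert_sdiff_singleton, insert_eq_of_mem hm]
  have hf₀ : rotatedTime L m m' q q' θ = travelTime L (ξ s₁) (ξ s₂) := by
    rw [rotatedTime, ← ha, hpen, PlaneLine.ofParam_rep, hins, hq, hq']
  refine hsteep m hm m' hm' hmm' q q' ε hεpm ⟨?_, fun K => ?_⟩
  · rw [hf₀]
    exact (h.run.reach (by linarith [hs₁.2])).reachTime_le.trans_lt ENNReal.ofReal_lt_top
  -- a speed that is small enough for the required rate
  set v : ℝ := (1 / m.2 + 2 * K / D + 1)⁻¹ with hv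
  have hvinv : v⁻¹ = 1 / m.2 + 2 * K / D + 1 := by rw [hv, inv_inv]
  have hvpos : 0 < v := by rw [hv]; positivity
  have hslow : ∀ᶠ u in 𝓝[>] t₂, ∀ n ∈ L, (n ≠ m ∧ v ≤ n.2) → ξ u ∉ n.1.points := by
    refine hreg.eventually_notMem h.run.cont nhdsWithin_le_nhds hvpos (fun _ _ h => h.2) ?_
    rintro n hn ⟨hnm, -⟩
    have hnear : ∀ᶠ u in 𝓝 t₂, ξ u ∉ n.1.points :=
      (n.1.isClosed_points.isOpen_compl.preimage h.run.cont).mem_nhds (hcon n hn hnm)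
    exact hnear.filter_mono nhdsWithin_le_nhds
  obtain ⟨b, hb, hb'⟩ := mem_nhdsGT_iff_exists_Ioo_subset.1 hslow
  obtain ⟨e, he, hemin⟩ := exists_between (lt_min (show t₂ < b from hb) hts₂)
  have heb : e < b := hemin.trans_le (min_le_left _ _)
  have hes : e < s₂ := hemin.trans_le (min_le_right _ _)
  -- small rotations keep the point at time `e` on the same side
  have hcψ : Continuous fun x : ℝ => ε₂ * height (pencil q a (θ + ε * x)) (ξ e) := by
    have h1 : Continuous fun x : ℝ => pencil q a (θ + ε * x) :=
      (continuous_pencil q a).comp (by fun_prop)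
    have h2 := continuous_height.comp (h1.prodMk (continuous_const (y := ξ e)))
    exact continuous_const.mul h2
  have hψ0 : 0 < ε₂ * height (pencil q a (θ + ε * 0)) (ξ e) := by
    rw [mul_zero, add_zero, hpen]
    exact hside e ⟨he, hes.le⟩
  obtain ⟨δ, hδ, hδ'⟩ := Metric.eventually_nhds_iff.1
    (hcψ.continuousAt.eventually (lt_mem_nhds hψ0))
  obtain ⟨j, hj⟩ := exists_nat_one_div_lt (lt_min hδ one_pos)
  refine ⟨j, fun x hx0 hxj => ?_⟩
  have hxδ : (x : ℝ) < δ := hxj.trans (hj.trans_le (min_le_left _ _))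
  have hx1 : (x : ℝ) ≤ 1 := (hxj.trans (hj.trans_le (min_le_right _ _))).le
  have hψe : 0 < ε₂ * height (pencil q a (θ + ε * x)) (ξ e) :=
    hδ' (by rw [Real.dist_eq, sub_zero, abs_of_pos hx0]; exact hxδ)
  have hsin : Real.sin (ε * x) = ε * Real.sin x := by
    rcases hεpm with h' | h' <;> simp [h']
  have hsinx := half_mul_le_sin hx0 hx1
  have hht : height (pencil q a (θ + ε * x)) (ξ t₂) = ε * ε₁ * (Real.sin x * D) := by
    rw [height_pencil_add, hpen, hht₂, hsin, ← hu₁, hal]; ring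
  have hψt : ε₂ * height (pencil q a (θ + ε * x)) (ξ t₂) = -(Real.sin x * D) := by
    rw [hht, hε]
    linear_combination (-(Real.sin x * D)) * hε₁2 * (ε₂ * ε₂) - (Real.sin x * D) * hε₂2
  -- the run crosses the rotated line at a time `τ` between `t₂` and `e`
  have hcont' : Continuous fun t => ε₂ * height (pencil q a (θ + ε * x)) (ξ t) :=
    continuous_const.mul ((continuous_height_right _).comp h.run.cont)
  obtain ⟨τ, hτ, hτ0⟩ := intermediate_value_Ioo he.le hcont'.continuousOn
    (show (0 : ℝ) ∈ Ioo _ _ from ⟨by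
      simp only [hψt]
      have : 0 < Real.sin x * D := mul_pos (by linarith) hDpos
      linarith, hψe⟩)
  have hτ0' : height (pencil q a (θ + ε * x)) (ξ τ) = 0 := by
    have : ε₂ ≠ 0 := by rintro rfl; norm_num at hε₂2
    simpa [this] using hτ0
  set X := dist (ξ t₂) (ξ τ) with hX
  have hX1 : X ≤ v * (τ - t₂) := by
    refine h.run.speed_Ioo hvpos hτ.1.le fun u hu hmem => ?_
    obtain ⟨ℓ, w, hmw, hvw, hz⟩ := hmem
    by_cases hlm : (ℓ, w) = m
    · subst hlm
      exact ht₃ u ⟨hu.1, by linarith [hu.2, hτ.2]⟩ hz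
    · exact hb' ⟨hu.1, by linarith [hu.2, hτ.2]⟩ (ℓ, w) hmw ⟨hlm, hvw⟩ hz
  have hX2 : x / 2 * D ≤ X := by
    have h1 := abs_height_sub_le (pencil q a (θ + ε * x)) (ξ t₂) (ξ τ)
    rw [hτ0', sub_zero, hht, abs_mul] at h1
    have h2 : |ε * ε₁| = 1 := by
      rcases hεpm with h' | h' <;> rcases hε₁ with h'' | h'' <;> simp [h', h'']
    rw [h2, one_mul, abs_of_pos (mul_pos (by linarith) hDpos)] at h1
    exact (mul_le_mul_of_nonneg_right hsinx hDpos.le).trans h1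
  have hf : rotatedTime L m m' q q' (θ + ε * x) ≤
      ENNReal.ofReal ((D + X) / m.2) + ENNReal.ofReal (s₂ - τ) := by
    rw [rotatedTime, ← ha, ← hq, ← hq']
    refine (reachTime_triangle _ _ (ξ τ) _).trans (add_le_add ?_ ?_)
    · refine (travelTime_le_of_mem (m := (PlaneLine.ofParam (pencil q a (θ + ε * x)), m.2))
        (mem_insert _ _) hw (PlaneLine.mem_points_ofParam.2 ?_)
        (PlaneLine.mem_points_ofParam.2 hτ0')).trans ?_
      · rw [hu₁]; exact height_pencil_self _ _ _
      · rw [edist_dist, ← ENNReal.ofReal_div_of_pos hw]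
        refine ENNReal.ofReal_le_ofReal (div_le_div_of_nonneg_right ?_ hw.le)
        rw [← hdist₁]
        exact dist_triangle _ _ _
    · refine (travelTime_anti (subset_insert _ _) _ _).trans (h.run.reach_diff ?_ ?_).reachTime_le
      · linarith [hτ.2]
      · exact fun s hs => ht₃ s ⟨hτ.1.trans hs.1, hs.2.le.trans hs₂₃.le⟩
  have hlow : ENNReal.ofReal (s₂ - s₁) ≤ rotatedTime L m m' q q' θ := by
    rw [hf₀]
    exact h.opt s₁ s₂ hs₁0.le (by linarith [hs₁.2]) hs₂T.le
  refine (add_le_add hf le_rfl).trans (le_trans ?_ hlow)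
  have hXnn : 0 ≤ X := dist_nonneg
  rw [← ENNReal.ofReal_add (by positivity) (by linarith [hτ.2]),
    ← ENNReal.ofReal_add (by
      have : 0 ≤ (D + X) / m.2 := by positivity
      linarith [hτ.2]) (by positivity)]
  refine ENNReal.ofReal_le_ofReal ?_
  have h1 : X / v ≤ τ - t₂ := by rw [div_le_iff₀ hvpos]; linarith
  rw [div_eq_mul_inv, hvinv] at h1
  have h2 : (D + X) / m.2 = (t₂ - s₁) + X / m.2 := by rw [hD]; field_simp
  have h3 : K * x ≤ X * (2 * K / D) := by
    have : (K : ℝ) * x = x / 2 * D * (2 * K / D) := by field_simp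
    rw [this]
    exact mul_le_mul_of_nonneg_right hX2 (by positivity)
  have h4 : X * (1 / m.2 + 2 * K / D + 1) = X / m.2 + X * (2 * K / D) + X := by ring
  rw [h4] at h1
  rw [h2]
  linarith

/-! ### Finite unions of intervals with rationally independent end points -/

/-- A compact set of reals which, on either side of each point, locally contains everything or
nothing: a finite union of intervals. -/
structure IsIntervalUnion (K : Set ℝ) : Prop where
  compact : IsCompact K
  right : ∀ p, (∀ᶠ y in 𝓝[>] p, y ∈ K) ∨ ∀ᶠ y in 𝓝[>] p, y ∉ K
  left : ∀ p, (∀ᶠ y in 𝓝[<] p, y ∈ K) ∨ ∀ᶠ y in 𝓝[<] p, y ∉ K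

/-- The set contains the points immediately to the right of `p`. -/
def FullRight (K : Set ℝ) (p : ℝ) : Prop := ∀ᶠ y in 𝓝[>] p, y ∈ K

/-- The set contains the points immediately to the left of `p`. -/
def FullLeft (K : Set ℝ) (p : ℝ) : Prop := ∀ᶠ y in 𝓝[<] p, y ∈ K

open Classical in
/-- The indicator of a proposition, as a rational number. -/
noncomputable def ind (p : Prop) : ℚ := if p then 1 else 0

theorem ind_of_true {p : Prop} (h : p) : ind p = 1 := by simp [ind, h]
theorem ind_of_false {p : Prop} (h : ¬ p) : ind p = 0 := by simp [ind, h]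
theorem ind_congr {p q : Prop} (h : p ↔ q) : ind p = ind q := by rw [propext h]

theorem ind_inj {p q : Prop} (h : ind p = ind q) : p ↔ q := by
  by_cases hp : p <;> by_cases hq : q <;> simp_all [ind]

theorem fullRight_iff_of_Ioo {K : Set ℝ} {c d y : ℝ} (hy : y ∈ Ioo c d) (P : Prop)
    (h : ∀ z ∈ Ioo c d, z ∈ K ↔ P) : (FullRight K y ↔ P) ∧ (FullLeft K y ↔ P) := by
  constructor
  · constructor
    · intro h1
      obtain ⟨z, hz, hz'⟩ := (h1.and (Ioo_mem_nhdsGT hy.2)).exists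
      exact (h z ⟨hy.1.trans hz'.1, hz'.2⟩).1 hz
    · intro hP
      filter_upwards [Ioo_mem_nhdsGT hy.2] with z hz
      exact (h z ⟨hy.1.trans hz.1, hz.2⟩).2 hP
  · constructor
    · intro h1
      obtain ⟨z, hz, hz'⟩ := (h1.and (Ioo_mem_nhdsLT hy.1)).exists
      exact (h z ⟨hz'.1, hz'.2.trans hy.2⟩).1 hz
    · intro hP
      filter_upwards [Ioo_mem_nhdsLT hy.1] with z hz
      exact (h z ⟨hz.1, hz.2.trans hy.2⟩).2 hP

namespace IsIntervalUnion

variable {K K' : Set ℝ}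

theorem exists_right (hK : IsIntervalUnion K) (p : ℝ) :
    ∃ d > p, ∀ z ∈ Ioo p d, z ∈ K ↔ FullRight K p := by
  rcases hK.right p with h | h
  · obtain ⟨d, hd, hd'⟩ := mem_nhdsGT_iff_exists_Ioo_subset.1 h
    exact ⟨d, hd, fun z hz => iff_of_true (hd' hz) h⟩
  · obtain ⟨d, hd, hd'⟩ := mem_nhdsGT_iff_exists_Ioo_subset.1 h
    refine ⟨d, hd, fun z hz => iff_of_false (hd' hz) fun h' => ?_⟩
    obtain ⟨y, hy, hy'⟩ := (h'.and h).exists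
    exact hy' hy

theorem exists_left (hK : IsIntervalUnion K) (p : ℝ) :
    ∃ d < p, ∀ z ∈ Ioo d p, z ∈ K ↔ FullLeft K p := by
  rcases hK.left p with h | h
  · obtain ⟨d, hd, hd'⟩ := mem_nhdsLT_iff_exists_Ioo_subset.1 h
    exact ⟨d, hd, fun z hz => iff_of_true (hd' hz) h⟩
  · obtain ⟨d, hd, hd'⟩ := mem_nhdsLT_iff_exists_Ioo_subset.1 h
    refine ⟨d, hd, fun z hz => iff_of_false (hd' hz) fun h' => ?_⟩
    obtain ⟨y, hy, hy'⟩ := (h'.and h).exists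
    exact hy' hy

theorem volume_inter_of_Ioo {K : Set ℝ} {a b : ℝ} (hab : a ≤ b) (P : Prop)
    (h : ∀ z ∈ Ioo a b, z ∈ K ↔ P) :
    (volume (K ∩ Icc a b)).toReal = (ind P : ℝ) * (b - a) := by
  by_cases hP : P
  · have h1 : volume (K ∩ Icc a b) = ENNReal.ofReal (b - a) := by
      refine le_antisymm ((measure_mono inter_subset_right).trans_eq Real.volume_Icc) ?_
      rw [← Real.volume_Ioo]
      exact measure_mono fun z hz => ⟨(h z hz).2 hP, Ioo_subset_Icc_self hz⟩
    rw [h1, ENNReal.toReal_ofReal (by linarith), ind_of_true hP]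
    simp
  · have h1 : volume (K ∩ Icc a b) = 0 := by
      refine measure_mono_null (t := {a, b}) (fun z hz => ?_) ((Set.toFinite _).measure_zero _)
      by_contra hne
      simp only [mem_insert_iff, mem_singleton_iff, not_or] at hne
      exact hP ((h z ⟨lt_of_le_of_ne hz.2.1 (Ne.symm hne.1), lt_of_le_of_ne hz.2.2 hne.2⟩).1 hz.1)
    rw [h1, ind_of_false hP]
    simp

/-- If a rational linear functional vanishes at all end points but `p₀`, where its value is `1`,
then its value at the total length tells whether `p₀` is a right or a left end point. -/
theorem functional_volume (hK : IsIntervalUnion K) {P : Set ℝ}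
    (hP : ∀ p, p ∉ P → (FullLeft K p ↔ FullRight K p)) {ψ : ℝ →ₗ[ℚ] ℚ} {p₀ : ℝ}
    (h1 : ψ p₀ = 1) (h0 : ∀ p ∈ P, p ≠ p₀ → ψ p = 0) :
    ψ (volume K).toReal = ind (FullLeft K p₀) - ind (FullRight K p₀) := by
  classical
  have hψ : ∀ (P : Prop) (x : ℝ), ψ ((ind P : ℝ) * x) = ind P * ψ x := by
    intro P x
    have : ((ind P : ℚ) : ℝ) * x = (ind P : ℚ) • x := by rw [Rat.smul_def]
    rw [this, map_smul, smul_eq_mul]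
  have key : ∀ a b, a < b → ψ (volume (K ∩ Icc a b)).toReal =
      ind (FullLeft K b) * ψ b - ind (FullRight K a) * ψ a +
        if a < p₀ ∧ p₀ < b then ind (FullLeft K p₀) - ind (FullRight K p₀) else 0 := by
    intro a b hab
    have := interval_induction (P := fun a b => a = b ∨ ψ (volume (K ∩ Icc a b)).toReal =
      ind (FullLeft K b) * ψ b - ind (FullRight K a) * ψ a +
        if a < p₀ ∧ p₀ < b then ind (FullLeft K p₀) - ind (FullRight K p₀) else 0) hab.le
      (fun t => Or.inl rfl) (fun r s t har hrs hst htb hrs' hst' => ?_) (fun t _ => ?_)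
      (fun t _ => ?_)
    · exact this.resolve_left hab.ne
    · rcases hrs' with rfl | h2
      · exact hst'
      rcases hst' with rfl | h3
      · exact Or.inr h2
      right
      rcases hrs.eq_or_lt with rfl | hrs
      · exact h3
      rcases hst.eq_or_lt with rfl | hst
      · exact h2
      have hvol : (volume (K ∩ Icc r t)).toReal =
          (volume (K ∩ Icc r s)).toReal + (volume (K ∩ Icc s t)).toReal := by
        rw [← Icc_union_Icc_eq_Icc hrs.le hst.le, inter_union_distrib_left, measure_union₀
          (hK.compact.isClosed.measurableSet.inter measurableSet_Icc).nullMeasurableSet,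
          ENNReal.toReal_add]
        · exact ((measure_mono inter_subset_left).trans_lt hK.compact.measure_lt_top).ne
        · exact ((measure_mono inter_subset_left).trans_lt hK.compact.measure_lt_top).ne
        · refine measure_mono_null (t := {s}) ?_ (by simp)
          rintro z ⟨⟨-, hz⟩, ⟨-, hz'⟩⟩
          exact le_antisymm hz.2 hz'.1
      rw [hvol, map_add, h2, h3]
      -- the contributions at `s` cancel unless `s` is the exceptional point
      have hs : ind (FullLeft K s) * ψ s - ind (FullRight K s) * ψ s =
          if s = p₀ then ind (FullLeft K p₀) - ind (FullRight K p₀) else 0 := by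
        split_ifs with h
        · rw [h, h1]; ring
        · by_cases hsP : s ∈ P
          · rw [h0 s hsP h]; ring
          · rw [ind_congr (hP s hsP)]; ring
      have hif : (if r < p₀ ∧ p₀ < t then ind (FullLeft K p₀) - ind (FullRight K p₀) else 0) =
          (if r < p₀ ∧ p₀ < s then ind (FullLeft K p₀) - ind (FullRight K p₀) else 0) +
          (if s < p₀ ∧ p₀ < t then ind (FullLeft K p₀) - ind (FullRight K p₀) else 0) +
          (if s = p₀ then ind (FullLeft K p₀) - ind (FullRight K p₀) else 0) := by
        rcases lt_trichotomy s p₀ with h | h | h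
        · simp [h, hrs.trans h, h.ne, h.not_gt]
        · subst h; simp [hrs, hst]
        · simp [h, h.trans hst, h.ne', h.not_gt]
      rw [hif]
      linear_combination hs
    · obtain ⟨d, hd, hd'⟩ := hK.exists_right t
      have hev : ∀ᶠ u in 𝓝[>] t, ¬ (t < p₀ ∧ p₀ < u) := by
        by_cases h : t < p₀
        · filter_upwards [Ioo_mem_nhdsGT h] with u hu h'
          exact absurd h'.2 hu.2.not_gt
        · exact Eventually.of_forall fun u h' => h h'.1
      filter_upwards [Ioo_mem_nhdsGT hd, hev] with u hu hu'
      right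
      rw [volume_inter_of_Ioo hu.1.le (FullRight K t) (fun z hz => hd' z ⟨hz.1, hz.2.trans hu.2⟩),
        if_neg hu', hψ, ind_congr (fullRight_iff_of_Ioo hu _ hd').2, map_sub]
      ring
    · obtain ⟨d, hd, hd'⟩ := hK.exists_left t
      have hev : ∀ᶠ u in 𝓝[<] t, ¬ (u < p₀ ∧ p₀ < t) := by
        by_cases h : p₀ < t
        · filter_upwards [Ioo_mem_nhdsLT h] with u hu h'
          exact absurd h'.1 hu.1.not_gt
        · exact Eventually.of_forall fun u h' => h h'.2
      filter_upwards [Ioo_mem_nhdsLT hd, hev] with u hu hu'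
      right
      rw [volume_inter_of_Ioo hu.2.le (FullLeft K t) (fun z hz => hd' z ⟨hu.1.trans hz.1, hz.2⟩),
        if_neg hu', hψ, ind_congr (fullRight_iff_of_Ioo hu _ hd').1, map_sub]
      ring
  obtain ⟨R, hR⟩ := hK.compact.isBounded.subset_closedBall 0
  set M := max R |p₀| with hM
  have hp₀ := abs_le.1 (le_max_right R |p₀|)
  have hKM : ∀ y ∈ K, |y| ≤ M := fun y hy => by
    have := hR hy
    rw [mem_closedBall_zero_iff, Real.norm_eq_abs] at this
    exact this.trans (le_max_left _ _)
  have hM0 : 0 ≤ M := (abs_nonneg _).trans (le_max_right _ _)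
  have h2 := key (-(M + 1)) (M + 1) (by linarith)
  have h3 : K ∩ Icc (-(M + 1)) (M + 1) = K := by
    refine inter_eq_left.2 fun y hy => ?_
    have := abs_le.1 (hKM y hy)
    exact ⟨by linarith, by linarith⟩
  have h4 : ¬ FullLeft K (M + 1) := by
    intro h
    obtain ⟨y, hy, hy'⟩ := (h.and (Ioo_mem_nhdsLT (show M < M + 1 by linarith))).exists
    have := abs_le.1 (hKM y hy)
    linarith [hy'.1]
  have h5 : ¬ FullRight K (-(M + 1)) := by
    intro h
    obtain ⟨y, hy, hy'⟩ :=
      (h.and (Ioo_mem_nhdsGT (show -(M + 1) < -M by linarith))).exists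
    have := abs_le.1 (hKM y hy)
    linarith [hy'.2]
  rw [h3, ind_of_false h4, ind_of_false h5, if_pos ⟨by linarith, by linarith⟩] at h2
  simpa using h2

/-- Two finite unions of intervals of the same length, all of whose end points belong to a
rationally independent set, agree up to finitely many points. -/
theorem fullRight_iff (hK : IsIntervalUnion K) (hK' : IsIntervalUnion K') {P : Set ℝ}
    (hP : ∀ p, p ∉ P → (FullLeft K p ↔ FullRight K p))
    (hP' : ∀ p, p ∉ P → (FullLeft K' p ↔ FullRight K' p))
    (hind : ∀ p ∈ P, p ∉ Submodule.span ℚ (P \ {p}))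
    (hvol : (volume K).toReal = (volume K').toReal) (t : ℝ) : FullRight K t ↔ FullRight K' t := by
  have hjump : ∀ p, ind (FullLeft K p) - ind (FullRight K p) =
      ind (FullLeft K' p) - ind (FullRight K' p) := by
    intro p
    by_cases hp : p ∈ P
    · obtain ⟨f, hf, hker⟩ := Submodule.exists_le_ker_of_notMem (hind p hp)
      have h1 : ((f p)⁻¹ • f) p = 1 := by simp [hf]
      have h0 : ∀ y ∈ P, y ≠ p → ((f p)⁻¹ • f) y = 0 := by
        intro y hy hyp
        have : f y = 0 := hker (Submodule.subset_span ⟨hy, hyp⟩)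
        simp [this]
      rw [← hK.functional_volume hP h1 h0, ← hK'.functional_volume hP' h1 h0, hvol]
    · rw [ind_congr (hP p hp), ind_congr (hP' p hp)]; ring
  have hconst : ∀ a b, a ≤ b → ind (FullRight K a) - ind (FullRight K' a) =
      ind (FullRight K b) - ind (FullRight K' b) := by
    intro a b hab
    refine interval_induction (P := fun a b => ind (FullRight K a) - ind (FullRight K' a) =
      ind (FullRight K b) - ind (FullRight K' b)) hab (fun _ => rfl)
      (fun _ _ _ _ _ _ _ h h' => h.trans h') (fun t _ => ?_) (fun t _ => ?_)
    · obtain ⟨d, hd, hd'⟩ := hK.exists_right t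
      obtain ⟨e, he, he'⟩ := hK'.exists_right t
      filter_upwards [Ioo_mem_nhdsGT hd, Ioo_mem_nhdsGT he] with u hu hu'
      rw [ind_congr (fullRight_iff_of_Ioo hu _ hd').1, ind_congr (fullRight_iff_of_Ioo hu' _ he').1]
    · obtain ⟨d, hd, hd'⟩ := hK.exists_left t
      obtain ⟨e, he, he'⟩ := hK'.exists_left t
      filter_upwards [Ioo_mem_nhdsLT hd, Ioo_mem_nhdsLT he] with u hu hu'
      rw [ind_congr (fullRight_iff_of_Ioo hu _ hd').1, ind_congr (fullRight_iff_of_Ioo hu' _ he').1]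
      linarith [hjump t]
  obtain ⟨R, hR⟩ := (hK.compact.union hK'.compact).isBounded.subset_closedBall 0
  have hout : ∀ (S : Set ℝ), S ⊆ K ∪ K' → ¬ FullRight S (max t R) := by
    intro S hS h
    obtain ⟨y, hy, hy'⟩ := (h.and self_mem_nhdsWithin).exists
    have h1 := hR (hS hy)
    rw [mem_closedBall_zero_iff, Real.norm_eq_abs] at h1
    have h2 := (abs_le.1 h1).2
    have h3 : max t R < y := hy'
    linarith [le_max_right t R]
  have := hconst t (max t R) (le_max_left _ _)
  rw [ind_of_false (hout K subset_union_left), ind_of_false (hout K' subset_union_right)] at this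
  exact ind_inj (by linarith)

end IsIntervalUnion

/-! ### Uniqueness of minimal runs -/

/-- Positions on the line `m` of its crossings with the other lines of `L`. -/
def crossings (L : Set (PlaneLine × ℝ)) (m : PlaneLine × ℝ) : Set ℝ :=
  {c | ∃ m' ∈ L, m' ≠ m ∧ ∃ z, z ∈ m.1.points ∧ z ∈ m'.1.points ∧ along m.1.rep.1 z = c}

/-- The behaviour, near a time `t₀` at which the minimal run is on the line `m`, of the set of
visited points of this line. -/
theorem IsMinimal.trace_germ {L : Set (PlaneLine × ℝ)} {T : ℝ} {ξ : ℝ → Plane} {k₀ : ℕ}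
    (hreg : SpeedRegular L k₀) (hL : InGeneralDirections L)
    (hvert : ∀ m ∈ L, Real.cos m.1.rep.1 ≠ 0) (hsteep : NoSteepRotation L) (h : IsMinimal L T ξ)
    {m : PlaneLine × ℝ} (hm : m ∈ L) {t₀ : ℝ} (ht₀ : t₀ ∈ Ioo 0 T) (hmem : ξ t₀ ∈ m.1.points) :
    (∀ σ : ℝ, σ = 1 ∨ σ = -1 →
      ∀ᶠ x in 𝓝[>] (0 : ℝ), along m.1.rep.1 (ξ t₀) + σ * x ∈ trace m ξ 0 T) ∨
    (∀ σ : ℝ, σ = 1 ∨ σ = -1 →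
      ∀ᶠ x in 𝓝[>] (0 : ℝ), along m.1.rep.1 (ξ t₀) + σ * x ∉ trace m ξ 0 T) ∨
    (along m.1.rep.1 (ξ t₀) ∈ crossings L m ∧ ∃ σ : ℝ, (σ = 1 ∨ σ = -1) ∧
      (∀ᶠ x in 𝓝[>] (0 : ℝ), along m.1.rep.1 (ξ t₀) + σ * x ∈ trace m ξ 0 T) ∧
      ∀ᶠ x in 𝓝[>] (0 : ℝ), along m.1.rep.1 (ξ t₀) + -σ * x ∉ trace m ξ 0 T) := by
  set θ := m.1.rep.1 with hθ
  set p := along θ (ξ t₀) with hp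
  have hw : 0 < m.2 := hL.pos m hm
  have hcont : Continuous fun t => along θ (ξ t) := (continuous_along_right _).comp h.run.cont
  have hinj : ∀ s ∈ Icc 0 T, ∀ t ∈ Icc 0 T, ξ s ∈ m.1.points → ξ t ∈ m.1.points →
      along θ (ξ s) = along θ (ξ t) → s = t := by
    intro s hs t ht hsm htm heq
    refine h.injOn hs ht (dist_eq_zero.1 ?_)
    rw [PlaneLine.dist_eq_of_mem hsm htm, ← hθ, heq, sub_self, abs_zero]
  -- points of the trace near `p` are visited near the time `t₀`
  have hnear : ∀ a b, a < t₀ → t₀ < b → ∀ᶠ y in 𝓝 p, y ∈ trace m ξ 0 T →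
      ∃ t ∈ Ioo a b, t ∈ Icc 0 T ∧ ξ t ∈ m.1.points ∧ along θ (ξ t) = y := by
    intro a b ha hb
    set A : Set ℝ := (Icc 0 T ∩ ξ ⁻¹' m.1.points) ∩ (Ioo a b)ᶜ with hA
    have hAc : IsCompact A := (isCompact_Icc.inter_right
      (m.1.isClosed_points.preimage h.run.cont)).inter_right isOpen_Ioo.isClosed_compl
    have hpA : p ∈ ((fun t => along θ (ξ t)) '' A)ᶜ := by
      rintro ⟨t, ⟨⟨ht, htm⟩, htab⟩, hteq⟩
      have := hinj t ht t₀ ⟨ht₀.1.le, ht₀.2.le⟩ htm hmem hteq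
      subst this
      exact htab ⟨ha, hb⟩
    filter_upwards [(hAc.image hcont).isClosed.isOpen_compl.mem_nhds hpA] with y hy hyK
    obtain ⟨t, ⟨ht, htm⟩, hty⟩ := hyK
    by_cases htab : t ∈ Ioo a b
    · exact ⟨t, htab, ht, htm, hty⟩
    · exact absurd ⟨t, ⟨⟨ht, htm⟩, htab⟩, hty⟩ hy
  have htend : ∀ σ : ℝ, Tendsto (fun x : ℝ => p + σ * x) (𝓝[>] 0) (𝓝 p) := by
    intro σ
    have h1 : Continuous fun x : ℝ => p + σ * x := by fun_prop
    have h2 := h1.tendsto 0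
    simp only [mul_zero, add_zero] at h2
    exact h2.mono_left nhdsWithin_le_nhds
  have hR := h.germ_right hreg hL ⟨ht₀.1.le, ht₀.2⟩ hm
  have hLe := h.germ_left hreg hL ⟨ht₀.1, ht₀.2.le⟩ hm
  -- a side is full if the run follows the line there
  have hfullR : ∀ ε : ℝ, (∀ᶠ u in 𝓝[>] t₀, ∀ s ∈ Icc t₀ u, ξ s ∈ m.1.points ∧
      along θ (ξ s) = p + ε * (m.2 * (s - t₀))) →
      ∀ᶠ x in 𝓝[>] (0 : ℝ), p + ε * x ∈ trace m ξ 0 T := by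
    intro ε hev
    obtain ⟨u, hu, hu'⟩ := (hev.and (Ioo_mem_nhdsGT ht₀.2)).exists
    filter_upwards [Ioo_mem_nhdsGT (show 0 < m.2 * (u - t₀) from
      mul_pos hw (by linarith [hu'.1]))] with x hx
    have hxw : x / m.2 ≤ u - t₀ := by rw [div_le_iff₀ hw]; linarith [hx.2]
    have hxw0 : 0 ≤ x / m.2 := div_nonneg hx.1.le hw.le
    have := hu (t₀ + x / m.2) ⟨by linarith, by linarith⟩
    refine ⟨t₀ + x / m.2, ⟨⟨by linarith [ht₀.1], by linarith [hu'.2]⟩, this.1⟩, ?_⟩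
    refine this.2.trans ?_
    field_simp
    ring
  have hfullL : ∀ ε : ℝ, (∀ᶠ u in 𝓝[<] t₀, ∀ s ∈ Icc u t₀, ξ s ∈ m.1.points ∧
      along θ (ξ s) = p + ε * (m.2 * (t₀ - s))) →
      ∀ᶠ x in 𝓝[>] (0 : ℝ), p + ε * x ∈ trace m ξ 0 T := by
    intro ε hev
    obtain ⟨u, hu, hu'⟩ := (hev.and (Ioo_mem_nhdsLT ht₀.1)).exists
    filter_upwards [Ioo_mem_nhdsGT (show 0 < m.2 * (t₀ - u) from
      mul_pos hw (by linarith [hu'.2]))] with x hx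
    have hxw : x / m.2 ≤ t₀ - u := by rw [div_le_iff₀ hw]; linarith [hx.2]
    have hxw0 : 0 ≤ x / m.2 := div_nonneg hx.1.le hw.le
    have := hu (t₀ - x / m.2) ⟨by linarith, by linarith⟩
    refine ⟨t₀ - x / m.2, ⟨⟨by linarith [hu'.1], by linarith [ht₀.2]⟩, this.1⟩, ?_⟩
    refine this.2.trans ?_
    field_simp
    ring
  rcases hR with hR | ⟨ε, hε, hR⟩ <;> rcases hLe with hLe | ⟨ε', hε', hLe⟩
  · -- the line is visited in isolation
    right; left
    intro σ hσ
    obtain ⟨b, hb, hb'⟩ := (hR.and self_mem_nhdsWithin).exists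
    obtain ⟨a, ha, ha'⟩ := (hLe.and self_mem_nhdsWithin).exists
    filter_upwards [(htend σ).eventually (hnear a b ha' hb'), self_mem_nhdsWithin] with x hx hx0 hxK
    have hx0 : 0 < x := hx0
    obtain ⟨t, ht, -, htm, hteq⟩ := hx hxK
    rcases lt_trichotomy t t₀ with h1 | h1 | h1
    · exact ha t ⟨ht.1.le, h1⟩ htm
    · rw [h1, ← hp] at hteq
      rcases hσ with rfl | rfl <;> linarith
    · exact hb t ⟨h1, ht.2.le⟩ htm
  · -- the run arrives along the line and departs
    right; right
    refine ⟨?_, ε', hε', hfullL ε' hLe, ?_⟩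
    · obtain ⟨m', hm', hne, hz⟩ := h.exists_crossing_of_departure hreg hL hvert hsteep hm ht₀ hε'
        hLe hR
      exact ⟨m', hm', hne, ξ t₀, hmem, hz, rfl⟩
    · obtain ⟨b, hb, hb'⟩ := (hR.and self_mem_nhdsWithin).exists
      obtain ⟨a, ha, ha'⟩ := (hLe.and self_mem_nhdsWithin).exists
      have ha' : a < t₀ := ha'
      filter_upwards [(htend (-ε')).eventually (hnear a b ha' hb'), self_mem_nhdsWithin]
        with x hx hx0 hxK
      have hx0 : 0 < x := hx0
      obtain ⟨t, ht, -, htm, hteq⟩ := hx hxK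
      rcases le_or_gt t t₀ with h1 | h1
      · rw [(ha t ⟨ht.1.le, h1⟩).2] at hteq
        have : 0 ≤ m.2 * (t₀ - t) := mul_nonneg hw.le (by linarith)
        rcases hε' with rfl | rfl <;> linarith
      · exact hb t ⟨h1, ht.2.le⟩ htm
  · -- the run arrives at the line and follows it
    right; right
    refine ⟨?_, ε, hε, hfullR ε hR, ?_⟩
    · have h2 := h.reverse
      have htend' : Tendsto (fun u => T - u) (𝓝[>] (T - t₀)) (𝓝[<] t₀) := by
        refine tendsto_nhdsWithin_iff.2 ⟨?_, ?_⟩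
        · have : Tendsto (fun u => T - u) (𝓝 (T - t₀)) (𝓝 (T - (T - t₀))) :=
            Continuous.tendsto (by fun_prop) _
          rw [sub_sub_cancel] at this
          exact this.mono_left nhdsWithin_le_nhds
        · filter_upwards [self_mem_nhdsWithin] with u hu
          have : T - t₀ < u := hu
          simp only [mem_Iio]
          linarith
      have htend'' : Tendsto (fun u => T - u) (𝓝[<] (T - t₀)) (𝓝[>] t₀) := by
        have := tendsto_sub_nhdsLT T (T - t₀)
        rwa [sub_sub_cancel] at this
      have hA : ∀ᶠ u in 𝓝[<] (T - t₀), ∀ s ∈ Icc u (T - t₀), ξ (T - s) ∈ m.1.points ∧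
          along m.1.rep.1 (ξ (T - s)) =
            along m.1.rep.1 (ξ (T - (T - t₀))) + ε * (m.2 * ((T - t₀) - s)) := by
        filter_upwards [htend''.eventually hR] with u hu s hs
        have := hu (T - s) ⟨by linarith [hs.2], by linarith [hs.1]⟩
        refine ⟨this.1, this.2.trans ?_⟩
        rw [sub_sub_cancel]
        ring
      have hB : ∀ᶠ u in 𝓝[>] (T - t₀), ∀ s ∈ Ioc (T - t₀) u, ξ (T - s) ∉ m.1.points := by
        filter_upwards [htend'.eventually hLe] with u hu s hs
        exact hu (T - s) ⟨by linarith [hs.2], by linarith [hs.1]⟩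
      obtain ⟨m', hm', hne, hz⟩ := h2.exists_crossing_of_departure hreg hL hvert hsteep hm
        (t₂ := T - t₀) ⟨by linarith [ht₀.2], by linarith [ht₀.1]⟩ hε hA hB
      refine ⟨m', hm', hne, ξ t₀, hmem, ?_, rfl⟩
      simpa using hz
    · obtain ⟨b, hb, hb'⟩ := (hR.and self_mem_nhdsWithin).exists
      obtain ⟨a, ha, ha'⟩ := (hLe.and self_mem_nhdsWithin).exists
      have hb' : t₀ < b := hb'
      filter_upwards [(htend (-ε)).eventually (hnear a b ha' hb'), self_mem_nhdsWithin]
        with x hx hx0 hxK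
      have hx0 : 0 < x := hx0
      obtain ⟨t, ht, -, htm, hteq⟩ := hx hxK
      rcases lt_or_ge t t₀ with h1 | h1
      · exact ha t ⟨ht.1.le, h1⟩ htm
      · rw [(hb t ⟨h1, ht.2.le⟩).2] at hteq
        have : 0 ≤ m.2 * (t - t₀) := mul_nonneg hw.le (by linarith)
        rcases hε with rfl | rfl <;> linarith
  · -- the run follows the line before and after; it cannot turn back
    left
    have hne : ε ≠ ε' := by
      rintro rfl
      obtain ⟨b, hb, hb'⟩ := (hR.and (Ioo_mem_nhdsGT ht₀.2)).exists
      obtain ⟨a, ha, ha'⟩ := (hLe.and (Ioo_mem_nhdsLT ht₀.1)).exists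
      set e := min (b - t₀) (t₀ - a) with he
      have he0 : 0 < e := lt_min (by linarith [hb'.1]) (by linarith [ha'.2])
      have h1 := hb (t₀ + e) ⟨by linarith, by linarith [min_le_left (b - t₀) (t₀ - a)]⟩
      have h2 := ha (t₀ - e) ⟨by linarith [min_le_right (b - t₀) (t₀ - a)], by linarith⟩
      have := hinj (t₀ + e) ⟨by linarith [ht₀.1], by
        linarith [hb'.2, min_le_left (b - t₀) (t₀ - a)]⟩ (t₀ - e)
        ⟨by linarith [ha'.1, min_le_right (b - t₀) (t₀ - a)], by linarith [ht₀.2]⟩ h1.1 h2.1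
        (by rw [h1.2, h2.2]; ring)
      linarith
    intro σ hσ
    by_cases hσε : σ = ε
    · rw [hσε]; exact hfullR ε hR
    · have : σ = ε' := by
        rcases hσ with rfl | rfl <;> rcases hε with rfl | rfl <;> rcases hε' with rfl | rfl <;>
          first | rfl | exact absurd rfl hσε | exact absurd rfl hne
      rw [this]; exact hfullL ε' hLe

theorem tendsto_sub_right (p : ℝ) : Tendsto (fun y => y - p) (𝓝[>] p) (𝓝[>] 0) := by
  refine tendsto_nhdsWithin_iff.2 ⟨?_, ?_⟩
  · have : Tendsto (fun y => y - p) (𝓝 p) (𝓝 (p - p)) := Continuous.tendsto (by fun_prop) _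
    rw [sub_self] at this
    exact this.mono_left nhdsWithin_le_nhds
  · filter_upwards [self_mem_nhdsWithin] with u hu
    have : p < u := hu
    simp only [mem_Ioi]
    linarith

theorem tendsto_sub_left (p : ℝ) : Tendsto (fun y => p - y) (𝓝[<] p) (𝓝[>] 0) := by
  have := tendsto_sub_nhdsLT p p
  rwa [sub_self] at this

theorem eventually_right_of {Q : ℝ → Prop} {p : ℝ} (h : ∀ᶠ x in 𝓝[>] (0 : ℝ), Q (p + 1 * x)) :
    ∀ᶠ y in 𝓝[>] p, Q y := by
  filter_upwards [(tendsto_sub_right p).eventually h] with y hy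
  simpa using hy

theorem eventually_left_of {Q : ℝ → Prop} {p : ℝ} (h : ∀ᶠ x in 𝓝[>] (0 : ℝ), Q (p + -1 * x)) :
    ∀ᶠ y in 𝓝[<] p, Q y := by
  filter_upwards [(tendsto_sub_left p).eventually h] with y hy
  simpa using hy

/-- The visited points of a line form a finite union of intervals; their end points are crossings
with other lines. -/
theorem IsMinimal.isIntervalUnion_trace {L : Set (PlaneLine × ℝ)} {T : ℝ} {ξ : ℝ → Plane} {k₀ : ℕ}
    (hreg : SpeedRegular L k₀) (hL : InGeneralDirections L)
    (hvert : ∀ m ∈ L, Real.cos m.1.rep.1 ≠ 0) (hsteep : NoSteepRotation L) (h : IsMinimal L T ξ)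
    {m : PlaneLine × ℝ} (hm : m ∈ L) (h0 : ξ 0 ∉ m.1.points) (hT : ξ T ∉ m.1.points) :
    IsIntervalUnion (trace m ξ 0 T) ∧
    ∀ p, p ∉ crossings L m → (FullLeft (trace m ξ 0 T) p ↔ FullRight (trace m ξ 0 T) p) := by
  have hcomp := isCompact_trace m h.run.cont 0 T
  have key : ∀ p ∈ trace m ξ 0 T, ∃ t₀ ∈ Ioo 0 T, ξ t₀ ∈ m.1.points ∧
      along m.1.rep.1 (ξ t₀) = p := by
    rintro _ ⟨t, ⟨ht, htm⟩, rfl⟩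
    refine ⟨t, ⟨lt_of_le_of_ne ht.1 ?_, lt_of_le_of_ne ht.2 ?_⟩, htm, rfl⟩
    · rintro rfl; exact h0 htm
    · rintro rfl; exact hT htm
  have hout : ∀ p, p ∉ trace m ξ 0 T → ∀ᶠ y in 𝓝 p, y ∉ trace m ξ 0 T := fun p hp =>
    hcomp.isClosed.isOpen_compl.mem_nhds hp
  have habs : ∀ {l : Filter ℝ} [l.NeBot] {S : Set ℝ}, (∀ᶠ y in l, y ∉ S) → ¬ ∀ᶠ y in l, y ∈ S := by
    intro l _ S h1 h2
    obtain ⟨y, hy, hy'⟩ := (h1.and h2).exists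
    exact hy hy'
  refine ⟨⟨hcomp, fun p => ?_, fun p => ?_⟩, fun p hp => ?_⟩
  · by_cases hpK : p ∈ trace m ξ 0 T
    · obtain ⟨t₀, ht₀, htm, rfl⟩ := key p hpK
      rcases h.trace_germ hreg hL hvert hsteep hm ht₀ htm with h1 | h1 | ⟨-, σ, hσ, h1, h2⟩
      · exact Or.inl (eventually_right_of (h1 1 (Or.inl rfl)))
      · exact Or.inr (eventually_right_of (h1 1 (Or.inl rfl)))
      · rcases hσ with rfl | rfl
        · exact Or.inl (eventually_right_of h1)
        · rw [neg_neg] at h2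
          exact Or.inr (eventually_right_of h2)
    · exact Or.inr ((hout p hpK).filter_mono nhdsWithin_le_nhds)
  · by_cases hpK : p ∈ trace m ξ 0 T
    · obtain ⟨t₀, ht₀, htm, rfl⟩ := key p hpK
      rcases h.trace_germ hreg hL hvert hsteep hm ht₀ htm with h1 | h1 | ⟨-, σ, hσ, h1, h2⟩
      · exact Or.inl (eventually_left_of (h1 (-1) (Or.inr rfl)))
      · exact Or.inr (eventually_left_of (h1 (-1) (Or.inr rfl)))
      · rcases hσ with rfl | rfl
        · exact Or.inr (eventually_left_of h2)
        · exact Or.inl (eventually_left_of h1)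
    · exact Or.inr ((hout p hpK).filter_mono nhdsWithin_le_nhds)
  · by_cases hpK : p ∈ trace m ξ 0 T
    · obtain ⟨t₀, ht₀, htm, rfl⟩ := key p hpK
      rcases h.trace_germ hreg hL hvert hsteep hm ht₀ htm with h1 | h1 | ⟨h1, -⟩
      · exact iff_of_true (eventually_left_of (h1 (-1) (Or.inr rfl)))
          (eventually_right_of (h1 1 (Or.inl rfl)))
      · exact iff_of_false (habs (eventually_left_of (h1 (-1) (Or.inr rfl))))
          (habs (eventually_right_of (h1 1 (Or.inl rfl))))
      · exact absurd h1 hp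
    · exact iff_of_false (habs ((hout p hpK).filter_mono nhdsWithin_le_nhds))
        (habs ((hout p hpK).filter_mono nhdsWithin_le_nhds))

/-- `f` has a concave corner at `w` as a function of the slowness `1 / w`: towards smaller slowness
it falls at a rate of at least `q'`, towards larger slowness it rises at a rate of at most `q`,
where `q < q'` in the applications. Only rational speeds are tested, so that the condition is
measurable. -/
def CornerAt (f : ℝ → ℝ≥0∞) (q q' : ℚ) (w : ℝ) : Prop :=
  f w < ⊤ ∧ (∀ r : ℚ, w < r → f r + ENNReal.ofReal (q' * (1 / w - 1 / r)) ≤ f w) ∧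
    ∀ r : ℚ, (0 : ℝ) < r → (r : ℝ) < w → f r ≤ f w + ENNReal.ofReal (q * (1 / r - 1 / w))

/-- The travel time between `x` and `y` has no corner as a function of the speed of a line. -/
def NoCorner (L : Set (PlaneLine × ℝ)) (x y : Plane) : Prop :=
  ∀ m ∈ L, ∀ q q' : ℚ, 0 ≤ q → q < q' →
    ¬ CornerAt (fun w => travelTime (insert (m.1, w) (L \ {m})) x y) q q' m.2

/-- The genericity properties of a family of lines from which the uniqueness of minimal runs from
`x` to `y` follows. -/
structure IsGeneric (L : Set (PlaneLine × ℝ)) (x y : Plane) : Prop where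
  dirs : InGeneralDirections L
  not_vertical : ∀ m ∈ L, Real.cos m.1.rep.1 ≠ 0
  notMem_left : ∀ m ∈ L, x ∉ m.1.points
  notMem_right : ∀ m ∈ L, y ∉ m.1.points
  noSteep : NoSteepRotation L
  noCorner : NoCorner L x y
  indep : ∀ m ∈ L, ∀ p ∈ crossings L m, p ∉ Submodule.span ℚ (crossings L m \ {p})

/-- Two minimal runs spend the same time on each line: otherwise the travel time would have a
corner as a function of the speed of the line. -/
theorem IsMinimal.volume_trace_le {L : Set (PlaneLine × ℝ)} {T : ℝ} {ξ ξ' : ℝ → Plane} {k₀ : ℕ}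
    {x y : Plane} (hreg : SpeedRegular L k₀) (hG : IsGeneric L x y) (hT : 0 ≤ T)
    (h : IsMinimal L T ξ) (h' : IsMinimal L T ξ') (h0 : ξ 0 = x) (h0' : ξ' 0 = x) (h1 : ξ T = y)
    (h1' : ξ' T = y) {m : PlaneLine × ℝ} (hm : m ∈ L) :
    (volume (trace m ξ' 0 T)).toReal ≤ (volume (trace m ξ 0 T)).toReal := by
  by_contra! hlt
  set κ := (volume (trace m ξ 0 T)).toReal
  set κ' := (volume (trace m ξ' 0 T)).toReal
  have hw : 0 < m.2 := hG.dirs.pos m hm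
  have hκ : 0 ≤ κ := ENNReal.toReal_nonneg
  obtain ⟨q, hq1, hq⟩ := exists_rat_btwn hlt
  obtain ⟨q', hq'1, hq'⟩ := exists_rat_btwn hq
  have hle : ∀ w, 0 < w → travelTime (insert (m.1, w) (L \ {m})) x y ≤
      ENNReal.ofReal (T + κ * (1 / w - 1 / m.2)) := fun w hw => by
    have := (h.travelTime_change_speed hreg hG.dirs hT hm hw).1
    rwa [h0, h1] at this
  have hle' : ∀ w, 0 < w → travelTime (insert (m.1, w) (L \ {m})) x y ≤
      ENNReal.ofReal (T + κ' * (1 / w - 1 / m.2)) := fun w hw => by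
    have := (h'.travelTime_change_speed hreg hG.dirs hT hm hw).1
    rwa [h0', h1'] at this
  have hκ' := (h'.travelTime_change_speed hreg hG.dirs hT hm one_pos).2
  have hins : insert (m.1, m.2) (L \ {m}) = L := by
    rw [Prod.mk.eta, insert_sdiff_singleton, insert_eq_of_mem hm]
  have hfw : travelTime (insert (m.1, m.2) (L \ {m})) x y = ENNReal.ofReal T := by
    refine le_antisymm ?_ ?_
    · simpa using hle m.2 hw
    · rw [hins, ← h0, ← h1]
      simpa using h.opt 0 T le_rfl hT le_rfl
  refine hG.noCorner m hm q q' (by exact_mod_cast hκ.trans hq1.le) (by exact_mod_cast hq'1)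
    ⟨?_, fun r hr => ?_, fun r hr0 hr => ?_⟩
  · simp only [hfw]; exact ENNReal.ofReal_lt_top
  · simp only [hfw]
    have hr0 : (0 : ℝ) < r := hw.trans hr
    have hd : 0 ≤ 1 / m.2 - 1 / (r : ℝ) := by
      have := one_div_le_one_div_of_le hw hr.le
      linarith
    have h2 : κ' * (1 / m.2 - 1 / r) ≤ T := by
      have h3 : κ' * (1 / m.2 - 1 / r) ≤ κ' * (1 / m.2) := by
        refine mul_le_mul_of_nonneg_left ?_ (hκ.trans hlt.le)
        have : 0 < 1 / (r : ℝ) := by positivity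
        linarith
      rw [mul_one_div] at h3
      exact h3.trans hκ'
    refine (add_le_add (hle' r hr0) le_rfl).trans ?_
    rw [← ENNReal.ofReal_add (by linarith) (by
      have : (0 : ℝ) ≤ q' := by linarith
      positivity)]
    refine ENNReal.ofReal_le_ofReal ?_
    have : (q' : ℝ) * (1 / m.2 - 1 / r) ≤ κ' * (1 / m.2 - 1 / r) :=
      mul_le_mul_of_nonneg_right hq'.le hd
    linarith
  · simp only [hfw]
    have hd : 0 ≤ 1 / (r : ℝ) - 1 / m.2 := by
      have := one_div_le_one_div_of_le hr0 hr.le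
      linarith
    have hq0 : (0 : ℝ) ≤ q := by linarith
    refine (hle r hr0).trans ?_
    rw [← ENNReal.ofReal_add hT (by positivity)]
    refine ENNReal.ofReal_le_ofReal ?_
    have : κ * (1 / (r : ℝ) - 1 / m.2) ≤ q * (1 / r - 1 / m.2) :=
      mul_le_mul_of_nonneg_right (by linarith) hd
    linarith

/-- In a generic family of lines, minimal runs are unique. -/
theorem IsMinimal.eqOn {L : Set (PlaneLine × ℝ)} {T : ℝ} {ξ ξ' : ℝ → Plane} {k₀ : ℕ}
    {x y : Plane} (hreg : SpeedRegular L k₀) (hG : IsGeneric L x y) (hT : 0 ≤ T)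
    (h : IsMinimal L T ξ) (h' : IsMinimal L T ξ') (h0 : ξ 0 = x) (h0' : ξ' 0 = x) (h1 : ξ T = y)
    (h1' : ξ' T = y) : EqOn ξ ξ' (Icc 0 T) := by
  -- both runs pass through a common point at the same time
  have htime : ∀ s ∈ Icc 0 T, ∀ s' ∈ Icc 0 T, ξ s = ξ' s' → s = s' := by
    have aux : ∀ {ζ : ℝ → Plane}, IsMinimal L T ζ → ζ 0 = x → ∀ s ∈ Icc 0 T,
        travelTime L x (ζ s) = ENNReal.ofReal s := by
      intro ζ hζ hζ0 s hs
      rw [← hζ0]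
      refine le_antisymm ?_ ?_
      · simpa using (hζ.run.reach hs.1).reachTime_le
      · simpa using hζ.opt 0 s le_rfl hs.1 hs.2
    intro s hs s' hs' heq
    have h2 := aux h h0 s hs
    rw [heq, aux h' h0' s' hs', ENNReal.ofReal_eq_ofReal_iff hs'.1 hs.1] at h2
    exact h2.symm
  by_contra hne
  rw [EqOn] at hne
  push Not at hne
  obtain ⟨t, ht, htne⟩ := hne
  have ht0 : t ≠ 0 := by rintro rfl; exact htne (h0.trans h0'.symm)
  have htT : t ≠ T := by rintro rfl; exact htne (h1.trans h1'.symm)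
  have ht' : t ∈ Ioo 0 T := ⟨lt_of_le_of_ne ht.1 (Ne.symm ht0), lt_of_le_of_ne ht.2 htT⟩
  -- times at which the runs differ
  obtain ⟨e, he, he'⟩ : ∃ e > t, ∀ s ∈ Ioo t e, ξ s ≠ ξ' s := by
    have hopen : IsOpen {s | ξ s ≠ ξ' s} := isOpen_ne_fun h.run.cont h'.run.cont
    have hnear : ∀ᶠ s in 𝓝 t, ξ s ≠ ξ' s := hopen.mem_nhds htne
    exact mem_nhdsGT_iff_exists_Ioo_subset.1 (hnear.filter_mono nhdsWithin_le_nhds)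
  obtain ⟨m, hm, c, d, hc, hcd, hd, hfol⟩ := h.exists_follows hreg hG.dirs ht.1
    (lt_min he ht'.2) (min_le_right _ _)
  have hde : d < e := hd.trans_le (min_le_left _ _)
  have hdT : d < T := hd.trans_le (min_le_right _ _)
  have hc0 : 0 < c := ht'.1.trans hc
  obtain ⟨hK, hKP⟩ := h.isIntervalUnion_trace hreg hG.dirs hG.not_vertical hG.noSteep hm
    (h0 ▸ hG.notMem_left m hm) (h1 ▸ hG.notMem_right m hm)
  obtain ⟨hK', hKP'⟩ := h'.isIntervalUnion_trace hreg hG.dirs hG.not_vertical hG.noSteep hm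
    (h0' ▸ hG.notMem_left m hm) (h1' ▸ hG.notMem_right m hm)
  have hvol : (volume (trace m ξ 0 T)).toReal = (volume (trace m ξ' 0 T)).toReal :=
    le_antisymm (h'.volume_trace_le hreg hG hT h h0' h0 h1' h1 hm)
      (h.volume_trace_le hreg hG hT h' h0 h0' h1 h1' hm)
  have hiff := hK.fullRight_iff hK' hKP hKP' (hG.indep m hm) hvol
  set θ := m.1.rep.1 with hθ
  have hcont : Continuous fun t => along θ (ξ t) := (continuous_along_right _).comp h.run.cont
  have hcdne : along θ (ξ c) ≠ along θ (ξ d) := by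
    intro heq
    have h2 : dist (ξ c) (ξ d) = 0 := by
      rw [PlaneLine.dist_eq_of_mem (hfol c ⟨le_rfl, hcd.le⟩) (hfol d ⟨hcd.le, le_rfl⟩), ← hθ, heq,
        sub_self, abs_zero]
    have := h.injOn ⟨hc0.le, by linarith⟩ ⟨by linarith, hdT.le⟩ (dist_eq_zero.1 h2)
    linarith
  have himg : ∀ y ∈ uIcc (along θ (ξ c)) (along θ (ξ d)), ∃ s ∈ Icc c d, along θ (ξ s) = y := by
    intro y hy
    obtain ⟨s, hs, hsy⟩ := intermediate_value_uIcc hcont.continuousOn hy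
    rw [uIcc_of_le hcd.le] at hs
    exact ⟨s, hs, hsy⟩
  set α := min (along θ (ξ c)) (along θ (ξ d)) with hα
  set β := max (along θ (ξ c)) (along θ (ξ d)) with hβ
  have hαβ : α < β := min_lt_max.2 hcdne
  have hfull : FullRight (trace m ξ 0 T) α := by
    filter_upwards [Ioo_mem_nhdsGT hαβ] with y hy
    obtain ⟨s, hs, hsy⟩ := himg y ⟨hy.1.le, hy.2.le⟩
    exact ⟨s, ⟨⟨by linarith [hs.1], by linarith [hs.2]⟩, hfol s hs⟩, hsy⟩
  obtain ⟨y, ⟨s', ⟨hs', hs'm⟩, hs'y⟩, hy⟩ := (((hiff α).1 hfull).and (Ioo_mem_nhdsGT hαβ)).exists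
  obtain ⟨s, hs, hsy⟩ := himg y ⟨hy.1.le, hy.2.le⟩
  have heq : ξ s = ξ' s' := by
    refine dist_eq_zero.1 ?_
    rw [PlaneLine.dist_eq_of_mem (hfol s hs) hs'm, ← hθ, hsy, ← hs'y, sub_self, abs_zero]
  have hss := htime s ⟨by linarith [hs.1], by linarith [hs.2]⟩ s' hs' heq
  subst hss
  exact he' s ⟨hc.trans_le hs.1, hs.2.trans_lt hde⟩ heq

/-! ### Speed-limit paths and runs -/

/-- A Lipschitz path whose speed is almost nowhere above `v` on `[s, t]` moves by at most
`v * (t - s)`. -/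
theorem dist_le_of_ae_norm_deriv_le {ξ : ℝ → Plane} {s t v : ℝ} {K : NNReal} (hst : s ≤ t)
    (hξ : LipschitzOnWith K ξ (Icc s t)) (h : ∀ᵐ u, u ∈ Icc s t → ‖deriv ξ u‖ ≤ v) :
    dist (ξ s) (ξ t) ≤ v * (t - s) := by
  set e := ξ t - ξ s with he
  set g : ℝ → ℝ := fun u => inner ℝ e (ξ u) with hg
  have hgl : LipschitzOnWith (‖e‖₊ * K) g (Icc s t) := by
    have := (innerSL ℝ e).lipschitz.comp_lipschitzOnWith hξ
    rwa [show ‖innerSL ℝ e‖₊ = ‖e‖₊ from NNReal.eq (innerSL_apply_norm ℝ e)] at this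
  have hac : AbsolutelyContinuousOnInterval g s t :=
    LipschitzOnWith.absolutelyContinuousOnInterval (by rwa [uIcc_of_le hst])
  have hint := hac.integral_deriv_eq_sub
  have hsub : g t - g s = ‖e‖ ^ 2 := by
    rw [hg, ← real_inner_self_eq_norm_sq]
    simp only
    rw [← inner_sub_right]
  have hle : ∫ u in s..t, deriv g u ≤ ∫ _ in s..t, ‖e‖ * v := by
    refine intervalIntegral.integral_mono_ae_restrict hst hac.intervalIntegrable_deriv
      intervalIntegrable_const ?_
    have hne : ∀ᵐ u : ℝ, u ≠ s ∧ u ≠ t := by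
      have h1 : ∀ᵐ u : ℝ, u ≠ s := by simp [ae_iff]
      have h2 : ∀ᵐ u : ℝ, u ≠ t := by simp [ae_iff]
      exact h1.and h2
    refine (ae_restrict_iff' measurableSet_Icc).2 ?_
    filter_upwards [h, hne, hξ.ae_differentiableWithinAt_of_mem] with u hu hu' hd hmem
    have hnhds : Icc s t ∈ 𝓝 u :=
      Icc_mem_nhds (lt_of_le_of_ne hmem.1 (Ne.symm hu'.1)) (lt_of_le_of_ne hmem.2 hu'.2)
    have hd' := ((hd hmem).differentiableAt hnhds).hasDerivAt
    have hg' : HasDerivAt g (inner ℝ e (deriv ξ u)) u :=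
      ((innerSL ℝ e).hasFDerivAt.comp_hasDerivAt u hd')
    rw [hg'.deriv]
    exact (real_inner_le_norm _ _).trans (mul_le_mul_of_nonneg_left (hu hmem) (norm_nonneg _))
  rw [hint, hsub, intervalIntegral.integral_const, smul_eq_mul] at hle
  rw [dist_comm, dist_eq_norm, ← he]
  rcases (norm_nonneg e).eq_or_lt with h0 | h0
  · rw [← h0]
    rcases hst.eq_or_lt with rfl | hlt
    · simp
    · have : ∃ u, u ∈ Ioo s t ∧ ‖deriv ξ u‖ ≤ v := by
        by_contra hcon
        push Not at hcon
        have h1 : volume (Ioo s t) = 0 := by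
          refine measure_mono_null (fun u hu => ?_) (ae_iff.1 h)
          exact fun h2 => absurd (h2 (Ioo_subset_Icc_self hu)) (not_le.2 (hcon u hu))
        rw [Real.volume_Ioo, ENNReal.ofReal_eq_zero] at h1
        linarith
      obtain ⟨u, -, hu⟩ := this
      exact mul_nonneg ((norm_nonneg _).trans hu) (by linarith)
  · nlinarith

/-- A speed-limit path, stopped outside its time interval, is a run. -/
theorem Connects.isRun {L : Set (PlaneLine × ℝ)} {x y : Plane} {T : ℝ} {ξ : ℝ → Plane}
    (h : Connects L x y T ξ) : IsRun (silhouette L) (fun t => ξ (max 0 (min T t))) := by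
  obtain ⟨hT, ⟨hlip, hnull⟩, hcont, -, -⟩ := h
  have key : ∀ v, 0 < v → ∀ s t, 0 ≤ s → s ≤ t → t < T → (∀ u ∈ Icc s t, ξ u ∉ silhouette L v) →
      dist (ξ s) (ξ t) ≤ v * (t - s) := by
    intro v hv s t hs hst ht hno
    have hsub : Icc s t ⊆ Ico 0 T := fun u hu => ⟨hs.trans hu.1, hu.2.trans_lt ht⟩
    obtain ⟨K, hK⟩ := (hlip.mono hsub).exists_lipschitzOnWith_of_compact isCompact_Icc
    refine dist_le_of_ae_norm_deriv_le hst hK ?_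
    refine measure_mono_null (fun u hu => ?_) (hnull v hv)
    have hu : ¬ (u ∈ Icc s t → ‖deriv ξ u‖ ≤ v) := hu
    push Not at hu
    exact ⟨hsub hu.1, hu.2, hno u hu.1⟩
  refine IsRun.clamp hT hcont fun v hv s t hs hst ht hno => ?_
  rcases ht.eq_or_lt with rfl | ht
  · rcases hst.eq_or_lt with rfl | hst
    · simp
    have hne : (𝓝[Ico s t] t).NeBot := by
      rw [← mem_closure_iff_nhdsWithin_neBot, closure_Ico hst.ne]
      exact ⟨hst.le, le_rfl⟩
    have h1 : Tendsto ξ (𝓝[Ico s t] t) (𝓝 (ξ t)) :=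
      (hcont t ⟨hT, le_rfl⟩).mono_left (nhdsWithin_mono _ fun u hu => ⟨hs.trans hu.1, hu.2.le⟩)
    have h2 : Tendsto (fun r => v * (r - s)) (𝓝[Ico s t] t) (𝓝 (v * (t - s))) :=
      (Continuous.tendsto (by fun_prop) t).mono_left nhdsWithin_le_nhds
    refine le_of_tendsto_of_tendsto (tendsto_const_nhds.dist h1) h2 ?_
    filter_upwards [self_mem_nhdsWithin] with r hr
    exact key v hv s r hs hr.1 hr.2 fun u hu => hno u ⟨hu.1, hu.2.trans hr.2.le⟩
  · exact key v hv s t hs hst ht hno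

theorem Connects.reach {L : Set (PlaneLine × ℝ)} {x y : Plane} {T : ℝ} {ξ : ℝ → Plane}
    (h : Connects L x y T ξ) : Reach (silhouette L) x y T := by
  refine ⟨h.1, _, h.isRun, ?_, ?_⟩
  · simp [h.1, h.2.2.2.1]
  · simp [h.1, h.2.2.2.2]

/-- Conversely, two points joined by a run are joined by a speed-limit path. -/
theorem SpeedRegular.exists_connects {L : Set (PlaneLine × ℝ)} {k₀ : ℕ} (hL : SpeedRegular L k₀)
    {x y : Plane} {T : ℝ} (h : Reach (silhouette L) x y T) : ∃ ξ, Connects L x y T ξ := by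
  obtain ⟨ξ, hξ, h0, h1⟩ := h.exists_clamped
  obtain ⟨k, hk⟩ : ∃ k : ℕ, ‖x‖ ≤ 2 ^ k := by
    obtain ⟨k, hk⟩ := pow_unbounded_of_one_lt ‖x‖ (one_lt_two)
    exact ⟨k, hk.le⟩
  obtain ⟨j, hj⟩ := exists_nat_ge (2 * T)
  have hk' : ‖ξ 0‖ ≤ 2 ^ max k k₀ := by
    rw [h0 0 le_rfl]
    exact hk.trans (pow_le_pow_right₀ one_le_two (le_max_left _ _))
  have hdist := (hL.tame.dist_le (le_max_right k k₀) hξ h.1 (j := j) (by linarith)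
    (fun s hs => by rw [h0 s hs, h0 0 le_rfl]) (fun s hs => by rw [h1 s hs, h1 _ le_rfl]) hk').2
  have hlip : LipschitzWith (2 ^ (max k k₀ + j)) ξ := by
    refine LipschitzWith.of_dist_le_mul fun s t => ?_
    push_cast
    rcases le_total s t with hst | hst
    · rw [Real.dist_eq, abs_sub_comm, abs_of_nonneg (by linarith)]
      exact hdist s t hst
    · rw [dist_comm, Real.dist_eq, abs_of_nonneg (by linarith)]
      exact hdist t s hst
  refine ⟨ξ, h.1, ⟨hlip.locallyLipschitz.locallyLipschitzOn, fun v hv => ?_⟩,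
    hξ.cont.continuousOn, h0 0 le_rfl, h1 T le_rfl⟩
  -- away from a silhouette the path is locally Lipschitz with the constant that bounds its speed
  convert measure_empty (μ := volume)
  refine eq_empty_iff_forall_notMem.2 fun t ⟨_, hv', hno⟩ => absurd hv' (not_lt.2 ?_)
  obtain ⟨ε, hε, hball⟩ := hL.isClosed_silhouette hv _ hno
  have hnear : ∀ᶠ u in 𝓝 t, dist (ξ u) (ξ t) < ε :=
    (Metric.tendsto_nhds.1 hξ.cont.continuousAt) ε hε
  obtain ⟨δ, hδ, hδ'⟩ := Metric.eventually_nhds_iff.1 hnear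
  refine norm_deriv_le_of_lip' hv.le ?_
  filter_upwards [Metric.ball_mem_nhds t hδ] with u hu
  rw [← dist_eq_norm, ← dist_eq_norm, Real.dist_eq]
  have hu' : |u - t| < δ := by simpa [Real.dist_eq] using hu
  rcases le_total u t with hut | hut
  · rw [abs_sub_comm, abs_of_nonneg (by linarith)]
    refine hξ.speed v hv u t hut fun r hr => hball _ (hδ' ?_)
    rw [Real.dist_eq, abs_sub_comm, abs_of_nonneg (by linarith [hr.2])]
    linarith [(abs_lt.1 hu').1, hr.1]
  · rw [dist_comm, abs_of_nonneg (by linarith)]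
    refine hξ.speed v hv t u hut fun r hr => hball _ (hδ' ?_)
    rw [Real.dist_eq, abs_of_nonneg (by linarith [hr.1])]
    linarith [(abs_lt.1 hu').2, hr.2]

/-- A geodesic is, when stopped outside its time interval, a minimal run. -/
theorem IsLineGeodesic.isMinimal {L : Set (PlaneLine × ℝ)} {k₀ : ℕ} (hL : SpeedRegular L k₀)
    {x y : Plane} {T : ℝ} {ξ : ℝ → Plane} (h : IsLineGeodesic L x y T ξ) :
    IsMinimal L T (fun t => ξ (max 0 (min T t))) := by
  have hrun := h.1.isRun
  have hT := h.1.1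
  refine ⟨hrun, fun s t hs hst ht => ?_⟩
  by_contra hlt
  push Not at hlt
  -- a faster connection between two points of the geodesic would give a faster path
  obtain ⟨r, hr, hr'⟩ := ENNReal.lt_iff_exists_real_btwn.1 hlt
  obtain ⟨hr'', hr'''⟩ := hr'
  have h1 := reach_of_reachTime_lt hr''
  have h0' := hrun.reach hs
  have h2' := hrun.reach ht
  have h3 := (h0'.trans h1).trans h2'
  rw [ENNReal.ofReal_lt_ofReal_iff'] at hr'''
  simp only [min_eq_right hT, max_eq_left le_rfl, min_self, max_eq_right hT] at h3
  rw [h.1.2.2.2.1, h.1.2.2.2.2] at h3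
  obtain ⟨η, hη⟩ := hL.exists_connects h3
  exact h.2 _ (by linarith [hr'''.1]) η hη

/-- In a generic family of lines there is exactly one geodesic between two points that can be
connected. -/
theorem exists_unique_geodesic {L : Set (PlaneLine × ℝ)} {k₀ : ℕ} (hL : SpeedRegular L k₀)
    {x y : Plane} (hG : IsGeneric L x y) (hfin : travelTime L x y ≠ ⊤) :
    ∃ (T : ℝ) (ξ : ℝ → Plane), IsLineGeodesic L x y T ξ ∧
      ∀ (T' : ℝ) (ξ' : ℝ → Plane), IsLineGeodesic L x y T' ξ' →
        T' = T ∧ Set.EqOn ξ' ξ (Set.Icc 0 T) := by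
  set T := (travelTime L x y).toReal with hT
  have hle : reachTime (silhouette L) x y ≤ ENNReal.ofReal T := by
    rw [hT, ENNReal.ofReal_toReal hfin]
  obtain ⟨ξ, hξ⟩ := hL.exists_connects (hL.reach_of_reachTime_le ENNReal.toReal_nonneg hle)
  have hgeo : IsLineGeodesic L x y T ξ := by
    refine ⟨hξ, fun S hS η hη => ?_⟩
    have := hη.reach.reachTime_le
    have h2 := ENNReal.toReal_mono ENNReal.ofReal_ne_top this
    rw [ENNReal.toReal_ofReal hη.1] at h2
    exact absurd hS (not_lt.2 h2)
  refine ⟨T, ξ, hgeo, fun T' ξ' h' => ?_⟩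
  have hTT : T' = T := by
    rcases lt_trichotomy T' T with hlt | heq | hlt
    · exact (hgeo.2 T' hlt ξ' h'.1).elim
    · exact heq
    · exact (h'.2 T hlt ξ hξ).elim
  subst hTT
  have hT0 := hξ.1
  refine ⟨rfl, fun t ht => ?_⟩
  have key : ∀ {ζ : ℝ → Plane}, Connects L x y T ζ →
      ζ (max 0 (min T 0)) = x ∧ ζ (max 0 (min T T)) = y := fun h => by
    rw [min_self, min_eq_right hT0, max_self, max_eq_right hT0]
    exact h.2.2.2
  have := (h'.isMinimal hL).eqOn hL hG hT0 (hgeo.isMinimal hL) (key h'.1).1 (key hξ).1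
    (key h'.1).2 (key hξ).2 ht
  simpa only [min_eq_right ht.2, max_eq_right ht.1] using this

/-! ### Configurations of points and Poisson processes -/

/-- A set of points of `S`, regarded as an element of the configuration space of `S`. -/
structure Configuration (S : Type*) where
  /-- The points of the configuration. -/
  points : Set S

namespace Configuration

open Classical in
/-- The point of a configuration in the set `B`, if there is exactly one, and `s₀` otherwise. -/
noncomputable def pointIn {S : Type*} (s₀ : S) (B : Set S) (C : Configuration S) : S :=
  if h : ∃ m, C.points ∩ B = {m} then h.choose else s₀

theorem pointIn_eq {S : Type*} {s₀ : S} {B : Set S} {C : Configuration S} {m : S}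
    (h : C.points ∩ B = {m}) : pointIn s₀ B C = m := by
  have h' : ∃ m, C.points ∩ B = {m} := ⟨m, h⟩
  rw [pointIn, dif_pos h']
  exact singleton_injective (h'.choose_spec.symm.trans h)

variable {S : Type*} [MeasurableSpace S]

/-- The events that finitely many of the numbers of points in measurable sets have prescribed
values. -/
def cylinders (S : Type*) [MeasurableSpace S] : Set (Set (Configuration S)) :=
  {s | ∃ (ι : Type) (_ : Fintype ι) (A : ι → Set S) (E : ι → Set ℕ∞),
    (∀ i, MeasurableSet (A i)) ∧ s = {C | ∀ i, (C.points ∩ A i).encard ∈ E i}}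

/-- The σ-algebra of configuration space is generated by the numbers of points in measurable
sets. -/
instance : MeasurableSpace (Configuration S) := MeasurableSpace.generateFrom (cylinders S)

theorem isPiSystem_cylinders : IsPiSystem (cylinders S) := by
  rintro _ ⟨ι, _, A, E, hA, rfl⟩ _ ⟨ι', _, A', E', hA', rfl⟩ -
  refine ⟨ι ⊕ ι', inferInstance, Sum.elim A A', Sum.elim E E', ?_, ?_⟩
  · rintro (i | i)
    · exact hA i
    · exact hA' i
  · ext C
    simp

theorem measurable_count {A : Set S} (hA : MeasurableSet A) :
    Measurable fun C : Configuration S => (C.points ∩ A).encard := by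
  intro E _
  refine MeasurableSpace.measurableSet_generateFrom
    ⟨Unit, inferInstance, fun _ => A, fun _ => E, fun _ => hA, ?_⟩
  ext C
  simp

theorem measurable_of_count {Ω : Type*} [MeasurableSpace Ω] {f : Ω → Configuration S}
    (hf : ∀ A, MeasurableSet A → Measurable fun ω => ((f ω).points ∩ A).encard) :
    Measurable f := by
  refine measurable_generateFrom ?_
  rintro _ ⟨ι, _, A, E, hA, rfl⟩
  have : f ⁻¹' {C | ∀ i, (C.points ∩ A i).encard ∈ E i} =
      ⋂ i, (fun ω => ((f ω).points ∩ A i).encard) ⁻¹' E i := by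
    ext ω; simp
  rw [this]
  exact MeasurableSet.iInter fun i => hf _ (hA i) (MeasurableSet.of_discrete)

theorem measurableSet_inter_nonempty {A : Set S} (hA : MeasurableSet A) :
    MeasurableSet {C : Configuration S | (C.points ∩ A).Nonempty} := by
  have : {C : Configuration S | (C.points ∩ A).Nonempty} =
      (fun C => (C.points ∩ A).encard) ⁻¹' {0}ᶜ := by
    ext C; simp [nonempty_iff_ne_empty]
  rw [this]
  exact measurable_count hA MeasurableSet.of_discrete

/-- The infimum of a measurable function over the points of a configuration is measurable. -/
theorem measurable_iInf {f : S → ℝ≥0∞} (hf : Measurable f) :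
    Measurable fun C : Configuration S => ⨅ m ∈ C.points, f m := by
  refine measurable_of_Iio fun c => ?_
  have : (fun C : Configuration S => ⨅ m ∈ C.points, f m) ⁻¹' Iio c =
      {C | (C.points ∩ f ⁻¹' Iio c).Nonempty} := by
    ext C
    simp only [mem_preimage, mem_Iio, iInf_lt_iff, mem_ofPred_eq, Set.Nonempty, mem_inter_iff,
      exists_prop]
  rw [this]
  exact measurableSet_inter_nonempty (hf measurableSet_Iio)

theorem measurable_pointIn (s₀ : S) {B : Set S} (hB : MeasurableSet B) :
    Measurable (pointIn s₀ B) := by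
  intro A hA
  have hone : MeasurableSet {C : Configuration S | (C.points ∩ B).encard = 1} :=
    measurable_count hB (measurableSet_singleton 1)
  have : pointIn s₀ B ⁻¹' A =
      ({C | (C.points ∩ B).encard = 1} ∩ {C | (C.points ∩ (B ∩ A)).Nonempty}) ∪
        ({C | (C.points ∩ B).encard = 1}ᶜ ∩ {_C | s₀ ∈ A}) := by
    ext C
    by_cases h : ∃ m, C.points ∩ B = {m}
    · obtain ⟨m, hm⟩ := h
      simp [pointIn_eq hm, hm, ← inter_assoc]
    · have h1 : ¬ (C.points ∩ B).encard = 1 := by rwa [encard_eq_one]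
      simp [pointIn, h, h1]
  rw [this]
  exact (hone.inter (measurableSet_inter_nonempty (hB.inter hA))).union
    (hone.compl.inter (MeasurableSet.const _))

end Configuration

namespace IsPoissonProcess

section

variable {Ω S : Type*}

/-- The event that there is exactly one point in `B`, and that it belongs to `A`. -/
def singleIn (N : Ω → Set S) (B A : Set S) : Set Ω := {ω | ∃ m ∈ A, N ω ∩ B = {m}}

theorem singleIn_eq (N : Ω → Set S) (B A : Set S) :
    singleIn N B A = {ω | (N ω ∩ (B ∩ A)).encard = 1 ∧ (N ω ∩ (B \ A)).encard = 0} := by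
  ext ω
  have hsplit : N ω ∩ B = (N ω ∩ (B ∩ A)) ∪ (N ω ∩ (B \ A)) := by
    rw [← inter_union_distrib_left, inter_union_sdiff]
  simp only [singleIn, mem_ofPred_eq, encard_eq_zero, encard_eq_one]
  constructor
  · rintro ⟨m, hm, heq⟩
    have hmem : m ∈ N ω ∩ B := by rw [heq]; rfl
    refine ⟨⟨m, ?_⟩, ?_⟩
    · rw [← inter_assoc, heq]
      exact inter_eq_left.2 (singleton_subset_iff.2 hm)
    · rw [← inter_sdiff_assoc, heq]
      exact sdiff_eq_empty.2 (singleton_subset_iff.2 hm)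
  · rintro ⟨⟨m, hm⟩, h0⟩
    have hmem : m ∈ N ω ∩ (B ∩ A) := by rw [hm]; rfl
    exact ⟨m, hmem.2.2, by rw [hsplit, hm, h0, union_empty]⟩

/-- The set of points of the sets `A i` outside `B`, split up by the `A i` to which they belong. -/
theorem encard_inter_sdiff {ι : Type} [Finite ι] (M B : Set S) (A : ι → Set S) (i : ι) :
    (M ∩ (A i \ B)).encard =
      ∑ᶠ I : {I : Set ι // i ∈ I}, (M ∩ {z | z ∉ B ∧ ∀ j, z ∈ A j ↔ j ∈ I.1}).encard := by
  classical
  have h1 : M ∩ (A i \ B) =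
      ⋃ I : {I : Set ι // i ∈ I}, M ∩ {z | z ∉ B ∧ ∀ j, z ∈ A j ↔ j ∈ I.1} := by
    ext z
    simp only [mem_inter_iff, Set.mem_sdiff, mem_iUnion, mem_ofPred_eq]
    constructor
    · rintro ⟨hM, hA, hB⟩
      exact ⟨⟨{j | z ∈ A j}, hA⟩, hM, hB, fun j => Iff.rfl⟩
    · rintro ⟨I, hM, hB, hI⟩
      exact ⟨hM, (hI i).2 I.2, hB⟩
  rw [h1, encard_iUnion_of_finite]
  intro I J hIJ
  refine disjoint_left.2 fun z hz hz' => hIJ (Subtype.ext ?_)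
  ext j
  rw [← hz.2.2 j, ← hz'.2.2 j]

end

variable {Ω S : Type*} [MeasurableSpace Ω] [MeasurableSpace S] {P : Measure Ω}
  {Λ : Measure S} {N : Ω → Set S}

theorem measure_count (h : IsPoissonProcess P Λ N) {B : Set S} (hB : MeasurableSet B)
    (hΛ : Λ B ≠ ⊤) (E : Set ℕ∞) :
    P {ω | (N ω ∩ B).encard ∈ E} =
      poissonMeasure (Λ B).toNNReal {k : ℕ | (k : ℕ∞) ∈ E} := by
  have h1 := congrArg (fun μ => μ E) (h.law_count B hB hΛ)
  rwa [Measure.map_apply (h.measurable_count B hB) MeasurableSet.of_discrete,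
    Measure.map_apply (by fun_prop) MeasurableSet.of_discrete] at h1

theorem measure_inter_eq_empty (h : IsPoissonProcess P Λ N) {B : Set S} (hB : MeasurableSet B)
    (hΛ : Λ B ≠ ⊤) : P {ω | N ω ∩ B = ∅} = ENNReal.ofReal (Real.exp (-(Λ B).toReal)) := by
  have h1 := h.measure_count hB hΛ {0}
  have h2 : {k : ℕ | (k : ℕ∞) ∈ ({0} : Set ℕ∞)} = {0} := by ext k; simp
  rw [h2, poissonMeasure_singleton] at h1
  simpa [ENNReal.toReal] using h1

theorem ae_finite (h : IsPoissonProcess P Λ N) {B : Set S} (hB : MeasurableSet B)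
    (hΛ : Λ B ≠ ⊤) : ∀ᵐ ω ∂P, (N ω ∩ B).Finite := by
  have h1 := h.measure_count hB hΛ {⊤}
  have h2 : {k : ℕ | (k : ℕ∞) ∈ ({⊤} : Set ℕ∞)} = ∅ := by ext k; simp
  rw [h2, measure_empty] at h1
  rw [ae_iff]
  simpa [encard_eq_top_iff] using h1

theorem measure_inter_nonempty_le [IsProbabilityMeasure P] (h : IsPoissonProcess P Λ N) {B : Set S}
    (hB : MeasurableSet B) : P {ω | (N ω ∩ B).Nonempty} ≤ Λ B := by
  by_cases hΛ : Λ B = ⊤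
  · rw [hΛ]; exact le_top
  have hm : MeasurableSet {ω | N ω ∩ B = ∅} := by
    have := h.measurable_count B hB (measurableSet_singleton 0)
    simpa [preimage] using this
  have h1 : {ω | (N ω ∩ B).Nonempty} = {ω | N ω ∩ B = ∅}ᶜ := by
    ext ω; simp [nonempty_iff_ne_empty]
  rw [h1, prob_compl_eq_one_sub hm, h.measure_inter_eq_empty hB hΛ, ← ENNReal.ofReal_one,
    ← ENNReal.ofReal_sub _ (Real.exp_pos _).le]
  refine ENNReal.ofReal_le_of_le_toReal ?_
  linarith [Real.add_one_le_exp (-(Λ B).toReal)]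

theorem ae_inter_eq_empty [IsProbabilityMeasure P] (h : IsPoissonProcess P Λ N) {B : Set S}
    (hB : MeasurableSet B) (hΛ : Λ B = 0) : ∀ᵐ ω ∂P, N ω ∩ B = ∅ := by
  rw [ae_iff]
  have := h.measure_inter_nonempty_le hB
  simpa [hΛ, nonempty_iff_ne_empty] using this

/-- The configuration of the points outside `B`. -/
def outside (N : Ω → Set S) (B : Set S) (ω : Ω) : Configuration S := ⟨N ω \ B⟩

theorem measurable_outside (h : IsPoissonProcess P Λ N) {B : Set S} (hB : MeasurableSet B) :
    Measurable (outside N B) := by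
  refine Configuration.measurable_of_count fun A hA => ?_
  have : (fun ω => ((outside N B ω).points ∩ A).encard) = fun ω => (N ω ∩ (A \ B)).encard := by
    ext ω
    simp only [outside]
    rw [sdiff_inter_right_comm, inter_sdiff_assoc]
  rw [this]
  exact h.measurable_count _ (hA.diff hB)

theorem measurableSet_singleIn (h : IsPoissonProcess P Λ N) {A B : Set S} (hB : MeasurableSet B)
    (hA : MeasurableSet A) : MeasurableSet (singleIn N B A) := by
  rw [singleIn_eq]
  exact (h.measurable_count _ (hB.inter hA) (measurableSet_singleton 1)).inter
    (h.measurable_count _ (hB.diff hA) (measurableSet_singleton 0))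

/-- Counts in disjoint sets are independent, for an arbitrary finite index set. -/
theorem iIndepFun_count (h : IsPoissonProcess P Λ N) {κ : Type} [Fintype κ] (D : κ → Set S)
    (hD : ∀ i, MeasurableSet (D i)) (hdis : Pairwise fun i j => Disjoint (D i) (D j)) :
    iIndepFun (fun (i : κ) ω => (N ω ∩ D i).encard) P := by
  classical
  let e := Fintype.equivFin κ
  have h1 := h.indep_count (Fintype.card κ) (fun i => D (e.symm i)) (fun i => hD _)
    (fun i j hij => hdis (e.symm.injective.ne hij))
  have h2 := h1.precomp e.injective
  simpa using h2

/-- The points in `B` are independent of the configuration outside `B`. -/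
theorem measure_singleIn_inter [IsProbabilityMeasure P] (h : IsPoissonProcess P Λ N) {A B : Set S}
    (hB : MeasurableSet B) (hA : MeasurableSet A) {s : Set (Configuration S)}
    (hs : MeasurableSet s) :
    P (singleIn N B A ∩ outside N B ⁻¹' s) = P (singleIn N B A) * P (outside N B ⁻¹' s) := by
  classical
  have hY := h.measurable_outside hB
  have hE := h.measurableSet_singleIn hB hA
  set μ₁ := (P.restrict (singleIn N B A)).map (outside N B) with hμ₁
  set μ₂ := P (singleIn N B A) • P.map (outside N B) with hμ₂
  have hfin : IsFiniteMeasure μ₁ := by rw [hμ₁]; infer_instance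
  have key : μ₁ = μ₂ := by
    have happ : ∀ s, MeasurableSet s → (μ₁ s = μ₂ s ↔ P (singleIn N B A ∩ outside N B ⁻¹' s) =
        P (singleIn N B A) * P (outside N B ⁻¹' s)) := by
      intro s hs
      rw [hμ₁, hμ₂, Measure.map_apply hY hs, Measure.restrict_apply (hY hs), Measure.smul_apply,
        Measure.map_apply hY hs, inter_comm, smul_eq_mul]
    refine ext_of_generate_finite (Configuration.cylinders S) rfl
      Configuration.isPiSystem_cylinders ?_ ((happ _ MeasurableSet.univ).2 (by simp))
    intro s hs
    refine (happ s (MeasurableSpace.measurableSet_generateFrom hs)).2 ?_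
    obtain ⟨ι, _, A', E, hA', rfl⟩ := hs
    -- the atoms of the sets `A' i` outside `B`, together with `B ∩ A` and `B \ A`
    let D : Bool ⊕ Set ι → Set S := Sum.elim (fun b => bif b then B ∩ A else B \ A)
      (fun I => {z | z ∉ B ∧ ∀ j, z ∈ A' j ↔ j ∈ I})
    have hD : ∀ i, MeasurableSet (D i) := by
      rintro (b | I)
      · cases b
        · exact hB.diff hA
        · exact hB.inter hA
      · have : D (Sum.inr I) = Bᶜ ∩ ⋂ j, {z | z ∈ A' j ↔ j ∈ I} := by
          ext z; simp [D]
        rw [this]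
        refine hB.compl.inter (MeasurableSet.iInter fun j => ?_)
        by_cases hj : j ∈ I
        · simpa [hj] using hA' j
        · simp only [hj, iff_false]
          exact (hA' j).compl
    have hdis : Pairwise fun i j => Disjoint (D i) (D j) := by
      have hBI : ∀ b I, Disjoint (D (Sum.inl b)) (D (Sum.inr I)) := by
        intro b I
        refine disjoint_left.2 fun z hz hz' => hz'.1 ?_
        cases b
        · exact hz.1
        · exact hz.1
      have hAA : Disjoint (B \ A) (B ∩ A) := disjoint_left.2 fun z hz hz' => hz.2 hz'.2
      rintro (b | I) (b' | J) hij
      · cases b <;> cases b'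
        · exact absurd rfl hij
        · exact hAA
        · exact hAA.symm
        · exact absurd rfl hij
      · exact hBI b J
      · exact (hBI b' I).symm
      · refine disjoint_left.2 fun z hz hz' => hij (congrArg Sum.inr ?_)
        ext j
        rw [← hz.2 j, ← hz'.2 j]
    have hind := h.iIndepFun_count D hD hdis
    set S₁ : Finset (Bool ⊕ Set ι) := Finset.univ.map ⟨Sum.inl, Sum.inl_injective⟩ with hS₁
    set S₂ : Finset (Bool ⊕ Set ι) := Finset.univ.map ⟨Sum.inr, Sum.inr_injective⟩ with hS₂
    have hS : Disjoint S₁ S₂ := by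
      rw [Finset.disjoint_left]
      intro x hx hx'
      simp only [hS₁, hS₂, Finset.mem_map, Finset.mem_univ, true_and,
        Function.Embedding.coeFn_mk] at hx hx'
      obtain ⟨b, rfl⟩ := hx
      obtain ⟨I, hI⟩ := hx'
      cases hI
    have hind' := hind.indepFun_finset S₁ S₂ hS fun i => h.measurable_count _ (hD i)
    have hm₁ : ∀ b, Sum.inl b ∈ S₁ := fun b => by simp [hS₁]
    have hm₂ : ∀ I, Sum.inr I ∈ S₂ := fun I => by simp [hS₂]
    let F₁ : Set (S₁ → ℕ∞) :=
      {f | f ⟨_, hm₁ true⟩ = 1 ∧ f ⟨_, hm₁ false⟩ = 0}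
    let F₂ : Set (S₂ → ℕ∞) :=
      {f | ∀ i, ∑ᶠ I : {I : Set ι // i ∈ I}, f ⟨_, hm₂ I.1⟩ ∈ E i}
    have hdisc : ∀ (κ : Finset (Bool ⊕ Set ι)) (F : Set (κ → ℕ∞)), MeasurableSet F :=
      fun κ F => F.to_countable.measurableSet
    have := hind'.measure_inter_preimage_eq_mul F₁ F₂ (hdisc _ _) (hdisc _ _)
    have e₁ : (fun ω (i : S₁) => (N ω ∩ D i).encard) ⁻¹' F₁ = singleIn N B A := by
      rw [singleIn_eq]; rfl
    have e₂ : (fun ω (i : S₂) => (N ω ∩ D i).encard) ⁻¹' F₂ =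
        outside N B ⁻¹' {C | ∀ i, (C.points ∩ A' i).encard ∈ E i} := by
      ext ω
      simp only [mem_preimage, mem_ofPred_eq, F₂, outside]
      refine forall_congr' fun i => ?_
      rw [sdiff_inter_right_comm, inter_sdiff_assoc, encard_inter_sdiff]
      rfl
    rwa [e₁, e₂] at this
  have h1 := congrArg (fun μ => μ s) key
  rwa [hμ₁, hμ₂, Measure.map_apply hY hs, Measure.restrict_apply (hY hs), Measure.smul_apply,
    Measure.map_apply hY hs, inter_comm, smul_eq_mul] at h1

/-- If, almost surely, the points `m` with a property that depends on `m` and on the configuration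
outside `B` form a null set, then the only point of the process in `B` does not have this
property. -/
theorem ae_notMem_of_null [IsProbabilityMeasure P] (h : IsPoissonProcess P Λ N) {B : Set S}
    (hB : MeasurableSet B) {F : Set (Configuration S × S)} (hF : MeasurableSet F)
    (hnull : ∀ᵐ ω ∂P, Λ {m | (outside N B ω, m) ∈ F} = 0) :
    ∀ᵐ ω ∂P, ∀ m, N ω ∩ B = {m} → (outside N B ω, m) ∉ F := by
  rcases isEmpty_or_nonempty S with hS | ⟨⟨s₀⟩⟩
  · exact Eventually.of_forall fun ω m => (hS.false m).elim
  have hY := h.measurable_outside hB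
  have hG := h.measurableSet_singleIn hB MeasurableSet.univ
  set G := singleIn N B univ with hGdef
  set X : Ω → S := fun ω => Configuration.pointIn s₀ B ⟨N ω⟩ with hX
  have hXeq : ∀ ω m, N ω ∩ B = {m} → X ω = m := fun ω m hm => Configuration.pointIn_eq hm
  have hXm : Measurable X := (Configuration.measurable_pointIn s₀ hB).comp
    (Configuration.measurable_of_count fun A hA => h.measurable_count A hA)
  have hGX : ∀ A, G ∩ X ⁻¹' A = singleIn N B A := by
    intro A
    ext ω
    constructor
    · rintro ⟨⟨m, -, hm⟩, hA⟩
      refine ⟨m, ?_, hm⟩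
      rwa [mem_preimage, hXeq ω m hm] at hA
    · rintro ⟨m, hmA, hm⟩
      exact ⟨⟨m, mem_univ m, hm⟩, by rwa [mem_preimage, hXeq ω m hm]⟩
  set ρ := (P.restrict G).map X with hρ
  have hρA : ∀ A, MeasurableSet A → ρ A = P (singleIn N B A) := by
    intro A hA
    rw [hρ, Measure.map_apply hXm hA, Measure.restrict_apply (hXm hA), inter_comm, hGX]
  have hac : ∀ A, MeasurableSet A → Λ A = 0 → ρ A = 0 := by
    intro A hA h0
    rw [hρA A hA]
    refine measure_mono_null (fun ω hω => ?_) (ae_iff.1 (h.ae_inter_eq_empty hA h0))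
    obtain ⟨m, hmA, hm⟩ := hω
    intro hempty
    have h1 : m ∈ N ω ∩ B := by rw [hm]; rfl
    exact (hempty ▸ (⟨h1.1, hmA⟩ : m ∈ N ω ∩ A) : m ∈ (∅ : Set S))
  have hρfin : IsFiniteMeasure ρ := by rw [hρ]; infer_instance
  have hPfin : IsProbabilityMeasure (P.map (outside N B)) :=
    Measure.isProbabilityMeasure_map hY.aemeasurable
  have hprod : (P.map (outside N B)).prod ρ =
      (P.restrict G).map fun ω => (outside N B ω, X ω) := by
    refine Measure.prod_eq fun s A hs hA => ?_
    rw [Measure.map_apply (hY.prodMk hXm) (hs.prod hA),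
      Measure.restrict_apply ((hY.prodMk hXm) (hs.prod hA)), Measure.map_apply hY hs, hρA A hA]
    have : (fun ω => (outside N B ω, X ω)) ⁻¹' s ×ˢ A ∩ G =
        singleIn N B A ∩ outside N B ⁻¹' s := by
      rw [← hGX]
      ext ω
      simp only [mem_inter_iff, mem_preimage, mem_prod]
      tauto
    rw [this, h.measure_singleIn_inter hB hA hs, mul_comm]
  have hzero : ((P.map (outside N B)).prod ρ) F = 0 := by
    rw [Measure.measure_prod_null hF]
    refine (ae_map_iff hY.aemeasurable ?_).2 ?_
    · exact measurable_measure_prodMk_left hF (measurableSet_singleton 0)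
    · filter_upwards [hnull] with ω hω
      exact hac _ (measurable_prodMk_left hF) hω
  rw [hprod, Measure.map_apply (hY.prodMk hXm) hF,
    Measure.restrict_apply ((hY.prodMk hXm) hF)] at hzero
  rw [ae_iff]
  refine measure_mono_null (fun ω hω => ?_) hzero
  simp only [mem_ofPred_eq, not_forall, not_not] at hω
  obtain ⟨m, hm, hmF⟩ := hω
  exact ⟨by rwa [mem_preimage, hXeq ω m hm], m, mem_univ m, hm⟩

end IsPoissonProcess

/-! ### The intensity measure -/

section intensity

variable {γ : ℝ}

instance : SFinite lineMeasure := by unfold lineMeasure; infer_instance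

instance : SFinite (speedMeasure γ) := by unfold speedMeasure; infer_instance

theorem lineMeasure_apply {A : Set PlaneLine} (hA : MeasurableSet A) :
    lineMeasure A = 2⁻¹ * volume {p : ℝ × ℝ | p.1 ∈ Ico 0 Real.pi ∧ PlaneLine.ofParam p ∈ A} := by
  rw [lineMeasure, Measure.smul_apply, smul_eq_mul,
    Measure.map_apply PlaneLine.measurable_ofParam hA,
    Measure.restrict_apply (PlaneLine.measurable_ofParam hA)]
  congr 2
  ext p
  simp only [mem_inter_iff, mem_preimage, mem_prod, mem_univ, and_true, mem_ofPred_eq]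
  tauto

/-- Null sets of marked lines can be recognized in the coordinates, separately for each speed. -/
theorem markedLineIntensity_eq_zero {A : Set (PlaneLine × ℝ)} (hA : MeasurableSet A)
    (h : ∀ w, 0 < w →
      volume {p : ℝ × ℝ | p.1 ∈ Ico 0 Real.pi ∧ (PlaneLine.ofParam p, w) ∈ A} = 0) :
    markedLineIntensity γ A = 0 := by
  rw [markedLineIntensity, Measure.prod_apply_symm hA]
  refine (lintegral_congr_ae ?_).trans lintegral_zero
  have hpos : ∀ᵐ w ∂(speedMeasure γ), 0 < w := by
    refine (withDensity_absolutelyContinuous _ _).ae_le ?_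
    exact ae_restrict_mem measurableSet_Ioi
  filter_upwards [hpos] with w hw
  rw [lineMeasure_apply (measurable_prodMk_right hA)]
  have := h w hw
  simp only [mem_preimage]
  rw [this, mul_zero]

theorem speedMeasure_Ici (hγ : 2 < γ) {v : ℝ} (hv : 0 < v) :
    speedMeasure γ (Ici v) = ENNReal.ofReal (v ^ (1 - γ)) := by
  have hint : IntegrableOn (fun w : ℝ => (γ - 1) * w ^ (-γ)) (Ioi v) :=
    (integrableOn_Ioi_rpow_of_lt (by linarith) hv).const_mul _
  have hsub : Ici v ∩ Ioi 0 = Ici v := inter_eq_left.2 fun w (hw : v ≤ w) => hv.trans_le hw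
  rw [speedMeasure, withDensity_apply _ measurableSet_Ici,
    Measure.restrict_restrict measurableSet_Ici, hsub, ← Measure.restrict_congr_set Ioi_ae_eq_Ici,
    ← ofReal_integral_eq_lintegral_ofReal hint, integral_const_mul,
    integral_Ioi_rpow_of_lt (by linarith) hv]
  · congr 1
    rw [show -γ + 1 = 1 - γ by ring]
    have : 1 - γ ≠ 0 := by linarith
    field_simp
    ring
  · refine (ae_restrict_iff' measurableSet_Ioi).2 (Eventually.of_forall fun w hw => ?_)
    have : 0 < w := hv.trans hw
    exact mul_nonneg (by linarith) (Real.rpow_nonneg this.le _)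

/-- The marked lines with angle in `I`, speed at least `v`, and distance at most `δ` from `z`. -/
def window (I : Set ℝ) (z : Plane) (δ v : ℝ) : Set (PlaneLine × ℝ) :=
  {m | m.1.rep.1 ∈ I ∧ |height m.1.rep z| ≤ δ ∧ v ≤ m.2}

theorem measurableSet_window {I : Set ℝ} (hI : MeasurableSet I) (z : Plane) (δ v : ℝ) :
    MeasurableSet (window I z δ v) := by
  have h1 : Measurable fun m : PlaneLine × ℝ => m.1.rep :=
    PlaneLine.measurable_rep.comp measurable_fst
  have h2 : Measurable fun m : PlaneLine × ℝ => |height m.1.rep z| := by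
    have : Continuous fun p : ℝ × ℝ => |height p z| := by unfold height; fun_prop
    exact this.measurable.comp h1
  exact (measurable_fst.comp h1 hI).inter
    ((measurableSet_le h2 measurable_const).inter
      (measurableSet_le measurable_const measurable_snd))

theorem markedLineIntensity_window (hγ : 2 < γ) {I : Set ℝ} (hI : MeasurableSet I)
    (hIπ : I ⊆ Ico 0 Real.pi) (z : Plane) (δ : ℝ) {v : ℝ} (hv : 0 < v) :
    markedLineIntensity γ (window I z δ v) =
      2⁻¹ * (ENNReal.ofReal (2 * δ) * volume I) * ENNReal.ofReal (v ^ (1 - γ)) := by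
  have hmeas : MeasurableSet {ℓ : PlaneLine | ℓ.rep.1 ∈ I ∧ |height ℓ.rep z| ≤ δ} := by
    have : Continuous fun p : ℝ × ℝ => |height p z| := by unfold height; fun_prop
    exact (measurable_fst.comp PlaneLine.measurable_rep hI).inter
      (measurableSet_le (this.measurable.comp PlaneLine.measurable_rep) measurable_const)
  have hprod : window I z δ v = {ℓ : PlaneLine | ℓ.rep.1 ∈ I ∧ |height ℓ.rep z| ≤ δ} ×ˢ Ici v := by
    ext m
    simp only [window, mem_ofPred_eq, mem_prod, mem_Ici]
    tauto
  rw [hprod, markedLineIntensity, Measure.prod_prod, speedMeasure_Ici hγ hv,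
    lineMeasure_apply hmeas]
  congr 2
  have hset : {p : ℝ × ℝ | p.1 ∈ Ico 0 Real.pi ∧
      PlaneLine.ofParam p ∈ {ℓ : PlaneLine | ℓ.rep.1 ∈ I ∧ |height ℓ.rep z| ≤ δ}} =
      {p : ℝ × ℝ | p.1 ∈ I ∧ |height p z| ≤ δ} := by
    ext p
    simp only [mem_ofPred_eq]
    constructor
    · rintro ⟨h1, h2⟩
      rwa [PlaneLine.rep_ofParam h1] at h2
    · intro h
      have h1 := hIπ h.1
      rw [PlaneLine.rep_ofParam h1]
      exact ⟨h1, h⟩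
  have hm : MeasurableSet {p : ℝ × ℝ | p.1 ∈ I ∧ |height p z| ≤ δ} := by
    have : Continuous fun p : ℝ × ℝ => |height p z| := by unfold height; fun_prop
    exact (measurable_fst hI).inter (measurableSet_le this.measurable measurable_const)
  rw [hset, Measure.volume_eq_prod, Measure.prod_apply hm]
  have hsec : ∀ θ, volume (Prod.mk θ ⁻¹' {p : ℝ × ℝ | p.1 ∈ I ∧ |height p z| ≤ δ}) =
      I.indicator (fun _ => ENNReal.ofReal (2 * δ)) θ := by
    intro θ
    by_cases hθ : θ ∈ I
    · rw [indicator_of_mem hθ]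
      have : Prod.mk θ ⁻¹' {p : ℝ × ℝ | p.1 ∈ I ∧ |height p z| ≤ δ} =
          Icc (height (θ, 0) z - δ) (height (θ, 0) z + δ) := by
        ext r
        simp only [mem_preimage, mem_ofPred_eq, hθ, true_and, mem_Icc, abs_le, height]
        constructor <;> rintro ⟨h1, h2⟩ <;> constructor <;> linarith
      rw [this, Real.volume_Icc]
      congr 1
      ring
    · rw [indicator_of_notMem hθ]
      simp [hθ]
  simp_rw [hsec]
  rw [lintegral_indicator hI, setLIntegral_const]

/-- Almost every marked line misses a given point. -/
theorem volume_height_eq_zero (z : Plane) : volume {p : ℝ × ℝ | height p z = 0} = 0 := by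
  have hm : MeasurableSet {p : ℝ × ℝ | height p z = 0} := by
    have : Continuous fun p : ℝ × ℝ => height p z := by unfold height; fun_prop
    exact this.measurable (measurableSet_singleton 0)
  rw [Measure.volume_eq_prod, Measure.measure_prod_null hm]
  refine Eventually.of_forall fun θ => ?_
  have : Prod.mk θ ⁻¹' {p : ℝ × ℝ | height p z = 0} = {height (θ, 0) z} := by
    ext r
    simp only [mem_preimage, mem_ofPred_eq, mem_singleton_iff, height]
    constructor <;> intro h <;> linarith
  change volume (Prod.mk θ ⁻¹' _) = 0
  rw [this]
  exact Real.volume_singleton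

theorem volume_fst_eq_zero (S : Set ℝ) (hS : volume S = 0) :
    volume {p : ℝ × ℝ | p.1 ∈ S} = 0 := by
  have : {p : ℝ × ℝ | p.1 ∈ S} = S ×ˢ univ := by ext p; simp
  rw [this, Measure.volume_eq_prod, Measure.prod_prod, hS, zero_mul]

end intensity

/-! ### Regularity of the random lines -/

section process

variable {Ω : Type*} [MeasurableSpace Ω] {P : Measure Ω} {γ : ℝ}
  {L : Ω → Set (PlaneLine × ℝ)}

theorem abs_height_zero_le {ℓ : PlaneLine} {z : Plane} (hz : z ∈ ℓ.points) :
    |height ℓ.rep 0| ≤ ‖z‖ := by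
  have := abs_height_sub_le ℓ.rep 0 z
  rwa [PlaneLine.mem_points.1 hz, sub_zero, dist_zero_left] at this

theorem ae_locFin (hγ : 2 < γ) (hL : IsPoissonProcess P (markedLineIntensity γ) L) :
    ∀ᵐ ω ∂P, ∀ R v : ℝ, 0 < v → {m ∈ L ω | v ≤ m.2 ∧ ∃ z ∈ m.1.points, ‖z‖ ≤ R}.Finite := by
  have h1 : ∀ᵐ ω ∂P, ∀ i j : ℕ,
      (L ω ∩ window (Ico 0 Real.pi) 0 i (1 / ((j : ℝ) + 1))).Finite := by
    refine ae_all_iff.2 fun i => ae_all_iff.2 fun j => hL.ae_finite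
      (measurableSet_window measurableSet_Ico _ _ _) ?_
    rw [markedLineIntensity_window hγ measurableSet_Ico subset_rfl _ _ (by positivity),
      Real.volume_Ico]
    exact ENNReal.mul_ne_top (ENNReal.mul_ne_top (by simp)
      (ENNReal.mul_ne_top ENNReal.ofReal_ne_top ENNReal.ofReal_ne_top)) ENNReal.ofReal_ne_top
  filter_upwards [h1] with ω hω R v hv
  obtain ⟨i, hi⟩ := exists_nat_ge R
  obtain ⟨j, hj⟩ := exists_nat_one_div_lt hv
  refine (hω i j).subset fun m hm => ⟨hm.1, m.1.rep_mem, ?_, hj.le.trans hm.2.1⟩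
  obtain ⟨z, hz, hzR⟩ := hm.2.2
  exact (abs_height_zero_le hz).trans (hzR.trans hi)

variable [IsProbabilityMeasure P]

theorem ae_tame (hγ : 2 < γ) (hL : IsPoissonProcess P (markedLineIntensity γ) L) :
    ∀ᵐ ω ∂P, ∃ k₀, Tame (silhouette (L ω)) k₀ := by
  set W : ℕ → Set (PlaneLine × ℝ) := fun k => window (Ico 0 Real.pi) 0 (2 ^ k) (2 ^ k) with hW
  have hWm : ∀ k, MeasurableSet (W k) := fun k => measurableSet_window measurableSet_Ico _ _ _
  set q : ℝ := 2 ^ (2 - γ) with hq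
  have hq1 : q < 1 := Real.rpow_lt_one_of_one_lt_of_neg one_lt_two (by linarith)
  have hq0 : 0 < q := Real.rpow_pos_of_pos two_pos _
  have hle : ∀ k, P {ω | (L ω ∩ W k).Nonempty} ≤ ENNReal.ofReal (Real.pi * q ^ k) := by
    intro k
    refine (hL.measure_inter_nonempty_le (hWm k)).trans_eq ?_
    rw [hW, markedLineIntensity_window hγ measurableSet_Ico subset_rfl _ _ (by positivity),
      Real.volume_Ico, ← ENNReal.ofReal_mul (by positivity),
      show (2⁻¹ : ℝ≥0∞) = ENNReal.ofReal 2⁻¹ by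
        rw [ENNReal.ofReal_inv_of_pos two_pos]; simp,
      ← ENNReal.ofReal_mul (by positivity), ← ENNReal.ofReal_mul (by
        have := Real.pi_pos
        rw [sub_zero]
        positivity)]
    congr 1
    have h1 : ((2 : ℝ) ^ k) ^ (1 - γ) = (2 ^ (1 - γ)) ^ k := by
      rw [← Real.rpow_natCast, ← Real.rpow_mul two_pos.le, mul_comm, Real.rpow_mul two_pos.le,
        Real.rpow_natCast]
    have h2 : q = 2 * 2 ^ (1 - γ) := by
      rw [hq, show (2 - γ : ℝ) = 1 + (1 - γ) by ring, Real.rpow_add two_pos, Real.rpow_one]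
    rw [h1, h2, mul_pow]
    ring
  have hsum : ∑' k, P {ω | (L ω ∩ W k).Nonempty} ≠ ⊤ := by
    have hs : Summable fun k : ℕ => Real.pi * q ^ k :=
      (summable_geometric_of_lt_one hq0.le hq1).mul_left _
    exact ne_top_of_le_ne_top hs.tsum_ofReal_ne_top (ENNReal.tsum_le_tsum hle)
  filter_upwards [ae_eventually_notMem hsum] with ω hω
  obtain ⟨k₀, hk₀⟩ := eventually_atTop.1 hω
  refine ⟨k₀, fun k hk v hv z hz ⟨ℓ, w, hm, hvw, hmem⟩ => hk₀ k hk ?_⟩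
  exact ⟨(ℓ, w), hm, ℓ.rep_mem, (abs_height_zero_le hmem).trans hz, hv.le.trans hvw⟩

/-- Almost surely, the random lines are locally finite at each speed and not too fast. -/
theorem ae_speedRegular (hγ : 2 < γ) (hL : IsPoissonProcess P (markedLineIntensity γ) L) :
    ∀ᵐ ω ∂P, ∃ k₀, SpeedRegular (L ω) k₀ := by
  filter_upwards [ae_locFin hγ hL, ae_tame hγ hL] with ω h1 ⟨k₀, h2⟩
  exact ⟨k₀, h1, h2⟩

/-- The marked lines whose coordinates belong to `U`. -/
def cell (U : Set ((ℝ × ℝ) × ℝ)) : Set (PlaneLine × ℝ) := {m | (m.1.rep, m.2) ∈ U}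

theorem measurableSet_cell {U : Set ((ℝ × ℝ) × ℝ)} (hU : MeasurableSet U) :
    MeasurableSet (cell U) :=
  ((PlaneLine.measurable_rep.comp measurable_fst).prodMk measurable_snd) hU

/-- Every line of a regular family is isolated by one of countably many cells. -/
theorem SpeedRegular.exists_cell {C : Set (PlaneLine × ℝ)} {k₀ : ℕ} (hC : SpeedRegular C k₀)
    {m : PlaneLine × ℝ} (hm : m ∈ C) (hpos : 0 < m.2) :
    ∃ U ∈ TopologicalSpace.countableBasis ((ℝ × ℝ) × ℝ), C ∩ cell U = {m} := by
  have hfin := hC.locFin (|m.1.rep.2| + 1) (m.2 / 2) (half_pos hpos)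
  set c : PlaneLine × ℝ → (ℝ × ℝ) × ℝ := fun m => (m.1.rep, m.2) with hc
  have hcinj : Function.Injective c := fun m m' h =>
    Prod.ext (PlaneLine.rep_injective (congrArg (fun u : (ℝ × ℝ) × ℝ => u.1) h))
      (congrArg (fun u : (ℝ × ℝ) × ℝ => u.2) h)
  set F := c '' ({m' ∈ C | m.2 / 2 ≤ m'.2 ∧ ∃ z ∈ m'.1.points, ‖z‖ ≤ |m.1.rep.2| + 1} \ {m})
    with hF
  have hFfin : F.Finite := (hfin.subset sdiff_subset).image c
  have hopen : IsOpen ({u : (ℝ × ℝ) × ℝ | m.2 / 2 < u.2 ∧ |u.1.2| < |m.1.rep.2| + 1} ∩ Fᶜ) := by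
    refine IsOpen.inter (IsOpen.inter ?_ ?_) hFfin.isClosed.isOpen_compl
    · exact isOpen_lt continuous_const continuous_snd
    · exact isOpen_lt (f := fun u : (ℝ × ℝ) × ℝ => |u.1.2|) (by fun_prop) continuous_const
  have hmem : c m ∈ {u : (ℝ × ℝ) × ℝ | m.2 / 2 < u.2 ∧ |u.1.2| < |m.1.rep.2| + 1} ∩ Fᶜ := by
    refine ⟨⟨half_lt_self hpos, lt_add_one _⟩, ?_⟩
    rintro ⟨m', hm', heq⟩
    exact hm'.2 (hcinj heq)
  obtain ⟨U, hU, hmU, hsub⟩ :=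
    (TopologicalSpace.isBasis_countableBasis _).exists_subset_of_mem_open hmem hopen
  refine ⟨U, hU, Subset.antisymm (fun m' hm' => ?_) (singleton_subset_iff.2 ⟨hm, hmU⟩)⟩
  by_contra hne
  obtain ⟨⟨h1, h2⟩, h3⟩ := hsub hm'.2
  refine h3 ⟨m', ⟨⟨hm'.1, le_of_lt h1, PlaneLine.foot m'.1.rep 0, ?_, ?_⟩, hne⟩, rfl⟩
  · exact PlaneLine.mem_points.2 (PlaneLine.height_foot _ _)
  · rw [← dist_zero_left, PlaneLine.dist_foot]
    have : height m'.1.rep 0 = -m'.1.rep.2 := by simp [height]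
    rw [this, abs_neg]
    exact le_of_lt h2

theorem ae_speed_pos (hL : IsPoissonProcess P (markedLineIntensity γ) L) :
    ∀ᵐ ω ∂P, ∀ m ∈ L ω, 0 < m.2 := by
  have hA : MeasurableSet {m : PlaneLine × ℝ | m.2 ≤ 0} :=
    measurableSet_le measurable_snd measurable_const
  filter_upwards [hL.ae_inter_eq_empty hA (markedLineIntensity_eq_zero hA fun w hw => by
    simp [not_le.2 hw])] with ω hω m hm
  by_contra h
  exact eq_empty_iff_forall_notMem.1 hω m ⟨hm, not_lt.1 h⟩

/-- If the marked lines `m` with a property that involves `m` and a regular family of lines always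
form a null set, then, almost surely, no random line has this property together with the family of
the other lines. -/
theorem ae_forall_notMem (hγ : 2 < γ) (hL : IsPoissonProcess P (markedLineIntensity γ) L)
    {F : Set (Configuration (PlaneLine × ℝ) × (PlaneLine × ℝ))} (hF : MeasurableSet F)
    (hnull : ∀ C k₀, SpeedRegular C.points k₀ → markedLineIntensity γ {m | (C, m) ∈ F} = 0) :
    ∀ᵐ ω ∂P, ∀ m ∈ L ω, (⟨L ω \ {m}⟩, m) ∉ F := by
  have hcount := TopologicalSpace.countable_countableBasis ((ℝ × ℝ) × ℝ)
  have h1 : ∀ᵐ ω ∂P, ∀ U ∈ TopologicalSpace.countableBasis ((ℝ × ℝ) × ℝ),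
      ∀ m, L ω ∩ cell U = {m} → (IsPoissonProcess.outside L (cell U) ω, m) ∉ F := by
    refine (ae_ball_iff hcount).2 fun U hU => ?_
    have hUm : MeasurableSet (cell U) :=
      measurableSet_cell (TopologicalSpace.isOpen_of_mem_countableBasis hU).measurableSet
    refine hL.ae_notMem_of_null hUm hF ?_
    filter_upwards [ae_speedRegular hγ hL] with ω ⟨k₀, hω⟩
    exact hnull _ k₀ (hω.subset sdiff_subset)
  filter_upwards [h1, ae_speedRegular hγ hL, ae_speed_pos hL] with ω hω ⟨k₀, hreg⟩ hpos m hm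
  obtain ⟨U, hU, hmU⟩ := hreg.exists_cell hm (hpos m hm)
  have := hω U hU m hmU
  have heq : L ω \ cell U = L ω \ {m} := by
    rw [← hmU, sdiff_self_inter]
  rwa [IsPoissonProcess.outside, heq] at this

theorem ae_notMem_points (hL : IsPoissonProcess P (markedLineIntensity γ) L) (z : Plane) :
    ∀ᵐ ω ∂P, ∀ m ∈ L ω, z ∉ m.1.points := by
  have hA : MeasurableSet {m : PlaneLine × ℝ | height m.1.rep z = 0} := by
    have : Continuous fun p : ℝ × ℝ => height p z := by unfold height; fun_prop
    exact (this.measurable.comp (PlaneLine.measurable_rep.comp measurable_fst))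
      (measurableSet_singleton 0)
  have hnull : markedLineIntensity γ {m : PlaneLine × ℝ | height m.1.rep z = 0} = 0 := by
    refine markedLineIntensity_eq_zero hA fun w _ =>
      measure_mono_null (fun p hp => ?_) (volume_height_eq_zero z)
    have h2 : height (PlaneLine.ofParam p).rep z = 0 := hp.2
    rwa [PlaneLine.rep_ofParam hp.1] at h2
  filter_upwards [hL.ae_inter_eq_empty hA hnull] with ω hω m hm hz
  exact eq_empty_iff_forall_notMem.1 hω m ⟨hm, PlaneLine.mem_points.1 hz⟩

theorem volume_ofParam_angle_eq_zero {S : Set ℝ} (hS : volume S = 0) (w : ℝ) :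
    volume {p : ℝ × ℝ | p.1 ∈ Ico 0 Real.pi ∧
      (PlaneLine.ofParam p, w) ∈ {m : PlaneLine × ℝ | m.1.rep.1 ∈ S}} = 0 := by
  refine measure_mono_null (fun p hp => ?_) (volume_fst_eq_zero S hS)
  have h2 : (PlaneLine.ofParam p).rep.1 ∈ S := hp.2
  rwa [PlaneLine.rep_ofParam hp.1] at h2

theorem ae_cos_ne_zero (hL : IsPoissonProcess P (markedLineIntensity γ) L) :
    ∀ᵐ ω ∂P, ∀ m ∈ L ω, Real.cos m.1.rep.1 ≠ 0 := by
  have hA : MeasurableSet {m : PlaneLine × ℝ | m.1.rep.1 ∈ {θ | Real.cos θ = 0}} :=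
    (measurable_fst.comp (PlaneLine.measurable_rep.comp measurable_fst))
      (Real.measurable_cos (measurableSet_singleton 0))
  have hS : volume {θ | Real.cos θ = 0} = 0 := by
    refine Set.Countable.measure_zero ?_ _
    have : {θ | Real.cos θ = 0} ⊆ range fun k : ℤ => (2 * k + 1) * Real.pi / 2 := by
      intro θ hθ
      obtain ⟨k, hk⟩ := Real.cos_eq_zero_iff.1 hθ
      exact ⟨k, hk.symm⟩
    exact (countable_range _).mono this
  filter_upwards [hL.ae_inter_eq_empty hA (markedLineIntensity_eq_zero hA fun w _ =>
    volume_ofParam_angle_eq_zero hS w)] with ω hω m hm hz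
  exact eq_empty_iff_forall_notMem.1 hω m ⟨hm, hz⟩

/-- Almost surely, a property that is unlikely to hold for a random line and a given other line does
not hold for any two of the lines. -/
theorem ae_forall_pair_notMem (hγ : 2 < γ) (hL : IsPoissonProcess P (markedLineIntensity γ) L)
    {F : Set ((Configuration (PlaneLine × ℝ) × (PlaneLine × ℝ)) × (PlaneLine × ℝ))}
    (hF : MeasurableSet F)
    (hnull : ∀ C k₀ m', SpeedRegular C.points k₀ →
      markedLineIntensity γ {m | ((C, m'), m) ∈ F} = 0) :
    ∀ᵐ ω ∂P, ∀ m ∈ L ω, ∀ m' ∈ L ω, m ≠ m' → ((⟨L ω \ {m}⟩, m'), m) ∉ F := by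
  have hcount := TopologicalSpace.countable_countableBasis ((ℝ × ℝ) × ℝ)
  let s₀ : PlaneLine × ℝ := (PlaneLine.ofParam 0, 0)
  have h1 : ∀ᵐ ω ∂P, ∀ U ∈ TopologicalSpace.countableBasis ((ℝ × ℝ) × ℝ),
      ∀ m ∈ L ω, (((⟨L ω \ {m}⟩ : Configuration _),
        Configuration.pointIn s₀ (cell U) ⟨L ω \ {m}⟩), m) ∉ F := by
    refine (ae_ball_iff hcount).2 fun U hU => ?_
    have hUm : MeasurableSet (cell U) :=
      measurableSet_cell (TopologicalSpace.isOpen_of_mem_countableBasis hU).measurableSet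
    have hmeas : Measurable fun q : Configuration (PlaneLine × ℝ) × (PlaneLine × ℝ) =>
        ((q.1, Configuration.pointIn s₀ (cell U) q.1), q.2) :=
      (measurable_fst.prodMk ((Configuration.measurable_pointIn s₀ hUm).comp
        measurable_fst)).prodMk measurable_snd
    exact ae_forall_notMem hγ hL (hmeas hF) fun C k₀ hC =>
      hnull C k₀ (Configuration.pointIn s₀ (cell U) C) hC
  filter_upwards [h1, ae_speedRegular hγ hL, ae_speed_pos hL] with ω hω ⟨k₀, hreg⟩ hpos m hm m' hm'
    hne
  obtain ⟨U, hU, hmU⟩ := (hreg.subset (sdiff_subset (s := L ω) (t := {m}))).exists_cell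
    (m := m') ⟨hm', fun h => hne h.symm⟩ (hpos m' hm')
  have := hω U hU m hm
  rwa [Configuration.pointIn_eq (C := ⟨L ω \ {m}⟩) hmU] at this

theorem ae_inGeneralDirections (hγ : 2 < γ) (hL : IsPoissonProcess P (markedLineIntensity γ) L) :
    ∀ᵐ ω ∂P, InGeneralDirections (L ω) := by
  have hm : Measurable fun m : PlaneLine × ℝ => m.1.rep.1 :=
    measurable_fst.comp (PlaneLine.measurable_rep.comp measurable_fst)
  have hF : MeasurableSet {q : (Configuration (PlaneLine × ℝ) × (PlaneLine × ℝ)) ×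
      (PlaneLine × ℝ) | q.2.1.rep.1 = q.1.2.1.rep.1} :=
    measurableSet_eq_fun (hm.comp measurable_snd)
      (hm.comp (measurable_snd.comp measurable_fst))
  have h1 := ae_forall_pair_notMem hγ hL hF fun C k₀ m' _ =>
    markedLineIntensity_eq_zero (A := {m : PlaneLine × ℝ | m.1.rep.1 ∈ {m'.1.rep.1}})
      (hm (measurableSet_singleton _)) fun w _ =>
      volume_ofParam_angle_eq_zero Real.volume_singleton w
  filter_upwards [h1, ae_speed_pos hL] with ω hω hpos
  exact ⟨hpos, fun m hm m' hm' hne heq => hω m hm m' hm' hne heq⟩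

end process

/-! ### Measurability of travel times -/

section measurability

variable {α : Type*} [MeasurableSpace α]

theorem measurable_stepCost (n : ℕ) (z z' : Plane) :
    Measurable fun m : PlaneLine × ℝ => stepCost n m z z' := by
  have h1 : ∀ z, Measurable fun m : PlaneLine × ℝ => |height m.1.rep z| := by
    intro z
    have : Continuous fun p : ℝ × ℝ => |height p z| := by unfold height; fun_prop
    exact this.measurable.comp (PlaneLine.measurable_rep.comp measurable_fst)
  unfold stepCost
  exact ((measurable_const.mul (h1 z).ennreal_ofReal).add
    (measurable_const.div measurable_snd.ennreal_ofReal)).add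
    (measurable_const.mul (h1 z').ennreal_ofReal)

/-- The approximate travel times depend measurably on a family of lines, a further line, and the end
points. -/
theorem measurable_chainTime {c : α → Configuration (PlaneLine × ℝ)} (hc : Measurable c)
    {g : α → PlaneLine × ℝ} (hg : Measurable g) {u u' : α → Plane} (hu : Measurable u)
    (hu' : Measurable u') (n : ℕ) :
    Measurable fun a => chainTime (insert (g a) (c a).points) n (u a) (u' a) := by
  have h1 : ∀ z z', Measurable fun a => netCost (insert (g a) (c a).points) n z z' := by
    intro z z'
    simp only [netCost, iInf_insert]
    exact measurable_const.min (((measurable_stepCost n z z').comp hg).min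
      ((Configuration.measurable_iInf (measurable_stepCost n z z')).comp hc))
  have h2 : ∀ k i j, Measurable fun a => chainCost (insert (g a) (c a).points) n k i j := by
    intro k
    induction k with
    | zero => exact fun i j => h1 _ _
    | succ k ih => exact fun i j => Measurable.iInf fun m => (ih i m).add (h1 _ _)
  unfold chainTime
  refine Measurable.iInf fun k => Measurable.iInf fun i => Measurable.iInf fun j => ?_
  exact ((measurable_const.mul (hu.edist measurable_const)).add (h2 k i j)).add
    (measurable_const.mul (measurable_const.edist hu'))

theorem measurable_iSup_chainTime {c : α → Configuration (PlaneLine × ℝ)} (hc : Measurable c)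
    {g : α → PlaneLine × ℝ} (hg : Measurable g) {u u' : α → Plane} (hu : Measurable u)
    (hu' : Measurable u') :
    Measurable fun a => ⨆ n, chainTime (insert (g a) (c a).points) n (u a) (u' a) :=
  Measurable.iSup fun n => measurable_chainTime hc hg hu hu' n

theorem iSup_chainTime_insert {C : Set (PlaneLine × ℝ)} {k₀ : ℕ}
    (hC : SpeedRegular C k₀) (m : PlaneLine × ℝ) (u u' : Plane) :
    ⨆ n, chainTime (insert m C) n u u' = travelTime (insert m C) u u' := by
  obtain ⟨k, hk⟩ := pow_unbounded_of_one_lt m.2 (one_lt_two)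
  exact iSup_chainTime ((hC.mono (le_max_left k₀ k)).insert
    (hk.le.trans (pow_le_pow_right₀ one_le_two (le_max_right _ _)))) u u'

end measurability

/-! ### Travel times have no corner as functions of a speed -/

theorem measurableSet_cornerAt {α : Type*} [MeasurableSpace α] {f : α → ℝ → ℝ≥0∞} {w : α → ℝ}
    (hw : Measurable w) (hfw : Measurable fun a => f a (w a))
    (hf : ∀ r : ℚ, Measurable fun a => f a r) (q q' : ℚ) :
    MeasurableSet {a | CornerAt (f a) q q' (w a)} := by
  have e : {a | CornerAt (f a) q q' (w a)} = {a | f a (w a) < ⊤} ∩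
      ((⋂ r : ℚ, {a | w a < r}ᶜ ∪
        {a | f a r + ENNReal.ofReal (q' * (1 / w a - 1 / r)) ≤ f a (w a)}) ∩
      ⋂ r : ℚ, {_a | (0 : ℝ) < r}ᶜ ∪ ({a | (r : ℝ) < w a}ᶜ ∪
        {a | f a r ≤ f a (w a) + ENNReal.ofReal (q * (1 / r - 1 / w a))})) := by
    ext a
    simp only [CornerAt, mem_ofPred_eq, mem_inter_iff, mem_iInter, mem_union, mem_compl_iff,
      imp_iff_not_or]
  have hw' : Measurable fun a => 1 / w a := measurable_const.div hw
  rw [e]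
  refine (measurableSet_lt hfw measurable_const).inter ((MeasurableSet.iInter fun r => ?_).inter
    (MeasurableSet.iInter fun r => ?_))
  · exact (measurableSet_lt hw measurable_const).compl.union (measurableSet_le
      ((hf r).add (measurable_const.mul (hw'.sub measurable_const)).ennreal_ofReal) hfw)
  · exact (MeasurableSet.const _).compl.union ((measurableSet_lt measurable_const hw).compl.union
      (measurableSet_le (hf r)
        (hfw.add (measurable_const.mul (measurable_const.sub hw')).ennreal_ofReal)))

/-- A decreasing function has at most one corner with given slopes: between two of them it would
have to decrease both more and less steeply. -/
theorem subsingleton_cornerAt {f : ℝ → ℝ≥0∞} (hf : Antitone f) {q q' : ℚ} (hq : 0 ≤ q)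
    (hqq' : q < q') : {w | 0 < w ∧ CornerAt f q q' w}.Subsingleton := by
  have key : ∀ w w', 0 < w → CornerAt f q q' w → CornerAt f q q' w' → w < w' → False := by
    intro w w' hw h h' hlt
    have hw' : 0 < w' := hw.trans hlt
    have hD : 0 < 1 / w - 1 / w' := by
      have := one_div_lt_one_div_of_lt hw hlt
      linarith
    have hq0 : (0 : ℝ) ≤ q := by exact_mod_cast hq
    have hqR : (q : ℝ) < q' := by exact_mod_cast hqq'
    have hstep : ∀ r r' : ℚ, (0 : ℝ) < r → (r : ℝ) < w → w < r' → (r' : ℝ) < w' →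
        (q' : ℝ) * (1 / w - 1 / r') ≤ q * (1 / r - 1 / w') := by
      intro r r' hr hrw hwr' hr'w'
      have h1 := h.2.1 r' hwr'
      have h2 := h'.2.2 r hr (hrw.trans hlt)
      have h3 : f w' + ENNReal.ofReal (q' * (1 / w - 1 / r')) ≤
          f w' + ENNReal.ofReal (q * (1 / r - 1 / w')) :=
        (add_le_add (hf hr'w'.le) le_rfl).trans (h1.trans ((hf hrw.le).trans h2))
      rw [ENNReal.add_le_add_iff_left h'.1.ne] at h3
      have h4 : (1 : ℝ) / w' ≤ 1 / r := one_div_le_one_div_of_le hr (hrw.trans hlt).le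
      exact (ENNReal.ofReal_le_ofReal_iff (mul_nonneg hq0 (by linarith))).1 h3
    -- rational approximations of the two corners from the left
    have hc1 : Tendsto (fun r : ℝ => q * (1 / r - 1 / w')) (𝓝[<] w)
        (𝓝 (q * (1 / w - 1 / w'))) := by
      have : ContinuousAt (fun r : ℝ => q * (1 / r - 1 / w')) w := by
        have : w ≠ 0 := hw.ne'
        fun_prop (disch := assumption)
      exact this.tendsto.mono_left nhdsWithin_le_nhds
    have hc2 : Tendsto (fun r : ℝ => q' * (1 / w - 1 / r)) (𝓝[<] w')
        (𝓝 (q' * (1 / w - 1 / w'))) := by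
      have : ContinuousAt (fun r : ℝ => q' * (1 / w - 1 / r)) w' := by
        have : w' ≠ 0 := hw'.ne'
        fun_prop (disch := assumption)
      exact this.tendsto.mono_left nhdsWithin_le_nhds
    have hlim : (q : ℝ) * (1 / w - 1 / w') < q' * (1 / w - 1 / w') :=
      mul_lt_mul_of_pos_right hqR hD
    obtain ⟨b, hb, hb'⟩ := exists_between hlim
    obtain ⟨x, hx, hx'⟩ := mem_nhdsLT_iff_exists_Ioo_subset.1 (hc1.eventually (gt_mem_nhds hb))
    obtain ⟨x', hx2, hx2'⟩ := mem_nhdsLT_iff_exists_Ioo_subset.1 (hc2.eventually (lt_mem_nhds hb'))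
    obtain ⟨r, hr, hrw⟩ := exists_rat_btwn (max_lt hx hw)
    obtain ⟨r', hr', hrw'⟩ := exists_rat_btwn (max_lt hx2 hlt)
    have h1 := hx' ⟨(le_max_left _ _).trans_lt hr, hrw⟩
    have h2 := hx2' ⟨(le_max_left _ _).trans_lt hr', hrw'⟩
    have h3 := hstep r r' ((le_max_right _ _).trans_lt hr) hrw ((le_max_right _ _).trans_lt hr')
      hrw'
    simp only [mem_ofPred_eq] at h1 h2
    linarith
  rintro w ⟨hw, h⟩ w' ⟨hw', h'⟩
  rcases lt_trichotomy w w' with hlt | heq | hlt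
  · exact (key w w' hw h h' hlt).elim
  · exact heq
  · exact (key w' w hw' h' h hlt).elim

theorem antitone_travelTime_insert (C : Set (PlaneLine × ℝ)) (ℓ : PlaneLine) (u u' : Plane) :
    Antitone fun w => travelTime (insert (ℓ, w) C) u u' := by
  intro w w' hww'
  refine reachTime_anti fun v _ z hz => ?_
  rw [mem_silhouette_insert] at hz ⊢
  exact hz.imp_left fun h => ⟨h.1.trans hww', h.2⟩

section process

variable {Ω : Type*} [MeasurableSpace Ω] {P : Measure Ω} [IsProbabilityMeasure P] {γ : ℝ}
  {L : Ω → Set (PlaneLine × ℝ)}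

theorem ae_noCorner (hγ : 2 < γ) (hL : IsPoissonProcess P (markedLineIntensity γ) L)
    (x y : Plane) : ∀ᵐ ω ∂P, NoCorner (L ω) x y := by
  have h1 : ∀ᵐ ω ∂P, ∀ q q' : ℚ, 0 ≤ q → q < q' → ∀ m ∈ L ω,
      ((⟨L ω \ {m}⟩ : Configuration (PlaneLine × ℝ)), m) ∉
        {a : Configuration (PlaneLine × ℝ) × (PlaneLine × ℝ) | CornerAt
          (fun w => ⨆ n, chainTime (insert (a.2.1, w) a.1.points) n x y) q q' a.2.2} := by
    refine ae_all_iff.2 fun q => ae_all_iff.2 fun q' => ae_all_iff.2 fun hq => ae_all_iff.2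
      fun hqq' => ?_
    have hF : MeasurableSet {a : Configuration (PlaneLine × ℝ) × (PlaneLine × ℝ) | CornerAt
        (fun w => ⨆ n, chainTime (insert (a.2.1, w) a.1.points) n x y) q q' a.2.2} :=
      measurableSet_cornerAt (measurable_snd.comp measurable_snd)
        (measurable_iSup_chainTime measurable_fst measurable_snd measurable_const measurable_const)
        (fun r => measurable_iSup_chainTime measurable_fst
          ((measurable_fst.comp measurable_snd).prodMk measurable_const) measurable_const
          measurable_const) q q'
    refine ae_forall_notMem hγ hL hF fun C k₀ hC => ?_
    have hFC := measurable_prodMk_left (x := C) hF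
    rw [markedLineIntensity]
    refine (Measure.measure_prod_null hFC).2 (Eventually.of_forall fun ℓ => ?_)
    have hsub : ({w | 0 < w ∧ CornerAt (fun w => travelTime (insert (ℓ, w) C.points) x y) q q' w} :
        Set ℝ).Subsingleton :=
      subsingleton_cornerAt (antitone_travelTime_insert C.points ℓ x y) hq hqq'
    refine withDensity_absolutelyContinuous _ _ ?_
    rw [Measure.restrict_apply (measurable_prodMk_left hFC)]
    refine measure_mono_null (fun w hw => ?_) (hsub.countable.measure_zero _)
    refine ⟨hw.2, ?_⟩
    have h2 : CornerAt (fun w => ⨆ n, chainTime (insert (ℓ, w) C.points) n x y) q q' w := hw.1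
    simpa only [iSup_chainTime_insert hC] using h2
  filter_upwards [h1, ae_speedRegular hγ hL] with ω hω ⟨k₀, hreg⟩ m hm q q' hq hqq' hcor
  refine hω q q' hq hqq' m hm ?_
  simp only [iSup_chainTime_insert (hreg.subset (sdiff_subset (s := L ω) (t := {m})))]
  exact hcor

/-! ### Crossings are rationally independent -/

/-- The position, on the line with parameters `p`, of its crossing with the line with parameters
`p'`. -/
noncomputable def crossing (p p' : ℝ × ℝ) : ℝ :=
  (p'.2 - p.2 * Real.cos (p'.1 - p.1)) / -Real.sin (p'.1 - p.1)

theorem height_eq_of_along (p p' : ℝ × ℝ) {z : Plane} (hz : height p z = 0) :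
    height p' z = -Real.sin (p'.1 - p.1) * along p.1 z + p.2 * Real.cos (p'.1 - p.1) - p'.2 := by
  have hp2 : p.2 = -Real.sin p.1 * z 0 + Real.cos p.1 * z 1 := by
    unfold height at hz; linarith
  have hcs := Real.sin_sq_add_cos_sq p.1
  rw [Real.sin_sub, Real.cos_sub, hp2, height, along]
  linear_combination (Real.sin p'.1 * z 0 - Real.cos p'.1 * z 1) * hcs

theorem sin_sub_ne_zero {θ θ' : ℝ} (h : θ ∈ Ico 0 Real.pi) (h' : θ' ∈ Ico 0 Real.pi)
    (hne : θ ≠ θ') : Real.sin (θ' - θ) ≠ 0 := by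
  rw [Ne, Real.sin_eq_zero_iff_of_lt_of_lt (by linarith [h.2, h'.1]) (by linarith [h.1, h'.2])]
  exact fun h0 => hne (by linarith)

theorem along_eq_crossing {ℓ ℓ' : PlaneLine} (hne : ℓ.rep.1 ≠ ℓ'.rep.1) {z : Plane}
    (hz : z ∈ ℓ.points) (hz' : z ∈ ℓ'.points) : along ℓ.rep.1 z = crossing ℓ.rep ℓ'.rep := by
  have hs := sin_sub_ne_zero ℓ.rep_mem ℓ'.rep_mem hne
  have h1 := height_eq_of_along ℓ.rep ℓ'.rep (PlaneLine.mem_points.1 hz)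
  rw [PlaneLine.mem_points.1 hz'] at h1
  rw [crossing, eq_div_iff (neg_ne_zero.2 hs)]
  linarith

theorem volume_crossing_eq_zero (p : ℝ × ℝ) (c : ℝ) :
    volume {p' : ℝ × ℝ | Real.sin (p'.1 - p.1) ≠ 0 ∧ crossing p p' = c} = 0 := by
  set z : Plane := c • PlaneLine.unitDir p.1 + p.2 • PlaneLine.unitNormal p.1 with hz
  have hcs := Real.sin_sq_add_cos_sq p.1
  have h0 : height p z = 0 := by
    simp [hz, height, PlaneLine.unitDir, PlaneLine.unitNormal]
    linear_combination p.2 * hcs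
  have h1 : along p.1 z = c := by
    simp [hz, along, PlaneLine.unitDir, PlaneLine.unitNormal]
    linear_combination c * hcs
  refine measure_mono_null (fun p' hp' => ?_) (volume_height_eq_zero z)
  have h2 := height_eq_of_along p p' h0
  rw [h1, ← hp'.2, crossing] at h2
  have hs := hp'.1
  simp only [mem_ofPred_eq]
  rw [h2]
  field_simp
  ring

theorem measurable_crossing : Measurable fun q : (ℝ × ℝ) × (ℝ × ℝ) => crossing q.1 q.2 := by
  unfold crossing
  refine Measurable.div ?_ ?_ <;> fun_prop

/-- The linear combination of crossings with the lines isolated by given cells. -/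
noncomputable def crossingSum (C : Configuration (PlaneLine × ℝ)) (m : PlaneLine × ℝ) :
    List (TopologicalSpace.countableBasis ((ℝ × ℝ) × ℝ) × ℚ) → ℝ
  | [] => 0
  | a :: l => a.2 * crossing m.1.rep
      (Configuration.pointIn (PlaneLine.ofParam 0, 0) (cell a.1) C).1.rep + crossingSum C m l

theorem measurable_crossingSum (l : List (TopologicalSpace.countableBasis ((ℝ × ℝ) × ℝ) × ℚ)) :
    Measurable fun q : Configuration (PlaneLine × ℝ) × (PlaneLine × ℝ) =>
      crossingSum q.1 q.2 l := by
  induction l with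
  | nil => exact measurable_const
  | cons a l ih =>
    refine Measurable.add
      (measurable_const.mul (measurable_crossing.comp (Measurable.prodMk ?_ ?_))) ih
    · exact PlaneLine.measurable_rep.comp (measurable_fst.comp measurable_snd)
    · exact PlaneLine.measurable_rep.comp (measurable_fst.comp
        ((Configuration.measurable_pointIn _ (measurableSet_cell
          (TopologicalSpace.isOpen_of_mem_countableBasis a.1.2).measurableSet)).comp
          measurable_fst))

theorem crossingSum_append (C : Configuration (PlaneLine × ℝ)) (m : PlaneLine × ℝ)
    (l l' : List (TopologicalSpace.countableBasis ((ℝ × ℝ) × ℝ) × ℚ)) :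
    crossingSum C m (l ++ l') = crossingSum C m l + crossingSum C m l' := by
  induction l with
  | nil => simp [crossingSum]
  | cons a l ih => simp [crossingSum, ih, add_assoc]

theorem crossingSum_smul (C : Configuration (PlaneLine × ℝ)) (m : PlaneLine × ℝ) (q : ℚ)
    (l : List (TopologicalSpace.countableBasis ((ℝ × ℝ) × ℝ) × ℚ)) :
    crossingSum C m (l.map fun a => (a.1, q * a.2)) = q * crossingSum C m l := by
  induction l with
  | nil => simp [crossingSum]
  | cons a l ih => simp [crossingSum, ih, mul_add, mul_assoc]

/-- Almost surely, the positions of the crossings on any of the random lines are linearly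
independent over the rational numbers. -/
theorem ae_indep_crossings (hγ : 2 < γ) (hL : IsPoissonProcess P (markedLineIntensity γ) L) :
    ∀ᵐ ω ∂P, ∀ m ∈ L ω, ∀ p ∈ crossings (L ω) m,
      p ∉ Submodule.span ℚ (crossings (L ω) m \ {p}) := by
  have hcount := (TopologicalSpace.countable_countableBasis ((ℝ × ℝ) × ℝ)).to_subtype
  have hrep : Measurable fun m : PlaneLine × ℝ => m.1.rep :=
    PlaneLine.measurable_rep.comp measurable_fst
  -- the second of the lines is the one that is random, given all the others
  have h1 : ∀ᵐ ω ∂P, ∀ l : List (TopologicalSpace.countableBasis ((ℝ × ℝ) × ℝ) × ℚ),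
      ∀ m' ∈ L ω, ∀ m ∈ L ω, m' ≠ m →
      (((⟨L ω \ {m'}⟩ : Configuration (PlaneLine × ℝ)), m), m') ∉
        {a : (Configuration (PlaneLine × ℝ) × (PlaneLine × ℝ)) × (PlaneLine × ℝ) |
          Real.sin (a.2.1.rep.1 - a.1.2.1.rep.1) ≠ 0 ∧
            crossing a.1.2.1.rep a.2.1.rep = crossingSum a.1.1 a.1.2 l} := by
    refine ae_all_iff.2 fun l => ?_
    have hF : MeasurableSet
        {a : (Configuration (PlaneLine × ℝ) × (PlaneLine × ℝ)) × (PlaneLine × ℝ) |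
          Real.sin (a.2.1.rep.1 - a.1.2.1.rep.1) ≠ 0 ∧
            crossing a.1.2.1.rep a.2.1.rep = crossingSum a.1.1 a.1.2 l} := by
      have h2 := hrep.comp (measurable_snd :
        Measurable (Prod.snd : (Configuration (PlaneLine × ℝ) × (PlaneLine × ℝ)) × _ → _))
      have h3 := hrep.comp ((measurable_snd.comp measurable_fst :
        Measurable fun a : (Configuration (PlaneLine × ℝ) × (PlaneLine × ℝ)) × (PlaneLine × ℝ) =>
          a.1.2))
      refine MeasurableSet.inter ?_ ?_
      · exact (Real.measurable_sin.comp ((measurable_fst.comp h2).sub (measurable_fst.comp h3)))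
          (measurableSet_singleton 0).compl
      · exact measurableSet_eq_fun (measurable_crossing.comp (h3.prodMk h2))
          ((measurable_crossingSum l).comp measurable_fst)
    refine ae_forall_pair_notMem hγ hL hF fun C k₀ m _ => markedLineIntensity_eq_zero
      (measurable_prodMk_left (x := (C, m)) hF) fun w _ => ?_
    refine measure_mono_null (fun p hp => ?_)
      (volume_crossing_eq_zero m.1.rep (crossingSum C m l))
    have h2 : Real.sin ((PlaneLine.ofParam p).rep.1 - m.1.rep.1) ≠ 0 ∧
      crossing m.1.rep (PlaneLine.ofParam p).rep = crossingSum C m l := hp.2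
    rwa [PlaneLine.rep_ofParam hp.1] at h2
  filter_upwards [h1, ae_speedRegular hγ hL, ae_inGeneralDirections hγ hL] with ω hω ⟨k₀, hreg⟩ hdir
    m hm p hp hspan
  obtain ⟨m', hm', hne, z, hz, hz', hzp⟩ := hp
  have hang := hdir.angle_ne m hm m' hm' (Ne.symm hne)
  have hpc : p = crossing m.1.rep m'.1.rep := by rw [← hzp, along_eq_crossing hang hz hz']
  have hex : ∃ l, p = crossingSum ⟨L ω \ {m'}⟩ m l := by
    refine Submodule.span_induction (p := fun c _ => ∃ l, c = crossingSum ⟨L ω \ {m'}⟩ m l)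
      ?_ ⟨[], rfl⟩ ?_ ?_ hspan
    · rintro c ⟨⟨m₁, hm₁, hne₁, z₁, hz₁, hz₁', hzc⟩, hcp⟩
      have hcc : c = crossing m.1.rep m₁.1.rep := by
        rw [← hzc, along_eq_crossing (hdir.angle_ne m hm m₁ hm₁ (Ne.symm hne₁)) hz₁ hz₁']
      have hm₁' : m₁ ∈ L ω \ {m'} := by
        refine ⟨hm₁, ?_⟩
        rintro rfl
        exact hcp (hcc.trans hpc.symm)
      obtain ⟨U, hU, hmU⟩ := (hreg.subset (sdiff_subset (s := L ω) (t := {m'}))).exists_cell hm₁'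
        (hdir.pos m₁ hm₁)
      refine ⟨[(⟨U, hU⟩, 1)], ?_⟩
      rw [crossingSum, crossingSum, Configuration.pointIn_eq (C := ⟨L ω \ {m'}⟩) hmU, hcc]
      simp
    · rintro c c' - - ⟨l, rfl⟩ ⟨l', rfl⟩
      exact ⟨l ++ l', (crossingSum_append _ _ _ _).symm⟩
    · rintro q c - ⟨l, rfl⟩
      exact ⟨_, (Rat.smul_def q _).trans (crossingSum_smul _ _ q l).symm⟩
  obtain ⟨l, hl⟩ := hex
  exact hω l m' hm' m hm hne ⟨sin_sub_ne_zero m.1.rep_mem m'.1.rep_mem hang, hpc.symm.trans hl⟩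

end process

/-! ### Steep rotations are exceptional -/

theorem SteepAt.exists_forall_real {f : ℝ → ℝ≥0∞} (hf : LowerSemicontinuous f) {θ : ℝ}
    (h : SteepAt f 1 θ) (K : ℕ) : ∃ j : ℕ, ∀ x : ℝ, 0 < x → x < 1 / ((j : ℝ) + 1) →
      f (θ + x) + ENNReal.ofReal (K * x) ≤ f θ := by
  obtain ⟨j, hj⟩ := h.2 K
  refine ⟨j, fun x hx hxj => ?_⟩
  by_contra! hlt
  have hF : LowerSemicontinuous fun x : ℝ => f (θ + x) + ENNReal.ofReal (K * x) := by
    have hc : Continuous fun x : ℝ => ENNReal.ofReal (K * x) :=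
      ENNReal.continuous_ofReal.comp (by fun_prop)
    exact (hf.comp (continuous_const.add continuous_id)).add hc.lowerSemicontinuous
  obtain ⟨a, b, hab, hsub⟩ := mem_nhds_iff_exists_Ioo_subset.1 (hF x _ hlt)
  obtain ⟨r, hr, hr'⟩ := exists_rat_btwn (max_lt hab.1 hx)
  have h1 : f θ < f (θ + r) + ENNReal.ofReal (K * r) :=
    hsub ⟨(le_max_left _ _).trans_lt hr, hr'.trans hab.2⟩
  have h2 := hj r ((le_max_right _ _).trans_lt hr) (hr'.trans hxj)
  rw [one_mul] at h2
  exact absurd h1 (not_lt.2 h2)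

/-- The points of a short interval from which a bounded function decreases, at an infinite rate at
first, form a null set: the function is monotone on this set, hence almost everywhere
differentiable. -/
theorem volume_steep_piece {f : ℝ → ℝ≥0∞} (hf : LowerSemicontinuous f) {T : Set ℝ} {M : ℕ} {δ : ℝ}
    (hM : ∀ θ ∈ T, f θ ≤ M) (hT : ∀ θ ∈ T, SteepAt f 1 θ)
    (hdec : ∀ θ ∈ T, ∀ x, 0 < x → x < δ → f (θ + x) ≤ f θ)
    (hdiam : ∀ θ ∈ T, ∀ θ' ∈ T, θ' - θ < δ) : volume T = 0 := by
  have hne : ∀ θ ∈ T, f θ ≠ ⊤ := fun θ hθ => ne_top_of_le_ne_top (by simp) (hM θ hθ)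
  have hanti : AntitoneOn (fun θ => (f θ).toReal) T := by
    intro θ hθ θ' hθ' hle
    rcases hle.eq_or_lt with rfl | hlt
    · exact le_rfl
    · refine ENNReal.toReal_mono (hne θ hθ) ?_
      have := hdec θ hθ (θ' - θ) (by linarith) (hdiam θ hθ θ' hθ')
      rwa [add_sub_cancel] at this
  obtain ⟨G, hG, hGT⟩ := hanti.exists_antitone_extension
    ⟨0, by rintro _ ⟨θ, -, rfl⟩; exact ENNReal.toReal_nonneg⟩
    ⟨M, by
      rintro _ ⟨θ, hθ, rfl⟩
      exact (ENNReal.toReal_mono (by simp) (hM θ hθ)).trans_eq (by simp)⟩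
  have hdiff : volume {θ | ¬ DifferentiableAt ℝ G θ} = 0 := by
    have := hG.neg.ae_differentiableAt
    refine measure_mono_null (fun θ hθ => ?_) (ae_iff.1 this)
    intro h
    exact hθ (by simpa using h.neg)
  have hiso : volume {θ ∈ T | 𝓝[T ∩ Ioi θ] θ = ⊥} = 0 :=
    (countable_setOfPred_isolated_right_within (s := T)).measure_zero _
  refine measure_mono_null (fun θ hθ => ?_) (measure_union_null hdiff hiso)
  by_contra hcon
  simp only [mem_union, mem_ofPred_eq, not_or, not_not, not_and] at hcon
  obtain ⟨hd, hnb⟩ := hcon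
  have hnb : (𝓝[T ∩ Ioi θ] θ).NeBot := ⟨hnb hθ⟩
  obtain ⟨K, hK⟩ := exists_nat_gt (-deriv G θ)
  obtain ⟨j, hj⟩ := (hT θ hθ).exists_forall_real hf K
  have hslope : Tendsto (slope G θ) (𝓝[T ∩ Ioi θ] θ) (𝓝 (deriv G θ)) :=
    (hasDerivAt_iff_tendsto_slope.1 hd.hasDerivAt).mono_left
      (nhdsWithin_mono _ fun y hy => ne_of_gt hy.2)
  have hle : ∀ᶠ y in 𝓝[T ∩ Ioi θ] θ, slope G θ y ≤ -K := by
    have h1 : ∀ᶠ y in 𝓝 θ, y < θ + 1 / ((j : ℝ) + 1) :=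
      gt_mem_nhds (lt_add_of_pos_right _ (by positivity))
    filter_upwards [self_mem_nhdsWithin, h1.filter_mono nhdsWithin_le_nhds] with y hy hyj
    have hpos : 0 < y - θ := sub_pos.2 hy.2
    have h2 := hj (y - θ) hpos (by linarith)
    rw [add_sub_cancel] at h2
    have h3 := ENNReal.toReal_mono (hne θ hθ) h2
    rw [ENNReal.toReal_add (hne y hy.1) ENNReal.ofReal_ne_top,
      ENNReal.toReal_ofReal (by positivity)] at h3
    rw [slope_def_field, ← hGT hθ, ← hGT hy.1, div_le_iff₀ hpos]
    linarith
  have := le_of_tendsto hslope hle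
  linarith

theorem volume_steepAt_one {f : ℝ → ℝ≥0∞} (hf : LowerSemicontinuous f) :
    volume {θ | SteepAt f 1 θ} = 0 := by
  set T : ℕ → ℕ → ℤ → Set ℝ := fun j M i => {θ | f θ ≤ M ∧ SteepAt f 1 θ ∧
    (∀ x, 0 < x → x < 1 / ((j : ℝ) + 1) → f (θ + x) ≤ f θ) ∧
      ⌊θ * (2 * ((j : ℝ) + 1))⌋ = i} with hT
  have hnull : volume (⋃ j, ⋃ M, ⋃ i, T j M i) = 0 := by
    refine measure_iUnion_null fun j => measure_iUnion_null fun M => measure_iUnion_null fun i => ?_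
    refine volume_steep_piece hf (fun θ hθ => hθ.1) (fun θ hθ => hθ.2.1) (fun θ hθ => hθ.2.2.1)
      fun θ hθ θ' hθ' => ?_
    have h1 := Int.floor_le (θ * (2 * ((j : ℝ) + 1)))
    have h2 := Int.lt_floor_add_one (θ' * (2 * ((j : ℝ) + 1)))
    rw [hθ.2.2.2] at h1
    rw [hθ'.2.2.2] at h2
    have hj : (0 : ℝ) < (j : ℝ) + 1 := by positivity
    rw [lt_div_iff₀ hj]
    nlinarith
  refine measure_mono_null (fun θ hθ => ?_) hnull
  have hθ : SteepAt f 1 θ := hθ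
  obtain ⟨M, hM⟩ := ENNReal.exists_nat_gt hθ.1.ne
  obtain ⟨j, hj⟩ := hθ.exists_forall_real hf 0
  simp only [mem_iUnion]
  exact ⟨j, M, _, hM.le, hθ, fun x hx hxj => by simpa using hj x hx hxj, rfl⟩

/-- A lower semicontinuous function decreases at an infinite rate from almost no point. -/
theorem volume_steepAt {f : ℝ → ℝ≥0∞} (hf : LowerSemicontinuous f) {ε : ℝ} (hε : ε = 1 ∨ ε = -1) :
    volume {θ | SteepAt f ε θ} = 0 := by
  rcases hε with rfl | rfl
  · exact volume_steepAt_one hf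
  · have h1 := volume_steepAt_one (f := fun t => f (-t)) (hf.comp continuous_neg)
    rw [← Measure.measure_preimage_neg] at h1
    refine measure_mono_null (fun θ hθ => ?_) h1
    obtain ⟨h2, h3⟩ : SteepAt f (-1) θ := hθ
    refine ⟨by simpa using h2, fun K => ?_⟩
    obtain ⟨j, hj⟩ := h3 K
    refine ⟨j, fun x hx hxj => ?_⟩
    have := hj x hx hxj
    simp only [neg_add_rev, neg_neg, one_mul]
    rw [add_comm (-(x : ℝ))]
    simpa using this

theorem measurableSet_steepAt {α : Type*} [MeasurableSpace α] {f : α → ℝ → ℝ≥0∞} {θ : α → ℝ}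
    {ε : ℝ} (h0 : Measurable fun a => f a (θ a))
    (h : ∀ r : ℚ, Measurable fun a => f a (θ a + ε * r)) :
    MeasurableSet {a | SteepAt (f a) ε (θ a)} := by
  have e : {a | SteepAt (f a) ε (θ a)} = {a | f a (θ a) < ⊤} ∩
      ⋂ K : ℕ, ⋃ j : ℕ, ⋂ r : ℚ, {_a | (0 : ℝ) < r}ᶜ ∪ ({_a | (r : ℝ) < 1 / ((j : ℝ) + 1)}ᶜ ∪
        {a | f a (θ a + ε * r) + ENNReal.ofReal (K * r) ≤ f a (θ a)}) := by
    ext a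
    simp only [SteepAt, mem_ofPred_eq, mem_inter_iff, mem_iInter, mem_iUnion, mem_union,
      mem_compl_iff, imp_iff_not_or]
  rw [e]
  refine (measurableSet_lt h0 measurable_const).inter (MeasurableSet.iInter fun K =>
    MeasurableSet.iUnion fun j => MeasurableSet.iInter fun r => ?_)
  exact (MeasurableSet.const _).compl.union ((MeasurableSet.const _).compl.union
    (measurableSet_le ((h r).add measurable_const) h0))

theorem measurable_ordinate (q : ℝ) : Measurable fun p : ℝ × ℝ => ordinate p q := by
  unfold ordinate
  refine Measurable.div ?_ ?_ <;> fun_prop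

theorem continuous_vec (q : ℝ) : Continuous fun a : ℝ => (!₂[q, a] : Plane) := by
  refine (PiLp.continuous_toLp 2 _).comp (continuous_pi fun i => ?_)
  fin_cases i
  · exact continuous_const
  · exact continuous_id

theorem measurable_pointAt (q : ℝ) : Measurable fun p : ℝ × ℝ => pointAt p q :=
  (continuous_vec q).measurable.comp (measurable_ordinate q)

/-- For almost all lines, rotating the line about its point of abscissa `q` does not shorten the
travel time from this point to a fixed point at an infinite rate. -/
theorem volume_steep_rotation {C : Configuration (PlaneLine × ℝ)} {k₀ : ℕ}
    (hC : SpeedRegular C.points k₀) (w q : ℝ) (z : Plane) {ε : ℝ} (hε : ε = 1 ∨ ε = -1) :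
    volume {p : ℝ × ℝ | Real.cos p.1 ≠ 0 ∧ SteepAt (fun θ => travelTime
      (insert (PlaneLine.ofParam (pencil q (ordinate p q) θ), w) C.points) (pointAt p q) z) ε p.1} =
      0 := by
  set G : ℝ → ℝ → ℝ≥0∞ := fun a θ =>
    travelTime (insert (PlaneLine.ofParam (pencil q a θ), w) C.points) !₂[q, a] z with hG
  have hpencil : Continuous fun b : ℝ × ℝ => pencil q b.1 b.2 := by unfold pencil; fun_prop
  have hmeas : MeasurableSet {b : ℝ × ℝ | SteepAt (G b.1) ε b.2} := by
    have key : ∀ g : ℝ × ℝ → ℝ, Measurable g → Measurable fun b : ℝ × ℝ => G b.1 (g b) := by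
      intro g hg
      simp only [hG, ← iSup_chainTime_insert hC]
      refine measurable_iSup_chainTime (c := fun _ => C) measurable_const ?_
        ((continuous_vec q).measurable.comp measurable_fst) measurable_const
      exact (PlaneLine.measurable_ofParam.comp (hpencil.measurable.comp
        (measurable_fst.prodMk hg))).prodMk measurable_const
    exact measurableSet_steepAt (key _ measurable_snd)
      fun r => key _ (measurable_snd.add measurable_const)
  have hnull : volume {b : ℝ × ℝ | SteepAt (G b.1) ε b.2} = 0 := by
    rw [Measure.volume_eq_prod]
    refine (Measure.measure_prod_null hmeas).2 (Eventually.of_forall fun a => ?_)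
    obtain ⟨k, hk⟩ := pow_unbounded_of_one_lt w (one_lt_two)
    exact volume_steepAt (lowerSemicontinuous_travelTime (hC.mono (le_max_left k₀ k))
      (hk.le.trans (pow_le_pow_right₀ one_le_two (le_max_right _ _))) (continuous_pencil q a)
      !₂[q, a] z) hε
  have himg := addHaar_image_eq_zero_of_differentiableOn_of_addHaar_eq_zero
    (μ := (volume : Measure (ℝ × ℝ))) (f := fun b : ℝ × ℝ => pencil q b.1 b.2)
    (s := {b : ℝ × ℝ | SteepAt (G b.1) ε b.2}) (by
      have : Differentiable ℝ fun b : ℝ × ℝ => pencil q b.1 b.2 := by unfold pencil; fun_prop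
      exact this.differentiableOn) hnull
  refine measure_mono_null (fun p hp => ?_) himg
  exact ⟨(ordinate p q, p.1), hp.2, pencil_ordinate hp.1 q⟩

/-- The travel time of `rotatedTime`, for a line `m` added to the family `C`, as a limit of its
approximations. -/
noncomputable def approxRotatedTime (C : Configuration (PlaneLine × ℝ)) (m' m : PlaneLine × ℝ)
    (q q' θ : ℝ) : ℝ≥0∞ :=
  ⨆ n, chainTime (insert (PlaneLine.ofParam (pencil q (ordinate m.1.rep q) θ), m.2) C.points) n
    (pointAt m.1.rep q) (pointAt m'.1.rep q')

theorem approxRotatedTime_eq {C : Configuration (PlaneLine × ℝ)} {k₀ : ℕ}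
    (hC : SpeedRegular C.points k₀) (m' m : PlaneLine × ℝ) (q q' θ : ℝ) :
    approxRotatedTime C m' m q q' θ =
      travelTime (insert (PlaneLine.ofParam (pencil q (ordinate m.1.rep q) θ), m.2) C.points)
        (pointAt m.1.rep q) (pointAt m'.1.rep q') :=
  iSup_chainTime_insert hC _ _ _

theorem measurable_approxRotatedTime {α : Type*} [MeasurableSpace α]
    {c : α → Configuration (PlaneLine × ℝ)} (hc : Measurable c) {m' m : α → PlaneLine × ℝ}
    (hm' : Measurable m') (hm : Measurable m) {g : α → ℝ} (hg : Measurable g) (q q' : ℝ) :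
    Measurable fun a => approxRotatedTime (c a) (m' a) (m a) q q' (g a) := by
  have hrep : Measurable fun m : PlaneLine × ℝ => m.1.rep :=
    PlaneLine.measurable_rep.comp measurable_fst
  have hpencil : Continuous fun b : ℝ × ℝ => pencil q b.1 b.2 := by unfold pencil; fun_prop
  refine measurable_iSup_chainTime hc ?_ ((measurable_pointAt q).comp (hrep.comp hm))
    ((measurable_pointAt q').comp (hrep.comp hm'))
  exact (PlaneLine.measurable_ofParam.comp (hpencil.measurable.comp
    (((measurable_ordinate q).comp (hrep.comp hm)).prodMk hg))).prodMk (measurable_snd.comp hm)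

section process

variable {Ω : Type*} [MeasurableSpace Ω] {P : Measure Ω} [IsProbabilityMeasure P] {γ : ℝ}
  {L : Ω → Set (PlaneLine × ℝ)}

theorem ae_noSteepRotation (hγ : 2 < γ) (hL : IsPoissonProcess P (markedLineIntensity γ) L) :
    ∀ᵐ ω ∂P, NoSteepRotation (L ω) := by
  have hangle : Measurable fun a : (Configuration (PlaneLine × ℝ) × (PlaneLine × ℝ)) ×
      (PlaneLine × ℝ) => a.2.1.rep.1 :=
    measurable_fst.comp (PlaneLine.measurable_rep.comp (measurable_fst.comp measurable_snd))
  have h1 : ∀ ε : ℝ, ε = 1 ∨ ε = -1 → ∀ᵐ ω ∂P, ∀ q q' : ℚ, ∀ m ∈ L ω, ∀ m' ∈ L ω, m ≠ m' →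
      (((⟨L ω \ {m}⟩ : Configuration (PlaneLine × ℝ)), m'), m) ∉
        {a : (Configuration (PlaneLine × ℝ) × (PlaneLine × ℝ)) × (PlaneLine × ℝ) |
          Real.cos a.2.1.rep.1 ≠ 0 ∧
            SteepAt (approxRotatedTime a.1.1 a.1.2 a.2 q q') ε a.2.1.rep.1} := by
    intro ε hε
    refine ae_all_iff.2 fun q => ae_all_iff.2 fun q' => ?_
    have hF : MeasurableSet
        {a : (Configuration (PlaneLine × ℝ) × (PlaneLine × ℝ)) × (PlaneLine × ℝ) |
          Real.cos a.2.1.rep.1 ≠ 0 ∧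
            SteepAt (approxRotatedTime a.1.1 a.1.2 a.2 q q') ε a.2.1.rep.1} := by
      have key : ∀ {g : (Configuration (PlaneLine × ℝ) × (PlaneLine × ℝ)) × (PlaneLine × ℝ) → ℝ},
          Measurable g → Measurable fun a => approxRotatedTime a.1.1 a.1.2 a.2 q q' (g a) :=
        fun hg => measurable_approxRotatedTime (measurable_fst.comp measurable_fst)
          (measurable_snd.comp measurable_fst) measurable_snd hg q q'
      refine MeasurableSet.inter
        ((Real.measurable_cos.comp hangle) (measurableSet_singleton 0).compl) ?_
      exact measurableSet_steepAt (key hangle) fun r => key (hangle.add measurable_const)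
    refine ae_forall_pair_notMem hγ hL hF fun C k₀ m' hC => markedLineIntensity_eq_zero
      (measurable_prodMk_left (x := (C, m')) hF) fun w _ => ?_
    refine measure_mono_null (fun p hp => ?_)
      (volume_steep_rotation hC w q (pointAt m'.1.rep q') hε)
    have h4 : Real.cos (PlaneLine.ofParam p).rep.1 ≠ 0 ∧ SteepAt
      (fun θ => approxRotatedTime C m' (PlaneLine.ofParam p, w) q q' θ) ε
        (PlaneLine.ofParam p).rep.1 := hp.2
    simp only [approxRotatedTime_eq hC, PlaneLine.rep_ofParam hp.1] at h4
    exact h4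
  filter_upwards [h1 1 (Or.inl rfl), h1 (-1) (Or.inr rfl), ae_cos_ne_zero hL,
    ae_speedRegular hγ hL] with ω hω hω' hcos ⟨k₀, hreg⟩ m hm m' hm' hne q q' ε hε hsteep
  have hreg' : SpeedRegular (⟨L ω \ {m}⟩ : Configuration (PlaneLine × ℝ)).points k₀ :=
    hreg.subset sdiff_subset
  have h4 : SteepAt (fun θ => approxRotatedTime ⟨L ω \ {m}⟩ m' m q q' θ) ε m.1.rep.1 := by
    simp only [approxRotatedTime_eq hreg']
    exact hsteep
  rcases hε with rfl | rfl
  · exact hω q q' m hm m' hm' hne ⟨hcos m hm, h4⟩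
  · exact hω' q q' m hm m' hm' hne ⟨hcos m hm, h4⟩

end process

/-! ### Finite travel times -/

/-- Two lines that make a large angle and pass near `x` cross near `x`. -/
theorem exists_crossing_near {ℓ ℓ' : PlaneLine} (h : 1 / 2 ≤ Real.sin (ℓ'.rep.1 - ℓ.rep.1))
    (x : Plane) : ∃ z, z ∈ ℓ.points ∧ z ∈ ℓ'.points ∧
      dist z x ≤ 4 * (|height ℓ.rep x| + |height ℓ'.rep x|) := by
  set θ := ℓ.rep.1 with hθ
  set θ' := ℓ'.rep.1 with hθ'
  set a := height ℓ.rep x with ha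
  set b := height ℓ'.rep x with hb
  set s := Real.sin (θ' - θ) with hs
  have hs0 : 0 < s := by linarith
  have hse : s = Real.sin θ' * Real.cos θ - Real.cos θ' * Real.sin θ := Real.sin_sub _ _
  have hbound : ∀ c c' : ℝ, |c| ≤ 1 → |c'| ≤ 1 → |(a * c - b * c') / s| ≤ 2 * (|a| + |b|) := by
    intro c c' hc hc'
    rw [abs_div, abs_of_pos hs0, div_le_iff₀ hs0]
    have h1 : |a * c - b * c'| ≤ |a| + |b| := by
      refine (abs_sub _ _).trans (add_le_add ?_ ?_)
      · rw [abs_mul]; exact mul_le_of_le_one_right (abs_nonneg _) hc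
      · rw [abs_mul]; exact mul_le_of_le_one_right (abs_nonneg _) hc'
    have h2 : 0 ≤ |a| + |b| := by positivity
    nlinarith
  refine ⟨!₂[x 0 - (a * Real.cos θ' - b * Real.cos θ) / s,
    x 1 - (a * Real.sin θ' - b * Real.sin θ) / s], ?_, ?_, ?_⟩
  · rw [PlaneLine.mem_points]
    have h1 : a = -Real.sin θ * x 0 + Real.cos θ * x 1 - ℓ.rep.2 := by rw [ha, height]
    simp only [height, Matrix.cons_val_zero, Matrix.cons_val_one, ← hθ]
    field_simp
    rw [hse]
    linear_combination (-(Real.sin θ' * Real.cos θ - Real.cos θ' * Real.sin θ)) * h1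
  · rw [PlaneLine.mem_points]
    have h1 : b = -Real.sin θ' * x 0 + Real.cos θ' * x 1 - ℓ'.rep.2 := by rw [hb, height]
    simp only [height, Matrix.cons_val_zero, Matrix.cons_val_one, ← hθ']
    field_simp
    rw [hse]
    linear_combination (-(Real.sin θ' * Real.cos θ - Real.cos θ' * Real.sin θ)) * h1
  · have hS : 0 ≤ |a| + |b| := by positivity
    refine le_of_sq_le_sq ?_ (by positivity)
    rw [dist_sq_coord]
    have h0 := hbound _ _ (Real.abs_cos_le_one θ') (Real.abs_cos_le_one θ)
    have h1 := hbound _ _ (Real.abs_sin_le_one θ') (Real.abs_sin_le_one θ)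
    simp only [Matrix.cons_val_zero, Matrix.cons_val_one]
    have h0' := sq_le_sq' (abs_le.1 h0).1 (abs_le.1 h0).2
    have h1' := sq_le_sq' (abs_le.1 h1).1 (abs_le.1 h1).2
    nlinarith

theorem half_le_sin_sub {θ θ' : ℝ} (h : θ ∈ Icc 0 1)
    (h' : θ' ∈ Icc (Real.pi / 2) (Real.pi / 2 + 1)) : 1 / 2 ≤ Real.sin (θ' - θ) := by
  rw [← Real.cos_pi_div_three, ← Real.cos_pi_div_two_sub, ← Real.cos_abs (Real.pi / 2 - _)]
  have hpi := Real.pi_gt_three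
  refine Real.cos_le_cos_of_nonneg_of_le_pi (abs_nonneg _) (by linarith) ?_
  rw [abs_le]
  constructor <;> linarith [h.1, h.2, h'.1, h'.2]

/-- If two transversal directions contain ever closer lines whose speeds decay more slowly than
their distances from `x`, then zigzagging along these lines leads to `x` in finite time. -/
theorem SpeedRegular.exists_travelTime_lt_top {C : Set (PlaneLine × ℝ)} {k₀ : ℕ}
    (hC : SpeedRegular C k₀) (x : Plane) {b : ℝ} (hb : 1 / 2 < b)
    (hH : ∀ᶠ n : ℕ in atTop, (C ∩ window (Icc 0 1) x ((1 / 2) ^ n) (b ^ n)).Nonempty)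
    (hV : ∀ᶠ n : ℕ in atTop,
      (C ∩ window (Icc (Real.pi / 2) (Real.pi / 2 + 1)) x ((1 / 2) ^ n) (b ^ n)).Nonempty) :
    ∃ z, travelTime C z x < ⊤ ∧
      (∃ m ∈ C, 0 < m.2 ∧ m.1.rep.1 ∈ Icc 0 1 ∧ z ∈ m.1.points) ∧
      ∃ m ∈ C, 0 < m.2 ∧ m.1.rep.1 ∈ Icc (Real.pi / 2) (Real.pi / 2 + 1) ∧ z ∈ m.1.points := by
  obtain ⟨N, hN⟩ := eventually_atTop.1 (hH.and hV)
  have hb0 : 0 < b := by linarith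
  have hH' : ∀ n, ∃ m, m ∈ C ∩ window (Icc 0 1) x ((1 / 2) ^ (N + n)) (b ^ (N + n)) :=
    fun n => (hN (N + n) (Nat.le_add_right _ _)).1
  have hV' : ∀ n, ∃ m, m ∈ C ∩ window (Icc (Real.pi / 2) (Real.pi / 2 + 1)) x
      ((1 / 2) ^ (N + n)) (b ^ (N + n)) := fun n => (hN (N + n) (Nat.le_add_right _ _)).2
  choose H hHC hHI using hH'
  choose V hVC hVI using hV'
  have hHpos : ∀ n, 0 < (H n).2 := fun n => (pow_pos hb0 _).trans_le (hHI n).2.2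
  have hVpos : ∀ n, 0 < (V n).2 := fun n => (pow_pos hb0 _).trans_le (hVI n).2.2
  choose z hzH hzV hzx using fun n =>
    exists_crossing_near (half_le_sin_sub (hHI n).1 (hVI n).1) x
  choose z' hz'H hz'V hz'x using fun n =>
    exists_crossing_near (half_le_sin_sub (hHI (n + 1)).1 (hVI n).1) x
  have hδ : ∀ n, dist (z n) x ≤ 8 * (1 / 2) ^ (N + n) := fun n => by
    linarith [hzx n, (hHI n).2.1, (hVI n).2.1]
  have hδ' : ∀ n, dist (z' n) x ≤ 8 * (1 / 2) ^ (N + n) := fun n => by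
    have h1 : ((1 : ℝ) / 2) ^ (N + (n + 1)) ≤ (1 / 2) ^ (N + n) :=
      pow_le_pow_of_le_one (by norm_num) (by norm_num) (by omega)
    linarith [hz'x n, (hHI (n + 1)).2.1, (hVI n).2.1]
  set r := 1 / (2 * b) with hr
  have hr0 : 0 < r := by positivity
  have hr1 : r < 1 := by rw [hr, div_lt_one (by positivity)]; linarith
  -- a step along a line of speed at least `b ^ k`
  have hstep : ∀ {m : PlaneLine × ℝ} {p p' : Plane} {k n : ℕ}, m ∈ C → b ^ k ≤ m.2 →
      p ∈ m.1.points → p' ∈ m.1.points → dist p x ≤ 8 * (1 / 2) ^ n → dist p' x ≤ 8 * (1 / 2) ^ n →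
      travelTime C p p' ≤ ENNReal.ofReal (16 * (1 / 2) ^ n / b ^ k) := by
    intro m p p' k n hm hk hp hp' hd hd'
    have hbk : 0 < b ^ k := pow_pos hb0 k
    refine (travelTime_le_of_mem hm (hbk.trans_le hk) hp hp').trans ?_
    rw [edist_dist, ← ENNReal.ofReal_div_of_pos (hbk.trans_le hk)]
    refine ENNReal.ofReal_le_ofReal (div_le_div₀ (by positivity) ?_ hbk hk)
    have := dist_triangle_right p p' x
    linarith
  have hpair : ∀ n, travelTime C (z n) (z (n + 1)) ≤
      ENNReal.ofReal ((16 + 16 / b) * r ^ (N + n)) := by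
    intro n
    have h1 := hstep (hVC n) (hVI n).2.2 (hzV n) (hz'V n) (hδ n) (hδ' n)
    have h2 := hstep (hHC (n + 1)) (hHI (n + 1)).2.2 (hz'H n) (hzH (n + 1)) (hδ' n)
      ((hδ (n + 1)).trans (mul_le_mul_of_nonneg_left
        (pow_le_pow_of_le_one (by norm_num) (by norm_num) (by omega)) (by norm_num)))
    refine (reachTime_triangle _ _ (z' n) _).trans ((add_le_add h1 h2).trans_eq ?_)
    rw [← ENNReal.ofReal_add (by positivity) (by positivity)]
    congr 1
    rw [hr, show N + (n + 1) = (N + n) + 1 by ring, pow_succ, div_pow, div_pow, mul_pow, one_pow]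
    field_simp
  set M := (16 + 16 / b) / (1 - r) with hM
  have hM0 : 0 ≤ M := div_nonneg (by positivity) (by linarith)
  have hchain : ∀ k, travelTime C (z 0) (z k) ≤
      ENNReal.ofReal (M * (1 - r ^ k)) := by
    intro k
    induction k with
    | zero => rw [travelTime, reachTime_self]; exact zero_le
    | succ k ih =>
      refine (reachTime_triangle _ _ (z k) _).trans ((add_le_add ih (hpair k)).trans ?_)
      have h1 : r ^ k ≤ 1 := pow_le_one₀ hr0.le hr1.le
      have h2 : r ^ (N + k) ≤ r ^ k := pow_le_pow_of_le_one hr0.le hr1.le (by omega)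
      rw [← ENNReal.ofReal_add (mul_nonneg hM0 (by linarith)) (by positivity)]
      refine ENNReal.ofReal_le_ofReal ?_
      have h3 : 16 + 16 / b = M * (1 - r) := by
        rw [hM, div_mul_cancel₀ _ (by linarith)]
      have h4 : (16 + 16 / b) * r ^ (N + k) ≤ (16 + 16 / b) * r ^ k :=
        mul_le_mul_of_nonneg_left h2 (by positivity)
      rw [pow_succ]
      rw [h3] at h4 ⊢
      nlinarith
  have hreach : ∀ k, Reach (silhouette C) (z 0) (z k) M := fun k =>
    hC.reach_of_reachTime_le hM0 ((hchain k).trans (ENNReal.ofReal_le_ofReal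
      (mul_le_of_le_one_right hM0 (by have := pow_pos hr0 k; linarith))))
  have hzlim : Tendsto z atTop (𝓝 x) := by
    rw [tendsto_iff_dist_tendsto_zero]
    have h0 : Tendsto (fun n : ℕ => 8 * ((1 : ℝ) / 2) ^ (N + n)) atTop (𝓝 0) := by
      have h1 := (tendsto_pow_atTop_nhds_zero_of_lt_one (r := (1 : ℝ) / 2) (by norm_num)
        (by norm_num)).const_mul (8 * (1 / 2) ^ N)
      rw [mul_zero] at h1
      refine h1.congr fun n => ?_
      rw [pow_add, mul_assoc]
    exact squeeze_zero (fun n => dist_nonneg) hδ h0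
  have hfinal : Reach (silhouette C) (z 0) x M :=
    hC.reach_of_tendsto tendsto_const_nhds hzlim tendsto_const_nhds (Eventually.of_forall hreach)
  exact ⟨z 0, hfinal.reachTime_le.trans_lt ENNReal.ofReal_lt_top,
    ⟨H 0, hHC 0, hHpos 0, (hHI 0).1, hzH 0⟩, ⟨V 0, hVC 0, hVpos 0, (hVI 0).1, hzV 0⟩⟩

theorem travelTime_lt_top_of_mem {C : Set (PlaneLine × ℝ)} {m : PlaneLine × ℝ} (hm : m ∈ C)
    (hw : 0 < m.2) {p q : Plane} (hp : p ∈ m.1.points) (hq : q ∈ m.1.points) :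
    travelTime C p q < ⊤ :=
  (travelTime_le_of_mem hm hw hp hq).trans_lt
    (ENNReal.div_lt_top (edist_ne_top _ _) (by simpa using hw))

section process

variable {Ω : Type*} [MeasurableSpace Ω] {P : Measure Ω} {γ : ℝ} {L : Ω → Set (PlaneLine × ℝ)}

/-- Almost surely, at all small scales `2 ^ (-n)` there are lines with directions in a given set
that pass `x` at this distance and have a speed of at least `2 ^ (-n * β)`, `β = γ / (2 * (γ - 1))`.
As `β > 1 / (γ - 1)`, the expected number of these lines grows with `n`; as `β < 1`, the times
needed to move along them at their scales are summable. -/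
theorem ae_eventually_window_nonempty (hγ : 2 < γ)
    (hL : IsPoissonProcess P (markedLineIntensity γ) L) (x : Plane) {I : Set ℝ}
    (hI : MeasurableSet I) (hIπ : I ⊆ Ico 0 Real.pi) (hI1 : volume I = 1) :
    ∀ᵐ ω ∂P, ∀ᶠ n : ℕ in atTop,
      (L ω ∩ window I x ((1 / 2) ^ n) (((2 : ℝ) ^ (-(γ / (2 * (γ - 1))))) ^ n)).Nonempty := by
  set b : ℝ := 2 ^ (-(γ / (2 * (γ - 1)))) with hb
  have hb0 : 0 < b := Real.rpow_pos_of_pos two_pos _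
  set c : ℝ := 2 ^ (γ / 2 - 1) with hc
  have hc1 : 1 < c := Real.one_lt_rpow one_lt_two (by linarith)
  have hcb : ∀ n : ℕ, (1 / 2 : ℝ) ^ n * (b ^ n) ^ (1 - γ) = c ^ n := by
    intro n
    have h1 : (b ^ n) ^ (1 - γ) = (b ^ (1 - γ)) ^ n := by
      rw [← Real.rpow_natCast, ← Real.rpow_mul hb0.le, mul_comm, Real.rpow_mul hb0.le,
        Real.rpow_natCast]
    have h2 : b ^ (1 - γ) = 2 ^ (γ / 2) := by
      rw [hb, ← Real.rpow_mul two_pos.le]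
      congr 1
      have : γ - 1 ≠ 0 := by linarith
      field_simp
      ring
    rw [h1, h2, ← mul_pow, hc, Real.rpow_sub two_pos, Real.rpow_one]
    congr 1
    ring
  have hΛ : ∀ n : ℕ, markedLineIntensity γ (window I x ((1 / 2) ^ n) (b ^ n)) =
      ENNReal.ofReal (c ^ n) := by
    intro n
    rw [markedLineIntensity_window hγ hI hIπ _ _ (pow_pos hb0 n), hI1, mul_one,
      show (2⁻¹ : ℝ≥0∞) = ENNReal.ofReal 2⁻¹ by rw [ENNReal.ofReal_inv_of_pos two_pos]; simp,
      ← ENNReal.ofReal_mul (by positivity), ← ENNReal.ofReal_mul (by positivity), ← hcb n]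
    congr 1
    ring
  have hle : ∀ n : ℕ, P {ω | L ω ∩ window I x ((1 / 2) ^ n) (b ^ n) = ∅} ≤
      ENNReal.ofReal ((1 / c) ^ n) := by
    intro n
    have hcn : 0 < c ^ n := pow_pos (by linarith) n
    rw [hL.measure_inter_eq_empty (measurableSet_window hI _ _ _)
      (by rw [hΛ]; exact ENNReal.ofReal_ne_top), hΛ, ENNReal.toReal_ofReal hcn.le]
    refine ENNReal.ofReal_le_ofReal ?_
    rw [Real.exp_neg, div_pow, one_pow, ← one_div]
    exact one_div_le_one_div_of_le hcn (by linarith [Real.add_one_le_exp (c ^ n)])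
  have hsum : ∑' n : ℕ, P {ω | L ω ∩ window I x ((1 / 2) ^ n) (b ^ n) = ∅} ≠ ⊤ := by
    have hs : Summable fun n : ℕ => (1 / c) ^ n :=
      summable_geometric_of_lt_one (by positivity) ((div_lt_one (by linarith)).2 hc1)
    exact ne_top_of_le_ne_top hs.tsum_ofReal_ne_top (ENNReal.tsum_le_tsum hle)
  filter_upwards [ae_eventually_notMem hsum] with ω hω
  filter_upwards [hω] with n hn
  exact nonempty_iff_ne_empty.2 hn

theorem ae_travelTime_ne_top [IsProbabilityMeasure P] (hγ : 2 < γ)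
    (hL : IsPoissonProcess P (markedLineIntensity γ) L) (x y : Plane) :
    ∀ᵐ ω ∂P, travelTime (L ω) x y ≠ ⊤ := by
  have hpi := Real.pi_gt_three
  have hI : Icc (0 : ℝ) 1 ⊆ Ico 0 Real.pi := fun θ hθ => ⟨hθ.1, by linarith [hθ.2]⟩
  have hI' : Icc (Real.pi / 2) (Real.pi / 2 + 1) ⊆ Ico 0 Real.pi :=
    fun θ hθ => ⟨by linarith [hθ.1], by linarith [hθ.2]⟩
  have hb : (1 / 2 : ℝ) < 2 ^ (-(γ / (2 * (γ - 1)))) := by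
    rw [show (1 / 2 : ℝ) = 2 ^ (-1 : ℝ) by rw [Real.rpow_neg_one]; norm_num]
    refine Real.rpow_lt_rpow_of_exponent_lt one_lt_two ?_
    have : γ / (2 * (γ - 1)) < 1 := by rw [div_lt_one (by linarith)]; linarith
    linarith
  have hH := fun z => ae_eventually_window_nonempty hγ hL z measurableSet_Icc hI (by simp)
  have hV := fun z => ae_eventually_window_nonempty hγ hL z measurableSet_Icc hI' (by simp)
  filter_upwards [hH x, hV x, hH y, hV y, ae_speedRegular hγ hL] with ω hHx hVx hHy hVy ⟨k₀, hreg⟩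
  obtain ⟨u, hu, ⟨m, hm, hmpos, hmI, hum⟩, -⟩ := hreg.exists_travelTime_lt_top x hb hHx hVx
  obtain ⟨u', hu', -, ⟨m', hm', hmpos', hmI', hum'⟩⟩ := hreg.exists_travelTime_lt_top y hb hHy hVy
  obtain ⟨p, hp, hp', -⟩ := exists_crossing_near (half_le_sin_sub hmI hmI') x
  have h1 : travelTime (L ω) x u < ⊤ := by rwa [travelTime, reachTime_comm]
  have h2 := travelTime_lt_top_of_mem hm hmpos hum hp
  have h3 := travelTime_lt_top_of_mem hm' hmpos' hp' hum'
  have h4 : travelTime (L ω) x y ≤ travelTime (L ω) x u + (travelTime (L ω) u p +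
      (travelTime (L ω) p u' + travelTime (L ω) u' y)) :=
    (reachTime_triangle _ _ u _).trans (add_le_add le_rfl ((reachTime_triangle _ _ p _).trans
      (add_le_add le_rfl (reachTime_triangle _ _ u' _))))
  exact (h4.trans_lt (ENNReal.add_lt_top.2 ⟨h1, ENNReal.add_lt_top.2 ⟨h2,
    ENNReal.add_lt_top.2 ⟨h3, hu'⟩⟩⟩)).ne

theorem ae_isGeneric [IsProbabilityMeasure P] (hγ : 2 < γ)
    (hL : IsPoissonProcess P (markedLineIntensity γ) L) (x y : Plane) :
    ∀ᵐ ω ∂P, IsGeneric (L ω) x y := by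
  filter_upwards [ae_inGeneralDirections hγ hL, ae_cos_ne_zero hL, ae_notMem_points hL x,
    ae_notMem_points hL y, ae_noSteepRotation hγ hL, ae_noCorner hγ hL x y,
    ae_indep_crossings hγ hL] with ω h1 h2 h3 h4 h5 h6 h7
  exact ⟨h1, h2, h3, h4, h5, h6, h7⟩

end process

theorem mainTheorem2 {Ω : Type*} [MeasurableSpace Ω] (P : MeasureTheory.Measure Ω)
    [MeasureTheory.IsProbabilityMeasure P] (γ : ℝ) (hγ : 2 < γ)
    (L : Ω → Set (PlaneLine × ℝ)) (hL : IsPoissonProcess P (markedLineIntensity γ) L)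
    (x y : Plane) :
    ∀ᵐ ω ∂P, ∃ (T : ℝ) (ξ : ℝ → Plane), IsLineGeodesic (L ω) x y T ξ ∧
      ∀ (T' : ℝ) (ξ' : ℝ → Plane), IsLineGeodesic (L ω) x y T' ξ' →
        T' = T ∧ Set.EqOn ξ' ξ (Set.Icc 0 T) := by
  filter_upwards [ae_speedRegular hγ hL, ae_isGeneric hγ hL x y, ae_travelTime_ne_top hγ hL x y]
    with ω ⟨k₀, hreg⟩ hG hfin
  exact exists_unique_geodesic hreg hG hfin
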